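/- **Setting.** Let $\mathbb T$ be $\{0,\dots,T\}$ with $T<\infty$, or $\mathbb N_0$, or $\mathbb N_0\cup\{\infty\}$ ($T=\infty$ in the last two cases), and $\mathbb T_s=\{r\in\mathbb T: r\ge s\}$. Let $(\Omega,\mathcal F,(\mathcal F_n)_{n\in\mathbb T\cap\mathbb N_0},P)$ be a filtered probability space with $\mathcal F_0=\{\emptyset,\Omega\}$, $\mathcal F=\mathcal F_T$, where $\mathcal F_\infty=\sigma(\bigcup_n\mathcal F_n)$. If $T=\infty$, assume that each $\mathcal F_n$ is $\sigma$-isomorphic to the Borel $\sigma$-field of a complete separable metric space, and that $\bigcap_nA_n\ne\emptyset$ for every decreasing sequence of atoms $A_n$ of $\mathcal F_n$. Let $\mu=(\mu_s)_{s\in\mathbb T}$ be an adapted process with $\mu_s>0$ and $\sum_{s\in\mathbb T}\mu_s=1$ $P$-a.s. Fix $t\in\mathbb T\cap\mathbb N_0$. Let $L^\infty=L^\infty(\Omega,\mathcal F,P)$, $L^\infty_t=L^\infty(\Omega,\mathcal F_t,P)$, and let $\mathcal R^\infty_t$ be the set of adapted, essentially bounded processes $X=(X_s)_{s\in\mathbb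 T}$ with $X_s=0$ for $s<t$ (modulo $P$-null sets). Let $\rho_t:\mathcal R_t^\infty\to L_t^\infty$ be a conditional convex risk measure for processes: for $X,Y\in\mathcal R^\infty_t$, $\rho_t(X+m1_{\mathbb T_t})=\rho_t(X)-m$ for $m\in L^\infty_t$; $X\le Y$ implies $\rho_t(X)\ge\rho_t(Y)$; $\rho_t(\lambda X+(1-\lambda)Y)\le\lambda\rho_t(X)+(1-\lambda)\rho_t(Y)$ for $\lambda\in L^\infty_t$, $0\le\lambda\le1$; and $\rho_t(0)=0$. Assume that $\rho_t$ is continuous from above: if $X^n_s\searrow X_s$ $P$-a.s. for all $s\in\mathbb T_t$, then $\rho_t(X^n)\nearrow\rho_t(X)$ $P$-a.s. Call $\rho_t$ *cash additive at time* $s\in\mathbb T$, $s>t$, if $\rho_t(X+m1_{\mathbb T_s})=\rho_t(X)-m$ for all $X\in\mathcal R_t^\infty$ and $m\in L^\infty_t$, and *cash additive* if this holds at every $s\in\mathbb T$ with $s>t$. **Models.** $\mathcal M_{\mathrm{loc}}(P)$ is the set of probability measures $Q$ on $\mathcal F$ with $Q\ll P$ on $\mathcal F_n$ for all $n\in\mathbb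 T\cap\mathbb N_0$. If $T=\infty$, let $M_\infty=\lim_n \frac{dQ}{dP}|_{\mathcal F_n}\in[0,\infty]$. $\Gamma(Q)$ is the set of adapted processes $\gamma=(\gamma_s)_{s\in\mathbb T}\geq 0$ with $\sum_{s\in\mathbb T}\gamma_s=1$ $Q$-a.s. and, if $\mathbb T=\mathbb N_0\cup\{\infty\}$, $\gamma_\infty=0$ $Q$-a.s. on $\{M_\infty=\infty\}$; $\Gamma_s(Q)=\{\gamma\in\Gamma(Q):\gamma_r=0\ \forall r<s\}$. $\mathcal D(Q)$ is the set of predictable, non-increasing processes $D=(D_s)_{s\in\mathbb T}\ge0$ with $D_0=1$ such that, $Q$-a.s., $D_n\to0$ if $\mathbb T=\mathbb N_0$, and $D_n\to D_\infty$, with $D_\infty=0$ on $\{M_\infty=\infty\}$, if $\mathbb T=\mathbb N_0\cup\{\infty\}$. It is identified with $\Gamma(Q)$ via $\gamma_n=D_n-D_{n+1}$ (with $D_{T+1}=0$ if $T<\infty$) and $\gamma_\infty=D_\infty$, so that $D_s=\sum_{r\in\mathbb T_s}\gamma_r$. Let $Q\otimes D=Q\otimes\gamma$ be the probability measure on the optional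 $\sigma$-field $\bar{\mathcal F}=\sigma(A\times\{s\}: s\in\mathbb T,A\in\mathcal F_s)$ of $\Omega\times\mathbb T$ given by $E_{Q\otimes\gamma}[X]=E_Q[\sum_{s\in\mathbb T}\gamma_sX_s]$, let $\bar P=P\otimes\mu$ and $\bar{\mathcal F}_t=\sigma(A_j\times\{j\},A_t\times\mathbb T_t: j<t, A_j\in\mathcal F_j,A_t\in\mathcal F_t)$. The penalty function is $$\alpha_t(Q\otimes\gamma)=\operatorname*{Q\text{-}ess\,sup}_{X\in\mathcal R_t^\infty,\ \rho_t(X)\le0}E_Q\Big[-\sum_{s\in\mathbb T_t}\frac{\gamma_s}{D_t}X_s\,\Big|\,\mathcal F_t\Big].$$ Let $\bar{\mathcal Q}_t^\alpha$ be the set of all $Q\otimes D\ll\bar P$ with $Q\in\mathcal M_{\mathrm{loc}}(P)$, $D\in\mathcal D(Q)$, $Q\otimes D=\bar P$ on $\bar{\mathcal F}_t$ and $\alpha_t(Q\otimes D)<\infty$ $Q$-a.s. Finally, $\mathcal Q_t^{\mathrm{loc}}=\{Q\in\mathcal M_{\mathrm{loc}}(P):Q=P\text{ on }\mathcal F_t\}$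 and $\mathcal Q_t=\{Q\ll P\text{ probability}:Q=P\text{ on }\mathcal F_t\}$. **Claim.** (1) For every $s\in\mathbb T$ with $s>t$ the following are equivalent: (a) $\rho_t$ is cash additive at time $s$; (b) $D_t=\dots=D_s$ $Q$-a.s. (i.e. $D_k=D_t$ for all $k\in\mathbb T$, $t\le k\le s$) for all $Q\otimes D\in\bar{\mathcal Q}_t^\alpha$; (c) for all $X\in\mathcal R_t^\infty$, $$\rho_t(X)=\operatorname*{ess\,sup}_{Q\in\mathcal Q_t^{\mathrm{loc}}}\operatorname*{ess\,sup}_{\gamma\in\Gamma_s(Q)}\Big(E_Q\Big[-\sum_{k\in\mathbb T_s}\gamma_kX_k\,\Big|\,\mathcal F_t\Big]-\alpha_t(Q\otimes\gamma)\Big).$$ In this case $\rho_t$ is cash additive at all times $k\in\mathbb T$ with $t<k\le s$. (2) If $T<\infty$ or $\mathbb T=\mathbb N_0\cup\{\infty\}$, the following are equivalent: (a) $\rho_t$ is cash additive; (b) for all $X\in\mathcal R_t^\infty$, $\rho_t(X)=\operatorname{ess\,sup}_{Q\in\mathcal Q_t}\big(E_Q[-X_T\,|\,\mathcal F_t]-\alpha_t(Q\otimes\delta_{\{T\}})\big)$,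 where $\delta_{\{T\}}$ is the Dirac measure at $T$; (c) $\rho_t(X)=\varphi(X_T)$ for all $X\in\mathcal R_t^\infty$, for some conditional convex risk measure for random variables $\varphi:L^\infty\to L_t^\infty$ (i.e. conditionally cash invariant, monotone, conditionally convex and normalized, as above). -/

import Mathlib

open MeasureTheory Filter Topology

noncomputable section

namespace ProcessRisk

/-! Time sets -/

/-- The three kinds of time sets: `{0, …, T}` with `T < ∞`, `ℕ₀`, and `ℕ₀ ∪ {∞}`. -/
inductive Horizon : Type
  | finite (T : ℕ)
  | nat
  | natTop

/-- The set `𝕋` of time points, as a subset of `ℕ₀ ∪ {∞}`. -/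
def Horizon.times : Horizon → Set ℕ∞
  | .finite T => Set.Iic (T : ℕ∞)
  | .nat => {s | s ≠ ⊤}
  | .natTop => Set.univ

/-- The time points as a type (ordered as a subset of `ℕ₀ ∪ {∞}`). -/
abbrev Horizon.Time (h : Horizon) : Type := {s : ℕ∞ // s ∈ h.times}

/-- `T = ∞`. -/
def Horizon.IsInfinite : Horizon → Prop
  | .finite _ => False
  | .nat => True
  | .natTop => True

variable {Ω : Type*} {mΩ : MeasurableSpace Ω} {h : Horizon}

/-! Filtration and processes -/

/-- `F_s` for `s ∈ ℕ₀ ∪ {∞}`, with `F_∞ = σ(⋃ₙ F_n)`. -/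
@[reducible] def sig (F : Filtration ℕ mΩ) : ℕ∞ → MeasurableSpace Ω
  | ⊤ => ⨆ n, F n
  | (n : ℕ) => F n

/-- The σ-field with respect to which the value at time `s` of a predictable process is
measurable: `F_{n-1}` at `n ≥ 1`, `F_0` at `0`, and `F_∞` at `∞`. -/
@[reducible] def predSig (F : Filtration ℕ mΩ) : ℕ∞ → MeasurableSpace Ω
  | ⊤ => ⨆ n, F n
  | (n : ℕ) => F (n - 1)

/-- `A` is an atom of the σ-field `m`. -/
def IsAtomOf (m : MeasurableSpace Ω) (A : Set Ω) : Prop :=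
  MeasurableSet[m] A ∧ A.Nonempty ∧ ∀ B ⊆ A, MeasurableSet[m] B → B = ∅ ∨ B = A

/-- Each `F_n` is σ-isomorphic to the Borel σ-field of a complete separable metric space, and
decreasing sequences of atoms `A_n` of `F_n` have nonempty intersection.  (A bijection between two
σ-fields that preserves and reflects inclusion is the same as one that preserves complements and
countable unions.) -/
structure IsStandardFiltration (F : Filtration ℕ mΩ) : Prop where
  standard : ∀ n, ∃ (S : Type) (mS : MeasurableSpace S), StandardBorelSpace S ∧
    Nonempty ({A : Set Ω // MeasurableSet[F n] A} ≃o {B : Set S // MeasurableSet[mS] B})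
  atoms : ∀ A : ℕ → Set Ω, Antitone A → (∀ n, IsAtomOf (F n) (A n)) → (⋂ n, A n).Nonempty

/-- Adapted processes `(X_s)_{s ∈ 𝕋}`. -/
def IsAdapted (F : Filtration ℕ mΩ) (X : h.Time → Ω → ℝ) : Prop :=
  ∀ s : h.Time, Measurable[sig F s] (X s)

/-- `X ∈ L^∞(Ω, m, P)`. -/
def IsLInfty (m : MeasurableSpace Ω) (P : @Measure Ω mΩ) (X : Ω → ℝ) : Prop :=
  Measurable[m] X ∧ ∃ c : ℝ, ∀ᵐ ω ∂P, |X ω| ≤ c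

/-- `X ∈ 𝓡^∞_t`: adapted, essentially bounded, and null before time `t`. -/
structure IsRInfty (F : Filtration ℕ mΩ) (P : Measure Ω) (t : ℕ) (X : h.Time → Ω → ℝ) : Prop where
  adapted : IsAdapted F X
  bounded : ∃ c : ℝ, ∀ᵐ ω ∂P, ∀ s, |X s ω| ≤ c
  null_before : ∀ s : h.Time, (s : ℕ∞) < t → X s =ᵐ[P] 0

/-- The process `m 1_{𝕋_s}`, where `𝕋_s = {r ∈ 𝕋 | s ≤ r}`. -/
def payFrom (s : ℕ∞) (m : Ω → ℝ) (r : h.Time) (ω : Ω) : ℝ :=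
  if s ≤ (r : ℕ∞) then m ω else 0

/-! Risk measures -/

/-- Conditional convex risk measures for processes `ρ_t : 𝓡^∞_t → L^∞_t`.  Processes and random
variables are given by representatives; by monotonicity `ρ` respects almost sure equality.  The
values of `ρ` outside `𝓡^∞_t` are irrelevant. -/
structure IsProcessRiskMeasure (F : Filtration ℕ mΩ) (P : Measure Ω) (t : ℕ)
    (ρ : (h.Time → Ω → ℝ) → Ω → ℝ) : Prop where
  mem : ∀ X, IsRInfty F P t X → IsLInfty (F t) P (ρ X)
  cash_invariant : ∀ X, IsRInfty F P t X → ∀ m, IsLInfty (F t) P m →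
    ρ (fun s ω => X s ω + payFrom t m s ω) =ᵐ[P] fun ω => ρ X ω - m ω
  monotone : ∀ X Y, IsRInfty F P t X → IsRInfty F P t Y → (∀ s, X s ≤ᵐ[P] Y s) →
    ρ Y ≤ᵐ[P] ρ X
  convex : ∀ X Y, IsRInfty F P t X → IsRInfty F P t Y → ∀ l : Ω → ℝ, Measurable[F t] l →
    (∀ᵐ ω ∂P, 0 ≤ l ω ∧ l ω ≤ 1) →
    ρ (fun s ω => l ω * X s ω + (1 - l ω) * Y s ω) ≤ᵐ[P]
      fun ω => l ω * ρ X ω + (1 - l ω) * ρ Y ω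
  normalized : ρ (fun _ _ => 0) =ᵐ[P] 0

/-- Continuity from above (the convergence of `ρ (X n)` is automatically monotone). -/
def ContinuousFromAbove (F : Filtration ℕ mΩ) (P : Measure Ω) (t : ℕ)
    (ρ : (h.Time → Ω → ℝ) → Ω → ℝ) : Prop :=
  ∀ (X : ℕ → h.Time → Ω → ℝ) (Y : h.Time → Ω → ℝ),
    (∀ n, IsRInfty F P t (X n)) → IsRInfty F P t Y →
    (∀ s, ∀ᵐ ω ∂P, Antitone (fun n => X n s ω) ∧
      Tendsto (fun n => X n s ω) atTop (𝓝 (Y s ω))) →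
    ∀ᵐ ω ∂P, Tendsto (fun n => ρ (X n) ω) atTop (𝓝 (ρ Y ω))

/-- Conditional convex risk measures for random variables `φ : L^∞ → L^∞_t`. -/
structure IsRiskMeasure (F : Filtration ℕ mΩ) (P : Measure Ω) (t : ℕ)
    (φ : (Ω → ℝ) → Ω → ℝ) : Prop where
  mem : ∀ X, IsLInfty mΩ P X → IsLInfty (F t) P (φ X)
  cash_invariant : ∀ X, IsLInfty mΩ P X → ∀ m, IsLInfty (F t) P m →
    φ (fun ω => X ω + m ω) =ᵐ[P] fun ω => φ X ω - m ω
  monotone : ∀ X Y, IsLInfty mΩ P X → IsLInfty mΩ P Y → X ≤ᵐ[P] Y → φ Y ≤ᵐ[P] φ X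
  convex : ∀ X Y, IsLInfty mΩ P X → IsLInfty mΩ P Y → ∀ l : Ω → ℝ, Measurable[F t] l →
    (∀ᵐ ω ∂P, 0 ≤ l ω ∧ l ω ≤ 1) →
    φ (fun ω => l ω * X ω + (1 - l ω) * Y ω) ≤ᵐ[P]
      fun ω => l ω * φ X ω + (1 - l ω) * φ Y ω
  normalized : φ (fun _ => 0) =ᵐ[P] 0

/-- `ρ_t` is cash additive at time `s`. -/
def CashAdditiveAt (F : Filtration ℕ mΩ) (P : Measure Ω) (t : ℕ)
    (ρ : (h.Time → Ω → ℝ) → Ω → ℝ) (s : h.Time) : Prop :=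
  ∀ X, IsRInfty F P t X → ∀ m, IsLInfty (F t) P m →
    ρ (fun r ω => X r ω + payFrom s m r ω) =ᵐ[P] fun ω => ρ X ω - m ω

/-- `ρ_t` is cash additive: it is so at all times `s ∈ 𝕋`, `s > t`. -/
def CashAdditive (F : Filtration ℕ mΩ) (P : Measure Ω) (t : ℕ)
    (ρ : (h.Time → Ω → ℝ) → Ω → ℝ) : Prop :=
  ∀ s : h.Time, (t : ℕ∞) < s → CashAdditiveAt F P t ρ s

/-! Essential suprema of families -/

/-- `Z` is (a version of) the `μ`-essential supremum of the family `S` of `m`-measurable extended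
real random variables. -/
def IsEssSup (m : MeasurableSpace Ω) (μ : @Measure Ω mΩ) (S : Set (Ω → EReal)) (Z : Ω → EReal) :
    Prop :=
  Measurable[m] Z ∧ (∀ f ∈ S, f ≤ᵐ[μ] Z) ∧
    ∀ Z', Measurable[m] Z' → (∀ f ∈ S, f ≤ᵐ[μ] Z') → Z ≤ᵐ[μ] Z'

open Classical in
/-- A version of the `μ`-essential supremum of `S`. -/
def essSupOf (m : MeasurableSpace Ω) (μ : @Measure Ω mΩ) (S : Set (Ω → EReal)) : Ω → EReal :=
  if H : ∃ Z, IsEssSup m μ S Z then H.choose else fun _ => ⊤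

/-- The essential supremum exists, so the alternative in `essSupOf` is never used. -/
theorem exists_isEssSup {m : MeasurableSpace Ω} (hm : m ≤ mΩ) (μ : @Measure Ω mΩ)
    [IsFiniteMeasure μ] (S : Set (Ω → EReal)) (hS : ∀ f ∈ S, Measurable[m] f) :
    ∃ Z, IsEssSup m μ S Z := by
  rcases S.eq_empty_or_nonempty with rfl | ⟨f₀, hf₀⟩
  · exact ⟨fun _ => ⊥, measurable_const, by simp, fun Z' _ _ => .of_forall fun _ => bot_le⟩
  let g : EReal → ENNReal := fun x => (ENNReal.orderIsoIicOneBirational (EReal.expOrderIso x)).1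
  have hg : StrictMono g := fun a b hab => by
    have h1 := ENNReal.orderIsoIicOneBirational.strictMono (EReal.expOrderIso.strictMono hab)
    exact h1
  have hg1 : ∀ x, g x ≤ 1 := fun x => (ENNReal.orderIsoIicOneBirational (EReal.expOrderIso x)).2
  have hgm : Measurable g := hg.monotone.measurable
  have hfin : ∀ Z : Ω → EReal, ∫⁻ ω, g (Z ω) ∂μ ≠ ⊤ := fun Z => by
    refine ((lintegral_mono (μ := μ) (g := fun _ => 1) fun ω => hg1 (Z ω)).trans_lt ?_).ne
    simp
  let I : Set ENNReal := {c | ∃ u : ℕ → Ω → EReal, (∀ n, u n ∈ S) ∧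
    c = ∫⁻ ω, g (⨆ n, u n ω) ∂μ}
  have hI : I.Nonempty := ⟨_, fun _ => f₀, fun _ => hf₀, rfl⟩
  obtain ⟨c, -, hc, hcI⟩ := exists_seq_tendsto_sSup hI (OrderTop.bddAbove I)
  choose u hu hcu using hcI
  let w : ℕ → Ω → EReal := fun k => u k.unpair.1 k.unpair.2
  have hw : ∀ k, w k ∈ S := fun k => hu _ _
  let Z : Ω → EReal := fun ω => ⨆ k, w k ω
  have hZm : Measurable[m] Z := Measurable.iSup fun k => hS _ (hw k)
  have hZ : sSup I ≤ ∫⁻ ω, g (Z ω) ∂μ := by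
    refine le_of_tendsto' hc fun n => ?_
    rw [hcu n]
    refine lintegral_mono fun ω => hg.monotone (iSup_le fun j => ?_)
    have := le_iSup (fun k => w k ω) (Nat.pair n j)
    simpa [w] using this
  refine ⟨Z, hZm, fun f hf => ?_, fun Z' _ hZ' => ?_⟩
  · let w' : ℕ → Ω → EReal := fun k => Nat.casesOn k f w
    have hw' : ∀ k, w' k ∈ S := fun k => by cases k with
      | zero => exact hf
      | succ k => exact hw k
    have hle : ∀ ω, Z ω ≤ ⨆ k, w' k ω := fun ω =>
      iSup_le fun k => le_iSup (fun k => w' k ω) (k + 1)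
    have hmem : ∫⁻ ω, g (⨆ k, w' k ω) ∂μ ≤ sSup I := le_sSup ⟨w', hw', rfl⟩
    have hm' : Measurable[mΩ] fun ω => ⨆ k, w' k ω :=
      Measurable.mono (Measurable.iSup fun k => hS _ (hw' k)) hm le_rfl
    have := ae_eq_of_ae_le_of_lintegral_le (μ := μ)
      (.of_forall fun ω => hg.monotone (hle ω)) (hfin Z) (@Measurable.comp _ _ _ mΩ _ _ g _ hgm hm').aemeasurable
      (hmem.trans hZ)
    filter_upwards [this] with ω hω
    have h2 := hg.injective hω
    rw [h2]
    exact le_iSup (fun k => w' k ω) 0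
  · filter_upwards [ae_all_iff.2 fun k => hZ' _ (hw k)] with ω hω
    exact iSup_le hω

/-! Models and discounting -/

/-- `M_∞ = limₙ M_n` for the density process `M_n = dQ/dP |_{F_n}`, with values in `[0, ∞]`.
If `Q` is locally absolutely continuous, the limit exists `P`- and `Q`-almost surely. -/
def densityLimit (F : Filtration ℕ mΩ) (P Q : Measure Ω) (ω : Ω) : ENNReal :=
  limsup (fun n => (Q.trim (F.le n)).rnDeriv (P.trim (F.le n)) ω) atTop

/-- `Q ∈ 𝓜_loc(P)`: `Q` is a probability measure with `Q ≪ P` on `F_n` for all `n ∈ 𝕋 ∩ ℕ₀`. -/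
def IsLocAC (h : Horizon) (F : Filtration ℕ mΩ) (P Q : Measure Ω) : Prop :=
  IsProbabilityMeasure Q ∧
    ∀ n : ℕ, (n : ℕ∞) ∈ h.times → Q.trim (F.le n) ≪ P.trim (F.le n)

/-- `Q = P` on `F_t`. -/
def AgreeOn (m : MeasurableSpace Ω) (Q P : @Measure Ω mΩ) : Prop :=
  ∀ A, MeasurableSet[m] A → Q A = P A

/-- `γ ∈ Γ(Q)`: optional random measures on `𝕋`, normalized with respect to `Q`. -/
structure IsOptionalRandomMeasure (F : Filtration ℕ mΩ) (P Q : Measure Ω)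
    (γ : h.Time → Ω → ℝ) : Prop where
  adapted : IsAdapted F γ
  nonneg : ∀ᵐ ω ∂Q, ∀ s, 0 ≤ γ s ω
  sum_one : ∀ᵐ ω ∂Q, HasSum (fun s => γ s ω) 1
  null_singular : ∀ s : h.Time, (s : ℕ∞) = ⊤ → ∀ᵐ ω ∂Q, densityLimit F P Q ω = ⊤ → γ s ω = 0

/-- `γ ∈ Γ_s(Q)`: in addition `γ_r = 0` for `r < s`. -/
def IsOptionalRandomMeasureFrom (F : Filtration ℕ mΩ) (P Q : Measure Ω) (s : h.Time)
    (γ : h.Time → Ω → ℝ) : Prop :=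
  IsOptionalRandomMeasure F P Q γ ∧ ∀ r < s, γ r =ᵐ[Q] 0

open Classical in
/-- A process on `𝕋`, extended by zero to `ℕ₀ ∪ {∞}`; thus `D_{T+1} = 0` if `T < ∞`, and
`D_∞ = 0` if `𝕋 = ℕ₀`. -/
def extend (D : h.Time → Ω → ℝ) (s : ℕ∞) (ω : Ω) : ℝ :=
  if hs : s ∈ h.times then D ⟨s, hs⟩ ω else 0

/-- `D ∈ 𝓓(Q)`: predictable discounting processes.  The condition `tendsto` says nothing if
`T < ∞`, it says `D_n → 0` if `𝕋 = ℕ₀`, and `D_n → D_∞` if `𝕋 = ℕ₀ ∪ {∞}`. -/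
structure IsDiscounting (F : Filtration ℕ mΩ) (P Q : Measure Ω) (D : h.Time → Ω → ℝ) : Prop where
  predictable : ∀ s : h.Time, Measurable[predSig F s] (D s)
  nonneg : ∀ᵐ ω ∂Q, ∀ s, 0 ≤ D s ω
  antitone : ∀ᵐ ω ∂Q, Antitone (fun s => D s ω)
  init : ∀ᵐ ω ∂Q, extend D 0 ω = 1
  tendsto : ∀ᵐ ω ∂Q, Tendsto (fun n : ℕ => extend D n ω) atTop (𝓝 (extend D ⊤ ω))
  null_singular : ∀ᵐ ω ∂Q, densityLimit F P Q ω = ⊤ → extend D ⊤ ω = 0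

/-- The optional random measure of a discounting process: `γ_n = D_n - D_{n+1}`, `γ_∞ = D_∞`. -/
def ofDiscounting (D : h.Time → Ω → ℝ) (s : h.Time) (ω : Ω) : ℝ :=
  match (s : ℕ∞) with
  | ⊤ => D s ω
  | (n : ℕ) => D s ω - extend D ((n + 1 : ℕ) : ℕ∞) ω

/-- `D_t = ∑_{s ∈ 𝕋_t} γ_s`. -/
def discount (γ : h.Time → Ω → ℝ) (t : ℕ) (ω : Ω) : ℝ :=
  ∑' s : h.Time, if (t : ℕ∞) ≤ s then γ s ω else 0

/-- The Dirac measure at time `T`. -/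
def diracAt (T : h.Time) (s : h.Time) (_ : Ω) : ℝ := if s = T then 1 else 0

/-! The product space `Ω × 𝕋` -/

/-- The optional σ-field on `Ω × 𝕋`. -/
@[reducible] def optionalField (h : Horizon) (F : Filtration ℕ mΩ) : MeasurableSpace (Ω × h.Time) :=
  MeasurableSpace.generateFrom
    {B | ∃ (s : h.Time) (A : Set Ω), MeasurableSet[sig F s] A ∧ B = A ×ˢ {s}}

/-- The σ-field at time `t` of the optional filtration. -/
@[reducible] def optionalFieldAt (h : Horizon) (F : Filtration ℕ mΩ) (t : ℕ) : MeasurableSpace (Ω × h.Time) :=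
  MeasurableSpace.generateFrom
    ({B | ∃ (j : h.Time) (A : Set Ω), (j : ℕ∞) < t ∧ MeasurableSet[sig F j] A ∧ B = A ×ˢ {j}} ∪
      {B | ∃ A : Set Ω, MeasurableSet[F t] A ∧ B = A ×ˢ {s : h.Time | (t : ℕ∞) ≤ s}})

/-- The measure `Q ⊗ γ` on the optional σ-field, `E_{Q ⊗ γ}[X] = E_Q[∑_{s ∈ 𝕋} γ_s X_s]`. -/
def otimes (F : Filtration ℕ mΩ) (Q : Measure Ω) (γ : h.Time → Ω → ℝ) :
    @Measure (Ω × h.Time) (optionalField h F) :=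
  @Measure.sum _ _ (optionalField h F) fun s =>
    @Measure.map _ _ mΩ (optionalField h F) (fun ω => (ω, s))
      (Q.withDensity fun ω => ENNReal.ofReal (γ s ω))

/-- `μ` is a reference process: adapted, strictly positive, with `∑_{s ∈ 𝕋} μ_s = 1`. -/
structure IsReference (F : Filtration ℕ mΩ) (P : Measure Ω) (μ : h.Time → Ω → ℝ) : Prop where
  adapted : IsAdapted F μ
  pos : ∀ᵐ ω ∂P, ∀ s, 0 < μ s ω
  sum_one : ∀ᵐ ω ∂P, HasSum (fun s => μ s ω) 1

/-- The set of probability measures on the optional σ-field that are absolutely continuous with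
respect to `P ⊗ μ` and coincide with it on the σ-field at time `t` of the optional filtration. -/
def modelSet (F : Filtration ℕ mΩ) (P : Measure Ω) (μ : h.Time → Ω → ℝ) (t : ℕ) :
    Set (@Measure (Ω × h.Time) (optionalField h F)) :=
  {R | R Set.univ = 1 ∧ R ≪ otimes F P μ ∧
    ∀ B, MeasurableSet[optionalFieldAt h F t] B → R B = otimes F P μ B}

/-! Penalty function and robust representations -/

/-- The minimal penalty function: with the acceptance set `𝓐_t = {X ∈ 𝓡^∞_t | ρ_t(X) ≤ 0}`,
`α_t(Q ⊗ γ) = Q-ess sup_{X ∈ 𝓐_t} E_Q[-∑_{s ∈ 𝕋_t} (γ_s / D_t) X_s | F_t]`. -/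
def penalty (F : Filtration ℕ mΩ) (P : Measure Ω) (t : ℕ) (ρ : (h.Time → Ω → ℝ) → Ω → ℝ)
    (Q : Measure Ω) (γ : h.Time → Ω → ℝ) : Ω → EReal :=
  essSupOf (F t) Q
    {f | ∃ X, IsRInfty F P t X ∧ ρ X ≤ᵐ[P] 0 ∧
      f = fun ω => (((Q[fun ω' => -∑' s : h.Time,
        if (t : ℕ∞) ≤ s then γ s ω' / discount γ t ω' * X s ω' else 0 | F t]) ω : ℝ) : EReal)}

/-- In all relevant models, i.e. for all `Q ⊗ D` in `modelSet` with `α_t(Q ⊗ D) < ∞`, there is no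
discounting between `t` and `s`: `D_t = … = D_s` `Q`-almost surely. -/
def NoDiscounting (F : Filtration ℕ mΩ) (P : Measure Ω) (μ : h.Time → Ω → ℝ) (t : ℕ)
    (ρ : (h.Time → Ω → ℝ) → Ω → ℝ) (s : h.Time) : Prop :=
  ∀ (Q : Measure Ω) (D : h.Time → Ω → ℝ), IsLocAC h F P Q → IsDiscounting F P Q D →
    otimes F Q (ofDiscounting D) ∈ modelSet F P μ t →
    (∀ᵐ ω ∂Q, penalty F P t ρ Q (ofDiscounting D) ω < ⊤) →
    ∀ k : h.Time, (t : ℕ∞) ≤ k → k ≤ s → D k =ᵐ[Q] extend D t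

/-- The robust representation of `ρ_t` over all `Q ∈ 𝓜_loc(P)` with `Q = P` on `F_t` and all
`γ ∈ Γ_s(Q)`. -/
def HasRepresentationFrom (F : Filtration ℕ mΩ) (P : Measure Ω) (t : ℕ)
    (ρ : (h.Time → Ω → ℝ) → Ω → ℝ) (s : h.Time) : Prop :=
  ∀ X, IsRInfty F P t X → IsEssSup (F t) P
    {f | ∃ (Q : Measure Ω) (γ : h.Time → Ω → ℝ), IsLocAC h F P Q ∧ AgreeOn (F t) Q P ∧
      IsOptionalRandomMeasureFrom F P Q s γ ∧
      f = fun ω => (((Q[fun ω' => -∑' k : h.Time,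
        if s ≤ k then γ k ω' * X k ω' else 0 | F t]) ω : ℝ) : EReal) - penalty F P t ρ Q γ ω}
    (fun ω => (ρ X ω : EReal))

/-- The robust representation of `ρ_t` in terms of the terminal value `X_T`, over all probability
measures `Q ≪ P` with `Q = P` on `F_t`, with penalty `β_t(Q) = α_t(Q ⊗ δ_T)`. -/
def HasTerminalRepresentation (F : Filtration ℕ mΩ) (P : Measure Ω) (t : ℕ)
    (ρ : (h.Time → Ω → ℝ) → Ω → ℝ) (T : h.Time) : Prop :=
  ∀ X, IsRInfty F P t X → IsEssSup (F t) P
    {f | ∃ Q : Measure Ω, IsProbabilityMeasure Q ∧ Q ≪ P ∧ AgreeOn (F t) Q P ∧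
      f = fun ω => (((Q[fun ω' => -X T ω' | F t]) ω : ℝ) : EReal)
        - penalty F P t ρ Q (diracAt T) ω}
    (fun ω => (ρ X ω : EReal))

end ProcessRisk

end

open ProcessRisk

/-! Proof of the robust representation of cash additive risk measures for processes -/

namespace ProcessRisk

/-! Extension of consistent families of measures along a filtration -/

/-! Two mechanisms link cash additivity to models. If `ρ` is cash additive at `s`, then paying `a`
at time `t` and receiving `a` at time `s` is acceptable for every real `a`
(`CashAdditiveAt.isAccepted_postpone`). Under a model `Q ⊗ D` the conditional loss of this position
is `a` times the conditional expectation of `(D_t - D_s) / D_t`. A finite penalty dominates all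
these losses, so the nonnegative ratio vanishes and nothing is discounted between `t` and `s`.
Conversely, weights in `Γ_s(Q)` have total mass one on `𝕋_s`, so adding `m 1_{𝕋_s}` to `X` lowers
every term of the representation by `m`.

In between stands the robust representation. Its upper bound holds because `X + ρ(X) 1_{𝕋_t}` is
acceptable. For the lower bound (`le_of_forall_exists_model`) it is enough to find, for every `c <
E[ρ(X)]`, a model that separates `X` from the acceptance set by `c`. By continuity from above, the
positions of expected risk at most `c` form a convex, upward closed set that is closed under bounded
convergence `P ⊗ μ`-a.s. (`isFatouConvex_riskSet`). Such a set is separated from outside points by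
an integrable density (`IsFatouConvex.exists_density`): after a shift it stays away from zero in a
norm `sup_n ‖·‖_{p_n} / (n + 1)`, and a Hahn-Banach functional dominated by that norm is countably
additive.

The density, normalized on `F_t` and glued to `μ` before `t`, has to be written as `Q ⊗ D`. The
conditional expectation of the remaining mass is a supermartingale. In its multiplicative
decomposition the predictable decreasing factor is `D`, and the martingale factor is the density
process of `Q`, which exists by an extension theorem of Kolmogorov type
(`IsStandardFiltration.exists_extension`). On `F_∞` the measure `Q` may have a part singular to `P`;
there `D_∞` vanishes, so that no `P`-null optional event is charged
(`IsOptionalDensity.exists_model`).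

Acceptable positions can be pasted along events of `F_t`, so their conditional losses are directed
upward and bounds on expected losses become bounds on the penalty (`integral_le_of_le_penalty`,
`penalty_lt_top`). If there is a last time `T`, the only weight in `Γ_T(Q)` is the Dirac measure at
`T`. Since weights charge no `P`-null events, this forces `Q ≪ P`, and the representation only sees
`X_T`. -/

open Classical in
theorem measurable_decide_mem {α : Type*} [MeasurableSpace α] {A : Set α} (hA : MeasurableSet A) :
    Measurable (fun x => decide (x ∈ A)) := by
  refine measurable_to_bool ?_
  have : (fun x => decide (x ∈ A)) ⁻¹' {true} = A := by ext; simp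
  rwa [this]

/-- A σ-field that is isomorphic to the Borel σ-field of a standard Borel space is generated by
a map into the Cantor space whose range is a Borel set. -/
theorem exists_cantor_coding {Ω : Type*} {m : MeasurableSpace Ω} {S : Type*}
    [MeasurableSpace S] [StandardBorelSpace S]
    (e : {A : Set Ω // MeasurableSet[m] A} ≃o {B : Set S // MeasurableSet B}) :
    ∃ f : Ω → (ℕ → Bool), MeasurableSet (Set.range f) ∧
      m = MeasurableSpace.comap f MeasurableSpace.pi := by
  classical
  let j : S → ℕ → Bool := MeasurableSpace.mapNatBool S
  have hjm : Measurable j := MeasurableSpace.measurable_mapNatBool S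
  have hji : Function.Injective j := MeasurableSpace.injective_mapNatBool S
  have hje : MeasurableEmbedding j := hjm.measurableEmbedding hji
  have hG : ∀ i, MeasurableSet (j ⁻¹' {c | c i = true}) := fun i =>
    hjm (measurableSet_eq_fun (measurable_pi_apply i) measurable_const)
  have he0 : (e ⟨∅, MeasurableSet.empty⟩).1 = ∅ := by
    have h1 : (⟨∅, MeasurableSet.empty⟩ : {A : Set Ω // MeasurableSet[m] A}) ≤
      e.symm ⟨∅, MeasurableSet.empty⟩ := fun x hx => hx.elim
    have h2 := (OrderIso.le_symm_apply e).1 h1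
    exact Set.subset_empty_iff.1 h2
  -- Disjointness is an order property: every measurable lower bound of two disjoint sets is empty.
  have hdisj : ∀ A B : {A : Set Ω // MeasurableSet[m] A}, A.1 ∩ B.1 = ∅ →
      (e A).1 ∩ (e B).1 = ∅ := by
    intro A B hAB
    let C : {B : Set S // MeasurableSet B} := ⟨(e A).1 ∩ (e B).1, (e A).2.inter (e B).2⟩
    have hA : e.symm C ≤ A := (OrderIso.symm_apply_le e).2 Set.inter_subset_left
    have hB : e.symm C ≤ B := (OrderIso.symm_apply_le e).2 Set.inter_subset_right
    have h0 : e.symm C ≤ ⟨∅, MeasurableSet.empty⟩ := fun x hx => by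
      have : x ∈ A.1 ∩ B.1 := ⟨hA hx, hB hx⟩
      rwa [hAB] at this
    have h1 : C ≤ e ⟨∅, MeasurableSet.empty⟩ := (OrderIso.symm_apply_le e).1 h0
    exact Set.subset_empty_iff.1 (he0 ▸ h1 : C.1 ⊆ ∅)
  -- Only the σ-fields are isomorphic and no point map from `Ω` to `S` is given. So `f` records
  -- which of the pulled back coordinate events contain `ω`; it is constant on atoms.
  let a : ℕ → {A : Set Ω // MeasurableSet[m] A} := fun i => e.symm ⟨_, hG i⟩
  have hea : ∀ i, (e (a i)).1 = j ⁻¹' {c | c i = true} := fun i => by simp [a]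
  let f : Ω → ℕ → Bool := fun ω i => decide (ω ∈ (a i).1)
  have hfm : Measurable[m] f := by
    refine @measurable_pi_lambda _ _ _ m _ _ fun i => ?_
    exact measurable_decide_mem (a i).2
  -- `C` is the part of `A` in the cell of `ω` for all coordinate events. It is nonempty, hence so
  -- is `e C`, and any point of `e C` lies on the same side of every coordinate event as `ω`.
  have key : ∀ (A : {A : Set Ω // MeasurableSet[m] A}) (ω), ω ∈ A.1 →
      ∃ s ∈ (e A).1, j s = f ω := by
    intro A ω hω
    let C : {A : Set Ω // MeasurableSet[m] A} :=
      ⟨A.1 ∩ ⋂ i, (if ω ∈ (a i).1 then (a i).1 else (a i).1ᶜ), A.2.inter <|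
        MeasurableSet.iInter fun i => by
          split_ifs
          exacts [(a i).2, (a i).2.compl]⟩
    have hωC : ω ∈ C.1 := by
      refine ⟨hω, Set.mem_iInter.2 fun i => ?_⟩
      split_ifs with h
      exacts [h, h]
    have hne : (e C).1.Nonempty := by
      by_contra h
      rw [Set.not_nonempty_iff_eq_empty, ← he0] at h
      have := e.injective (Subtype.ext h)
      rw [this] at hωC
      exact hωC
    obtain ⟨s, hs⟩ := hne
    refine ⟨s, e.monotone (show C ≤ A from Set.inter_subset_left) hs, funext fun i => ?_⟩
    by_cases h : ω ∈ (a i).1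
    · have h1 : C ≤ a i := fun x hx => by
        have := Set.mem_iInter.1 hx.2 i
        rwa [if_pos h] at this
      have h2 : s ∈ (e (a i)).1 := e.monotone h1 hs
      rw [hea] at h2
      simp only [f, h, decide_true]
      exact h2
    · have h1 : C.1 ∩ (a i).1 = ∅ := by
        rw [Set.eq_empty_iff_forall_notMem]
        intro x hx
        have := Set.mem_iInter.1 hx.1.2 i
        rw [if_neg h] at this
        exact this hx.2
      have h2 : s ∉ (e (a i)).1 := fun h' => by
        have := hdisj _ _ h1
        rw [Set.eq_empty_iff_forall_notMem] at this
        exact this s ⟨hs, h'⟩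
      rw [hea] at h2
      simp only [f, h, decide_false]
      simpa using h2
  have hrange : Set.range f = Set.range j := by
    ext c
    constructor
    · rintro ⟨ω, rfl⟩
      obtain ⟨s, -, hs⟩ := key ⟨Set.univ, MeasurableSet.univ⟩ ω trivial
      exact ⟨s, hs⟩
    · rintro ⟨s, rfl⟩
      let B : {B : Set S // MeasurableSet B} := ⟨{s}, measurableSet_singleton s⟩
      have hne : (e.symm B).1.Nonempty := by
        by_contra h
        rw [Set.not_nonempty_iff_eq_empty] at h
        have h1 : e.symm B = ⟨∅, MeasurableSet.empty⟩ := Subtype.ext h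
        have h2 : B.1 = ∅ := by rw [← he0, ← h1, OrderIso.apply_symm_apply]
        exact Set.singleton_ne_empty s h2
      obtain ⟨ω, hω⟩ := hne
      obtain ⟨s', hs', h⟩ := key _ ω hω
      rw [OrderIso.apply_symm_apply] at hs'
      have : s' = s := hs'
      exact ⟨ω, by rw [← h, this]⟩
  refine ⟨f, hrange ▸ hje.measurableSet_range, le_antisymm (fun A hA => ?_) hfm.comap_le⟩
  refine ⟨j '' (e ⟨A, hA⟩).1, hje.measurableSet_image.2 (e ⟨A, hA⟩).2, ?_⟩
  ext ω
  constructor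
  -- If `ω` were outside `A`, `key` for the complement would give a second point with the code of
  -- `s`. Injectivity of `j` identifies the two, against disjointness of the images.
  · rintro ⟨s, hs, hsω⟩
    by_contra hω
    obtain ⟨s', hs', h'⟩ := key ⟨Aᶜ, hA.compl⟩ ω hω
    have : s' = s := hji (h'.trans hsω.symm)
    subst this
    have := hdisj ⟨A, hA⟩ ⟨Aᶜ, hA.compl⟩ (Set.inter_compl_self A)
    rw [Set.eq_empty_iff_forall_notMem] at this
    exact this _ ⟨hs, hs'⟩
  · intro hω
    exact key ⟨A, hA⟩ ω hω

/-- Kolmogorov extension for a sequence of probability measures on `ℕ → K`, `K` compact, whose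
finite-dimensional distributions stabilize. -/
theorem exists_measure_of_stable_marginals {K : Type*} [TopologicalSpace K]
    [CompactSpace K] [T2Space K] [SecondCountableTopology K] [MeasurableSpace K] [BorelSpace K]
    [TopologicalSpace.PseudoMetrizableSpace K]
    (ν : ℕ → ProbabilityMeasure (ℕ → K))
    (hν : ∀ N, ∀ n ≥ N, (ν n : Measure (ℕ → K)).map (fun x (i : Fin (N + 1)) => x i) =
      (ν N : Measure (ℕ → K)).map (fun x (i : Fin (N + 1)) => x i)) :
    ∃ ν' : ProbabilityMeasure (ℕ → K), ∀ N, (ν' : Measure (ℕ → K)).map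
      (fun x (i : Fin (N + 1)) => x i) =
        (ν N : Measure (ℕ → K)).map (fun x (i : Fin (N + 1)) => x i) := by
  -- Probability measures on a compact metrizable space form a compact space. A limit along an
  -- ultrafilter keeps every finite-dimensional marginal, since these are eventually constant.
  let U : Ultrafilter ℕ := Ultrafilter.of atTop
  obtain ⟨ν', -, hν'⟩ := isCompact_univ (X := ProbabilityMeasure (ℕ → K)).ultrafilter_le_nhds
    (U.map ν) (by simp)
  refine ⟨ν', fun N => ?_⟩
  have hc : Continuous (fun (x : ℕ → K) (i : Fin (N + 1)) => x i) := by fun_prop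
  have h1 : Tendsto (fun n => (ν n).map hc.measurable.aemeasurable) U
      (𝓝 (ν'.map hc.measurable.aemeasurable)) :=
    ((ProbabilityMeasure.continuous_map hc).tendsto ν').comp hν'
  have h2 : Tendsto (fun n => (ν n).map hc.measurable.aemeasurable) U
      (𝓝 ((ν N).map hc.measurable.aemeasurable)) := by
    refine tendsto_const_nhds.congr' ?_
    have : ∀ᶠ n in (U : Filter ℕ), N ≤ n := Ultrafilter.of_le atTop (eventually_ge_atTop N)
    filter_upwards [this] with n hn
    exact Subtype.ext (hν N n hn).symm
  have h3 := tendsto_nhds_unique h1 h2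
  exact congrArg Subtype.val h3

theorem isAtomOf_comap_singleton {Ω K : Type*} [MeasurableSpace K] [MeasurableSingletonClass K]
    (f : Ω → K) {x : K} (hx : x ∈ Set.range f) :
    IsAtomOf (MeasurableSpace.comap f inferInstance) (f ⁻¹' {x}) := by
  refine ⟨⟨{x}, measurableSet_singleton x, rfl⟩, ?_, ?_⟩
  · obtain ⟨ω, rfl⟩ := hx
    exact ⟨ω, rfl⟩
  · rintro _ hB ⟨C, -, rfl⟩
    by_cases h : x ∈ C
    · right
      refine le_antisymm hB fun ω hω => ?_
      have : f ω = x := hω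
      rwa [Set.mem_preimage, this]
    · left
      refine Set.eq_empty_iff_forall_notMem.2 fun ω hω => h ?_
      have : f ω = x := hB hω
      rwa [← this]

/-- A consistent sequence of probability measures along a standard filtration extends to a
probability measure on the σ-field generated by the filtration. -/
theorem IsStandardFiltration.exists_extension {Ω : Type*} {mΩ : MeasurableSpace Ω}
    {F : Filtration ℕ mΩ} (hF : IsStandardFiltration F) (hFT : ⨆ n, F n = mΩ)
    (q : ℕ → Measure Ω) [∀ n, IsProbabilityMeasure (q n)]
    (hq : ∀ n A, MeasurableSet[F n] A → q (n + 1) A = q n A) :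
    ∃ Q : Measure Ω, IsProbabilityMeasure Q ∧ ∀ n A, MeasurableSet[F n] A → Q A = q n A := by
  classical
  have hcode : ∀ n, ∃ f : Ω → (ℕ → Bool), MeasurableSet (Set.range f) ∧
      F n = MeasurableSpace.comap f MeasurableSpace.pi := by
    intro n
    obtain ⟨S, mS, hS, ⟨e⟩⟩ := hF.standard n
    exact exists_cantor_coding e
  choose f hfr hf using hcode
  have hfm : ∀ k n, k ≤ n → Measurable[F n] (f k) := fun k n hkn =>
    Measurable.mono (by rw [measurable_iff_comap_le, hf k]) (F.mono hkn) le_rfl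
  have hfmΩ : ∀ k, Measurable (f k) := fun k => (hfm k k le_rfl).mono (F.le k) le_rfl
  have hqle : ∀ N n, N ≤ n → ∀ A, MeasurableSet[F N] A → q n A = q N A := by
    intro N n hn
    induction n, hn using Nat.le_induction with
    | base => simp
    | succ n hn ih => exact fun A hA => (hq n A (F.mono hn A hA)).trans (ih A hA)
  have hΩ : Nonempty Ω := nonempty_of_isProbabilityMeasure (q 0)
  let ω₀ : Ω := hΩ.some
  -- Under `q n` only the codes up to `n` are controlled; later coordinates are filled with a
  -- constant.
  let x : ℕ → Ω → ℕ → (ℕ → Bool) := fun n ω k => if k ≤ n then f k ω else fun _ => false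
  have hx : ∀ n, Measurable (x n) := fun n => measurable_pi_lambda _ fun k => by
    by_cases h : k ≤ n
    · simpa [x, h] using hfmΩ k
    · simp [x, h]
  let ν : ℕ → ProbabilityMeasure (ℕ → ℕ → Bool) := fun n =>
    ⟨(q n).map (x n), Measure.isProbabilityMeasure_map (hx n).aemeasurable⟩
  have hrm : ∀ N, Measurable (fun (y : ℕ → ℕ → Bool) (i : Fin (N + 1)) => y i) := fun N => by
    fun_prop
  have hmarg : ∀ N n, N ≤ n → (ν n : Measure (ℕ → ℕ → Bool)).map
      (fun x (i : Fin (N + 1)) => x i) =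
      (q N).map (fun ω (i : Fin (N + 1)) => f i ω) := by
    intro N n hn
    have hfN : Measurable[F N] (fun ω (i : Fin (N + 1)) => f i ω) :=
      @measurable_pi_lambda _ _ _ (F N) _ _ fun i => hfm i N (Nat.lt_succ_iff.1 i.2)
    have h1 : (fun (y : ℕ → ℕ → Bool) (i : Fin (N + 1)) => y i) ∘ x n =
        fun ω (i : Fin (N + 1)) => f i ω := by
      funext ω i
      have : (i : ℕ) ≤ n := (Nat.lt_succ_iff.1 i.2).trans hn
      simp [x, this]
    change ((q n).map (x n)).map _ = _
    rw [Measure.map_map (hrm N) (hx n), h1]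
    ext C hC
    have hfN' := hfN.mono (F.le N) le_rfl
    rw [Measure.map_apply hfN' hC, Measure.map_apply hfN' hC]
    exact hqle N n hn _ (hfN hC)
  obtain ⟨ν', hν'⟩ := exists_measure_of_stable_marginals ν
    fun N n hn => (hmarg N n hn).trans (hmarg N N le_rfl).symm
  replace hν' := fun N => (hν' N).trans (hmarg N N le_rfl)
  -- the projections between the codes
  have hproj : ∀ n, ∃ p : (ℕ → Bool) → (ℕ → Bool), Measurable p ∧ ∀ ω, f n ω = p (f (n + 1) ω) := by
    intro n
    have : ∀ i : ℕ, ∃ H : Set (ℕ → Bool), MeasurableSet H ∧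
        f (n + 1) ⁻¹' H = {ω | f n ω i = true} := by
      intro i
      have : MeasurableSet[F (n + 1)] {ω | f n ω i = true} :=
        (hfm n (n + 1) n.le_succ) (measurableSet_eq_fun (measurable_pi_apply i) measurable_const)
      rw [hf (n + 1)] at this
      exact this
    choose H hH hHf using this
    refine ⟨fun c i => decide (c ∈ H i), measurable_pi_lambda _ fun i =>
      measurable_decide_mem (hH i), fun ω => funext fun i => ?_⟩
    have : f (n + 1) ω ∈ H i ↔ f n ω i = true := by
      change ω ∈ f (n + 1) ⁻¹' H i ↔ _
      rw [hHf]; rfl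
    by_cases h : f n ω i = true
    · simp [h, this]
    · simp [Bool.eq_false_of_not_eq_true h, this]
  choose p hpm hp using hproj
  -- `G` consists of the code sequences that are admissible at each level and consistent between
  -- levels. It is Borel because the ranges are, and `ν'` is carried by it because each condition
  -- involves only finitely many coordinates.
  let G : Set (ℕ → ℕ → Bool) := {x | ∀ n, x n ∈ Set.range (f n) ∧ x n = p n (x (n + 1))}
  have hGm : MeasurableSet G := by
    have : G = ⋂ n, {x | x n ∈ Set.range (f n) ∧ x n = p n (x (n + 1))} := by
      ext; simp [G]
    rw [this]
    refine MeasurableSet.iInter fun n => MeasurableSet.inter ?_ ?_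
    · exact (measurable_pi_apply (X := fun _ : ℕ => ℕ → Bool) n) (hfr n)
    · exact measurableSet_eq_fun (measurable_pi_apply n)
        ((hpm n).comp (measurable_pi_apply (n + 1)))
  have hGae : ∀ᵐ x ∂(ν' : Measure (ℕ → ℕ → Bool)), x ∈ G := by
    refine ae_all_iff.2 fun n => ?_
    let i : Fin (n + 1 + 1) := ⟨n, by omega⟩
    let i' : Fin (n + 1 + 1) := ⟨n + 1, by omega⟩
    let W : Set (Fin (n + 1 + 1) → ℕ → Bool) := {y | y i ∈ Set.range (f n) ∧ y i = p n (y i')}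
    have hW : MeasurableSet W := MeasurableSet.inter ((measurable_pi_apply (X := fun _ : Fin (n + 1 + 1) => ℕ → Bool) i) (hfr n))
      (measurableSet_eq_fun (measurable_pi_apply i) ((hpm n).comp (measurable_pi_apply i')))
    have h1 : ∀ᵐ y ∂((ν' : Measure (ℕ → ℕ → Bool)).map
        (fun x (i : Fin (n + 1 + 1)) => x i)), y ∈ W := by
      rw [hν' (n + 1)]
      have hm : Measurable (fun ω (i : Fin (n + 1 + 1)) => f i ω) :=
        measurable_pi_lambda _ fun i => hfmΩ i
      exact (ae_map_iff (p := fun y => y ∈ W) hm.aemeasurable hW).2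
        (.of_forall fun ω => ⟨⟨ω, rfl⟩, hp n ω⟩)
    exact (ae_map_iff (hrm (n + 1)).aemeasurable hW).1 h1
  -- A consistent sequence of codes is a decreasing sequence of atoms; the assumption on atoms
  -- provides a point with all these codes.
  have hlift : ∀ x ∈ G, ∃ ω, ∀ n, f n ω = x n := by
    intro x hx
    obtain ⟨ω, hω⟩ := hF.atoms (fun n => f n ⁻¹' {x n}) (antitone_nat_of_succ_le fun n ω hω => by
      have h1 : f (n + 1) ω = x (n + 1) := hω
      change f n ω = x n
      rw [hp n, h1, ← (hx n).2]) (fun n => by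
      rw [hf n]
      exact isAtomOf_comap_singleton (f n) (hx n).1)
    exact ⟨ω, fun n => Set.mem_iInter.1 hω n⟩
  let g : (ℕ → ℕ → Bool) → Ω := fun x => if h : x ∈ G then (hlift x h).choose else ω₀
  have hg : ∀ x ∈ G, ∀ n, f n (g x) = x n := fun x hx n => by
    simp only [g, dif_pos hx]
    exact (hlift x hx).choose_spec n
  -- The lift is chosen pointwise, yet it is measurable: on `G` its `n`-th code is the `n`-th
  -- coordinate, and `F n` is generated by the `n`-th code.
  have hgm : Measurable g := by
    rw [measurable_iff_le_map, ← hFT]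
    refine iSup_le fun n A hA => ?_
    rw [hf n] at hA
    obtain ⟨C, hC, rfl⟩ := hA
    change MeasurableSet (g ⁻¹' (f n ⁻¹' C))
    have : g ⁻¹' (f n ⁻¹' C) = (G ∩ {x | x n ∈ C}) ∪ (Gᶜ ∩ {_x | f n ω₀ ∈ C}) := by
      ext x
      by_cases hx : x ∈ G
      · simp [hx, hg x hx n]
      · simp [hx, g]
    rw [this]
    exact (hGm.inter (measurable_pi_apply n hC)).union (hGm.compl.inter (MeasurableSet.const _))
  refine ⟨(ν' : Measure (ℕ → ℕ → Bool)).map g, Measure.isProbabilityMeasure_map hgm.aemeasurable,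
    fun n A hA => ?_⟩
  rw [Measure.map_apply hgm (F.le n A hA)]
  rw [hf n] at hA
  obtain ⟨C, hC, rfl⟩ := hA
  let W : Set (Fin (n + 1) → ℕ → Bool) := {y | y (Fin.last n) ∈ C}
  have hW : MeasurableSet W := measurable_pi_apply (Fin.last n) hC
  have h1 : (ν' : Measure (ℕ → ℕ → Bool)) (g ⁻¹' (f n ⁻¹' C)) =
      (ν' : Measure (ℕ → ℕ → Bool)) ((fun x (i : Fin (n + 1)) => x i) ⁻¹' W) := by
    refine measure_congr ?_
    filter_upwards [hGae] with x hx
    refine propext ?_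
    change f n (g x) ∈ C ↔ x n ∈ C
    rw [hg x hx n]
  have h2 : Measurable (fun ω (i : Fin (n + 1)) => f i ω) :=
    measurable_pi_lambda _ fun i => hfmΩ i
  rw [h1, ← Measure.map_apply (hrm n) hW, hν' n, Measure.map_apply h2 hW]
  rfl

end ProcessRisk

namespace ProcessRisk

/-! Separation of convex sets of bounded functions that are closed under bounded convergence -/

/-- In a Hilbert space, a bounded sequence has convergent convex combinations of its tails. -/
theorem exists_tendsto_convexHull_tail {H : Type*} [NormedAddCommGroup H] [InnerProductSpace ℝ H]
    [CompleteSpace H] (h : ℕ → H) {b : ℝ} (hb : ∀ n, ‖h n‖ ≤ b) :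
    ∃ (g : ℕ → H) (z : H), (∀ k, g k ∈ convexHull ℝ (h '' Set.Ici k)) ∧
      Tendsto g atTop (𝓝 z) := by
  let K : ℕ → Set H := fun k => closure (convexHull ℝ (h '' Set.Ici k))
  have hKne : ∀ k, (K k).Nonempty := fun k =>
    ⟨h k, subset_closure (subset_convexHull ℝ _ ⟨k, Set.self_mem_Ici, rfl⟩)⟩
  have hKc : ∀ k, Convex ℝ (K k) := fun k => (convex_convexHull ℝ _).closure
  have hKanti : ∀ k l, k ≤ l → K l ⊆ K k := fun k l hkl => closure_mono <|
    convexHull_mono <| Set.image_mono fun n hn => le_trans hkl hn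
  -- Elements of minimal norm in the closed convex hulls of the tails. Their norms increase and are
  -- bounded, and the parallelogram law turns this into the Cauchy property.
  have hmin : ∀ k, ∃ p ∈ K k, ∀ w ∈ K k, ‖p‖ ≤ ‖w‖ := by
    intro k
    obtain ⟨p, hp, hpm⟩ := exists_norm_eq_iInf_of_complete_convex (hKne k)
      isClosed_closure.isComplete (hKc k) 0
    refine ⟨p, hp, fun w hw => ?_⟩
    simp only [zero_sub, norm_neg] at hpm
    rw [hpm]
    exact ciInf_le (f := fun w : K k => ‖(w : H)‖) ⟨0, by rintro _ ⟨w, rfl⟩; positivity⟩ ⟨w, hw⟩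
  choose p hpK hpm using hmin
  have hmono : Monotone fun k => ‖p k‖ := fun k l hkl => hpm k _ (hKanti k l hkl (hpK l))
  have hbdd : BddAbove (Set.range fun k => ‖p k‖) := ⟨b, by
    rintro _ ⟨k, rfl⟩
    exact (hpm k _ (subset_closure (subset_convexHull ℝ _ ⟨k, Set.self_mem_Ici, rfl⟩))).trans (hb k)⟩
  have hlim := tendsto_atTop_ciSup hmono hbdd
  -- The midpoint of `p l` and `p k` lies in `K k`, so its norm is at least that of `p k`.
  have hsq : ∀ k l, k ≤ l → ‖p l - p k‖ ^ 2 ≤ 2 * (‖p l‖ ^ 2 - ‖p k‖ ^ 2) := by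
    intro k l hkl
    have hpar := parallelogram_law_with_norm ℝ (p l) (p k)
    have hmid : (1 / 2 : ℝ) • p l + (1 / 2 : ℝ) • p k ∈ K k :=
      hKc k (hKanti k l hkl (hpK l)) (hpK k) (by norm_num) (by norm_num) (by norm_num)
    have h1 := hpm k _ hmid
    rw [← smul_add, norm_smul] at h1
    norm_num at h1
    nlinarith [norm_nonneg (p k), norm_nonneg (p l + p k)]
  have hcauchy : CauchySeq p := by
    have hlim2 : CauchySeq fun k => ‖p k‖ ^ 2 := (hlim.pow 2).cauchySeq
    rw [Metric.cauchySeq_iff'] at hlim2 ⊢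
    intro ε hε
    obtain ⟨N, hN⟩ := hlim2 (ε ^ 2 / 2) (by positivity)
    refine ⟨N, fun n hn => ?_⟩
    have h1 := hN n hn
    rw [Real.dist_eq] at h1
    have h2 := hsq N n hn
    have h3 := le_abs_self (‖p n‖ ^ 2 - ‖p N‖ ^ 2)
    rw [dist_eq_norm]
    exact lt_of_pow_lt_pow_left₀ 2 hε.le (by linarith)
  obtain ⟨z, hz⟩ := cauchySeq_tendsto_of_complete hcauchy
  have hg : ∀ k, ∃ g ∈ convexHull ℝ (h '' Set.Ici k), dist (p k) g < 1 / ((k : ℝ) + 1) := fun k =>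
    Metric.mem_closure_iff.1 (hpK k) _ (by positivity)
  choose g hgm hgd using hg
  refine ⟨g, z, hgm, ?_⟩
  refine tendsto_of_tendsto_of_dist hz ?_
  exact squeeze_zero (fun _ => dist_nonneg) (fun k => (hgd k).le)
    tendsto_one_div_add_atTop_nhds_zero_nat

/-- The space of bounded measurable functions. -/
def bddMeas (E : Type*) [MeasurableSpace E] : Submodule ℝ (E → ℝ) where
  carrier := {f | Measurable f ∧ ∃ c, ∀ x, |f x| ≤ c}
  zero_mem' := ⟨measurable_const, 0, by simp⟩
  add_mem' := by
    rintro f g ⟨hf, c, hc⟩ ⟨hg, d, hd⟩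
    exact ⟨hf.add hg, c + d, fun x => (abs_add_le _ _).trans (add_le_add (hc x) (hd x))⟩
  smul_mem' := by
    rintro a f ⟨hf, c, hc⟩
    refine ⟨hf.const_smul a, |a| * c, fun x => ?_⟩
    simp only [Pi.smul_apply, smul_eq_mul, abs_mul]
    exact mul_le_mul_of_nonneg_left (hc x) (abs_nonneg a)

variable {E : Type*} [MeasurableSpace E]

theorem bddMeas_measurable (f : bddMeas E) : Measurable (f : E → ℝ) := f.2.1

theorem bddMeas_bounded (f : bddMeas E) : ∃ c, 0 ≤ c ∧ ∀ x, |(f : E → ℝ) x| ≤ c := by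
  obtain ⟨c, hc⟩ := f.2.2
  exact ⟨max c 0, le_max_right _ _, fun x => (hc x).trans (le_max_left _ _)⟩

theorem bddMeas_memLp (ν : Measure E) [IsFiniteMeasure ν] (f : bddMeas E) (p : ENNReal) :
    MemLp (f : E → ℝ) p ν := by
  obtain ⟨c, -, hc⟩ := bddMeas_bounded f
  exact MemLp.of_bound (bddMeas_measurable f).aestronglyMeasurable c (.of_forall hc)

/-- Bounded sequences of functions have almost surely convergent convex combinations of tails. -/
theorem exists_ae_tendsto_convexHull_tail (ν : Measure E) [IsProbabilityMeasure ν]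
    (h : ℕ → bddMeas E) {b : ℝ} (hb : ∀ n, ∀ᵐ x ∂ν, |(h n : E → ℝ) x| ≤ b) :
    ∃ (g : ℕ → bddMeas E) (z : E → ℝ), Measurable z ∧
      (∀ k, g k ∈ convexHull ℝ (h '' Set.Ici k)) ∧
      ∀ᵐ x ∂ν, Tendsto (fun k => (g k : E → ℝ) x) atTop (𝓝 (z x)) := by
  let T : bddMeas E →ₗ[ℝ] Lp ℝ 2 ν :=
    { toFun := fun f => (bddMeas_memLp ν f 2).toLp _
      map_add' := fun f g => MemLp.toLp_add _ _
      map_smul' := fun a f => MemLp.toLp_const_smul a _ }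
  have hTb : ∀ n, ‖T (h n)‖ ≤ b := by
    intro n
    have hb0 : 0 ≤ b := by
      obtain ⟨x, hx⟩ := (hb 0).exists
      exact (abs_nonneg _).trans hx
    have := eLpNorm_le_of_ae_bound (f := (h n : E → ℝ)) (p := 2) (hb n)
    simp only [measure_univ, ENNReal.one_rpow, one_mul] at this
    change ‖((bddMeas_memLp ν (h n) 2).toLp _ : Lp ℝ 2 ν)‖ ≤ b
    rw [Lp.norm_toLp]
    exact ENNReal.toReal_le_of_le_ofReal hb0 this
  obtain ⟨g', z', hg', hz'⟩ := exists_tendsto_convexHull_tail (fun n => T (h n)) hTb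
  have hpre : ∀ k, ∃ g ∈ convexHull ℝ (h '' Set.Ici k), T g = g' k := by
    intro k
    have h1 := hg' k
    rw [show (fun n => T (h n)) '' Set.Ici k = T '' (h '' Set.Ici k) from
      (Set.image_image T h _).symm, ← LinearMap.image_convexHull] at h1
    exact h1
  choose g hg hTg using hpre
  have hconv : Tendsto (fun k => T (g k)) atTop (𝓝 z') := by simpa only [hTg] using hz'
  -- A subsequence converges almost surely; since `ns k ≥ k`, its members still come from the tails
  -- from `k` on.
  obtain ⟨ns, hns, hae⟩ := (tendstoInMeasure_of_tendsto_Lp hconv).exists_seq_tendsto_ae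
  refine ⟨fun k => g (ns k), (Lp.aestronglyMeasurable z').mk z',
    (Lp.aestronglyMeasurable z').stronglyMeasurable_mk.measurable, fun k => ?_, ?_⟩
  · exact convexHull_mono (Set.image_mono fun n hn => le_trans (hns.le_apply) hn) (hg (ns k))
  · have h1 : ∀ᵐ x ∂ν, ∀ k, (T (g k) : E → ℝ) x = (g k : E → ℝ) x :=
      ae_all_iff.2 fun k => MemLp.coeFn_toLp (bddMeas_memLp ν (g k) 2)
    filter_upwards [hae, h1, (Lp.aestronglyMeasurable z').ae_eq_mk] with x hx h1 h2
    rw [← h2]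
    simpa only [h1] using hx

/-- Chebyshev's inequality with exponent `p + 1` bounds the measure of `{|z| ≥ c + ε}` by `(c / (c +
ε)) ^ (p + 1)`, which tends to zero. -/
theorem ae_abs_le_of_eLpNorm_le (ν : Measure E) {z : E → ℝ}
    (hz : Measurable z) {c : ℝ} (hc : 0 < c)
    (h : ∀ p : ℕ, eLpNorm z ((p + 1 : ℕ) : ENNReal) ν ≤ ENNReal.ofReal c) :
    ∀ᵐ x ∂ν, |z x| ≤ c := by
  have hkey : ∀ n : ℕ, ν {x | ENNReal.ofReal (c + 1 / ((n : ℝ) + 1)) ≤ ‖z x‖ₑ} = 0 := by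
    intro n
    have hn : (0 : ℝ) < 1 / ((n : ℝ) + 1) := by positivity
    set e : ENNReal := ENNReal.ofReal (c + 1 / ((n : ℝ) + 1)) with he
    have he0 : e ≠ 0 := by
      rw [he, Ne, ENNReal.ofReal_eq_zero]; push Not; linarith
    have hle : ∀ p : ℕ, ν {x | e ≤ ‖z x‖ₑ} ≤ (e⁻¹ * ENNReal.ofReal c) ^ (p + 1) := by
      intro p
      refine (meas_ge_le_mul_pow_eLpNorm_enorm ν (p := ((p + 1 : ℕ) : ENNReal)) (by simp)
        (by simp) hz.aestronglyMeasurable he0 (fun h => absurd h (by simp [he]))).trans ?_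
      rw [ENNReal.toReal_natCast, ENNReal.rpow_natCast, ENNReal.rpow_natCast, mul_pow]
      gcongr
      exact h p
    have hlt : e⁻¹ * ENNReal.ofReal c < 1 := by
      rw [he, ← ENNReal.ofReal_inv_of_pos (by positivity), ← ENNReal.ofReal_mul (by positivity),
        ENNReal.ofReal_lt_one, inv_mul_lt_one₀ (by positivity)]
      linarith
    have htend := (ENNReal.tendsto_pow_atTop_nhds_zero_of_lt_one hlt).comp (tendsto_add_atTop_nat 1)
    exact le_antisymm (ge_of_tendsto' htend hle) bot_le
  have : ∀ᵐ x ∂ν, ∀ n : ℕ, ¬ ENNReal.ofReal (c + 1 / ((n : ℝ) + 1)) ≤ ‖z x‖ₑ :=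
    ae_all_iff.2 fun n => by
      rw [ae_iff]; simpa using hkey n
  filter_upwards [this] with x hx
  refine le_of_forall_pos_lt_add fun ε hε => ?_
  obtain ⟨n, hn⟩ := exists_nat_one_div_lt hε
  have h1 := hx n
  rw [← ofReal_norm, ENNReal.ofReal_le_ofReal_iff (norm_nonneg _), not_le,
    Real.norm_eq_abs] at h1
  linarith

/-- Convex sets of bounded functions that are closed under bounded almost sure convergence. -/
structure IsFatouConvex (ν : Measure E) (C : Set (bddMeas E)) : Prop where
  convex : Convex ℝ C
  closed : ∀ (H : ℕ → bddMeas E) (G : bddMeas E) (b : ℝ), (∀ n, H n ∈ C) →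
    (∀ n, ∀ᵐ x ∂ν, |(H n : E → ℝ) x| ≤ b) →
    (∀ᵐ x ∂ν, Tendsto (fun n => (H n : E → ℝ) x) atTop (𝓝 ((G : E → ℝ) x))) → G ∈ C

theorem convex_ae_abs_le (ν : Measure E) (b : ℝ) :
    Convex ℝ {H : bddMeas E | ∀ᵐ x ∂ν, |(H : E → ℝ) x| ≤ b} := by
  intro f hf g hg a c ha hc hac
  change ∀ᵐ x ∂ν, _
  filter_upwards [hf, hg] with x hx hy
  simp only [Submodule.coe_add, Submodule.coe_smul, Pi.add_apply, Pi.smul_apply, smul_eq_mul]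
  refine (abs_add_le _ _).trans ?_
  rw [abs_mul, abs_mul, abs_of_nonneg ha, abs_of_nonneg hc]
  calc a * |(f : E → ℝ) x| + c * |(g : E → ℝ) x| ≤ a * b + c * b := by gcongr
    _ = b := by rw [← add_mul, hac, one_mul]

/-- Minkowski's inequality gives convexity and Fatou's lemma gives closedness. -/
theorem isFatouConvex_eLpNorm_le (ν : Measure E) (p : ℕ) (c : ENNReal) :
    IsFatouConvex ν {H : bddMeas E | eLpNorm (H : E → ℝ) ((p + 1 : ℕ) : ENNReal) ν ≤ c} where
  convex := by
    intro f hf g hg a b ha hb hab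
    simp only [Set.mem_ofPred_eq, Submodule.coe_add, Submodule.coe_smul] at *
    refine (eLpNorm_add_le ((bddMeas_measurable f).const_smul a).aestronglyMeasurable
      ((bddMeas_measurable g).const_smul b).aestronglyMeasurable (by simp)).trans ?_
    rw [eLpNorm_const_smul, eLpNorm_const_smul, Real.enorm_eq_ofReal ha, Real.enorm_eq_ofReal hb]
    calc _ ≤ ENNReal.ofReal a * c + ENNReal.ofReal b * c := by gcongr
      _ = c := by rw [← add_mul, ← ENNReal.ofReal_add ha hb, hab, ENNReal.ofReal_one, one_mul]
  closed := by
    intro H G b hH _ hlim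
    refine (Lp.eLpNorm_lim_le_liminf_eLpNorm
      (fun n => (bddMeas_measurable (H n)).aestronglyMeasurable) _ hlim).trans ?_
    exact liminf_le_of_frequently_le' (.of_forall hH)

theorem IsFatouConvex.inter {ν : Measure E} {C C' : Set (bddMeas E)} (h : IsFatouConvex ν C)
    (h' : IsFatouConvex ν C') : IsFatouConvex ν (C ∩ C') where
  convex := h.convex.inter h'.convex
  closed := fun H G b hH hb hlim => ⟨h.closed H G b (fun n => (hH n).1) hb hlim,
    h'.closed H G b (fun n => (hH n).2) hb hlim⟩

/-- Truncation of a measurable function. -/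
def clip (c : ℝ) (z : E → ℝ) (hz : Measurable z) : bddMeas E :=
  ⟨fun x => max (-|c|) (min (z x) |c|), measurable_const.max (hz.min measurable_const), |c|,
    fun x => abs_le.2 ⟨le_max_left _ _, max_le (by linarith [abs_nonneg c]) (min_le_right _ _)⟩⟩

theorem clip_apply {c : ℝ} {z : E → ℝ} (hz : Measurable z) {x : E} (h : |z x| ≤ c) :
    (clip c z hz : E → ℝ) x = z x := by
  have h1 := abs_le.1 (h.trans (le_abs_self c))
  change max (-|c|) (min (z x) |c|) = z x
  rw [min_eq_left h1.2, max_eq_right h1.1]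

/-- Otherwise each exponent `p` has a counterexample in `C`, with `‖H‖_{p+1} ≤ c` and `|H| ≤ c + 1`.
Convex combinations of tails converge almost surely to some `z` with all norms at most `c`, hence
`|z| ≤ c`. The uniform bound `c + 1` is what puts `z` into `C`, a contradiction. -/
theorem IsFatouConvex.exists_exponent {ν : Measure E} [IsProbabilityMeasure ν]
    {C : Set (bddMeas E)} (hC : IsFatouConvex ν C) {c : ℝ} (hc : 0 < c)
    (hCc : ∀ H ∈ C, ¬ ∀ᵐ x ∂ν, |(H : E → ℝ) x| ≤ c) :
    ∃ p : ℕ, ∀ H ∈ C, eLpNorm (H : E → ℝ) ((p + 1 : ℕ) : ENNReal) ν ≤ ENNReal.ofReal c →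
      ¬ ∀ᵐ x ∂ν, |(H : E → ℝ) x| ≤ c + 1 := by
  by_contra! hcon
  choose H hHC hHn hHb using hcon
  obtain ⟨g, z, hzm, hg, hgz⟩ := exists_ae_tendsto_convexHull_tail ν H hHb
  have hgC : ∀ k, g k ∈ C := fun k => by
    refine convexHull_min ?_ hC.convex (hg k)
    rintro _ ⟨n, -, rfl⟩
    exact hHC n
  have hgb : ∀ k, ∀ᵐ x ∂ν, |(g k : E → ℝ) x| ≤ c + 1 := fun k => by
    refine convexHull_min ?_ (convex_ae_abs_le ν (c + 1)) (hg k)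
    rintro _ ⟨n, -, rfl⟩
    exact hHb n
  have hgn : ∀ q k : ℕ, q ≤ k →
      eLpNorm (g k : E → ℝ) ((q + 1 : ℕ) : ENNReal) ν ≤ ENNReal.ofReal c := fun q k hqk => by
    refine convexHull_min ?_ (isFatouConvex_eLpNorm_le ν q (ENNReal.ofReal c)).convex (hg k)
    rintro _ ⟨n, hn, rfl⟩
    refine le_trans ?_ (hHn n)
    refine eLpNorm_le_eLpNorm_of_exponent_le ?_ (bddMeas_measurable _).aestronglyMeasurable
    exact_mod_cast Nat.succ_le_succ (hqk.trans hn)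
  have hzn : ∀ q : ℕ, eLpNorm z ((q + 1 : ℕ) : ENNReal) ν ≤ ENNReal.ofReal c := fun q => by
    refine (Lp.eLpNorm_lim_le_liminf_eLpNorm
      (fun n => (bddMeas_measurable (g n)).aestronglyMeasurable) _ hgz).trans ?_
    refine liminf_le_of_frequently_le' (Eventually.frequently ?_)
    filter_upwards [eventually_ge_atTop q] with k hk using hgn q k hk
  have hzc := ae_abs_le_of_eLpNorm_le ν hzm hc hzn
  have hclip : ∀ᵐ x ∂ν, (clip c z hzm : E → ℝ) x = z x := by
    filter_upwards [hzc] with x hx using clip_apply hzm hx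
  refine hCc (clip c z hzm) (hC.closed g _ (c + 1) hgC hgb ?_) ?_
  · filter_upwards [hgz, hclip] with x h1 h2
    rwa [h2]
  · filter_upwards [hzc, hclip] with x h1 h2
    rwa [h2]

/-- A convex set of bounded functions, closed under bounded almost sure convergence and at
distance larger than `1` from zero, stays away from zero in the norm
`sup_n ‖H‖_{p_n} / (n + 1)` for a suitable sequence of exponents. -/
theorem IsFatouConvex.exists_exponents {ν : Measure E} [IsProbabilityMeasure ν]
    {C : Set (bddMeas E)} (hC : IsFatouConvex ν C)
    (hCc : ∀ H ∈ C, ¬ ∀ᵐ x ∂ν, |(H : E → ℝ) x| ≤ 1) :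
    ∃ p : ℕ → ℕ, ∀ H ∈ C, ∃ n : ℕ,
      ENNReal.ofReal ((n : ℝ) + 1) < eLpNorm (H : E → ℝ) ((p n + 1 : ℕ) : ENNReal) ν := by
  let Good : ℕ → Set (bddMeas E) → Prop := fun n C => IsFatouConvex ν C ∧
    ∀ H ∈ C, ¬ ∀ᵐ x ∂ν, |(H : E → ℝ) x| ≤ (n : ℝ) + 1
  -- Intersecting with the ball of radius `n + 1` in a suitable `L^p` raises the excluded sup-norm
  -- bound from `n + 1` to `n + 2`. An element surviving all these intersections would satisfy no
  -- bound at all, although it is bounded.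
  have hstep : ∀ n (C : {C // Good n C}), ∃ p : ℕ, Good (n + 1) (C.1 ∩
      {H : bddMeas E | eLpNorm (H : E → ℝ) ((p + 1 : ℕ) : ENNReal) ν ≤
        ENNReal.ofReal ((n : ℝ) + 1)}) := by
    rintro n ⟨C, hC, hCn⟩
    obtain ⟨p, hp⟩ := hC.exists_exponent (c := (n : ℝ) + 1) (by positivity) hCn
    refine ⟨p, hC.inter (isFatouConvex_eLpNorm_le ν p _), fun H hH => ?_⟩
    push_cast
    exact hp H hH.1 hH.2
  choose p hp using hstep
  let C' : ∀ n, {C // Good n C} := fun n => Nat.rec ⟨C, hC, by simpa using hCc⟩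
    (fun n C => ⟨_, hp n C⟩) n
  refine ⟨fun n => p n (C' n), fun H hH => ?_⟩
  by_contra! hcon
  have hmem : ∀ n, H ∈ (C' n).1 := by
    intro n
    induction n with
    | zero => exact hH
    | succ n ih => exact ⟨ih, hcon n⟩
  obtain ⟨c, -, hc⟩ := bddMeas_bounded H
  obtain ⟨n, hn⟩ := exists_nat_ge c
  exact (C' n).2.2 H (hmem n) (.of_forall fun x => (hc x).trans (by linarith))

end ProcessRisk

/-! ### Hahn-Banach separation and countable additivity of the separating functional -/

namespace ProcessRisk

/-- A sublinear function that is at least `1` on a nonempty convex set dominates a linear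
functional that is at least `1` on this set. -/
theorem exists_linear_le_of_one_le {V : Type*} [AddCommGroup V] [Module ℝ V] (N : V → ℝ)
    (N_hom : ∀ c : ℝ, 0 < c → ∀ x, N (c • x) = c * N x) (N_add : ∀ x y, N (x + y) ≤ N x + N y)
    {K : Set V} (hK : Convex ℝ K) (hKne : K.Nonempty) (hN : ∀ k ∈ K, 1 ≤ N k) :
    ∃ l : V →ₗ[ℝ] ℝ, (∀ x, l x ≤ N x) ∧ ∀ k ∈ K, 1 ≤ l k := by
  have N_0 : N 0 = 0 := by
    have := N_hom 2 (by norm_num) 0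
    rw [smul_zero] at this
    linarith
  -- The cone over `K`, with the scaling factor recorded as first coordinate.
  let T : Set (ℝ × V) := {p | 0 ≤ p.1 ∧ ∃ k ∈ K, p.2 = p.1 • k}
  have hT0 : (0, 0) ∈ T := by
    obtain ⟨k, hk⟩ := hKne
    exact ⟨le_rfl, k, hk, by simp⟩
  have hTne : Nonempty T := ⟨⟨_, hT0⟩⟩
  have hTadd : ∀ p ∈ T, ∀ q ∈ T, p + q ∈ T := by
    rintro ⟨a, w⟩ ⟨ha, k, hk, hw⟩ ⟨b, w'⟩ ⟨hb, k', hk', hw'⟩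
    simp only at ha hb hw hw'
    subst hw hw'
    refine ⟨add_nonneg ha hb, ?_⟩
    rcases (add_nonneg ha hb).eq_or_lt with h0 | h0
    · have ha0 : a = 0 := by linarith
      have hb0 : b = 0 := by linarith
      exact ⟨k, hk, by simp [ha0, hb0]⟩
    · refine ⟨(a / (a + b)) • k + (b / (a + b)) • k', hK hk hk' (by positivity) (by positivity)
        (by field_simp), ?_⟩
      simp only [Prod.mk_add_mk, smul_add, smul_smul]
      rw [mul_div_cancel₀ _ h0.ne', mul_div_cancel₀ _ h0.ne']
  have hTsmul : ∀ c : ℝ, 0 < c → ∀ p ∈ T, c • p ∈ T := by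
    rintro c hc ⟨a, w⟩ ⟨ha, k, hk, hw⟩
    simp only at ha hw
    subst hw
    exact ⟨mul_nonneg hc.le ha, k, hk, by simp [smul_smul]⟩
  -- The infimum of `N (v + a • k) - a` over `a ≥ 0` and `k ∈ K`. It is sublinear, lies below `N`,
  -- and takes values at most `-1` on `-K`; any linear functional below `q` is therefore as
  -- required. The bound `N ≥ 1` on `K` keeps the infimum finite.
  let q : V → ℝ := fun v => ⨅ p : T, (N (v + p.1.2) - p.1.1)
  have hlow : ∀ v, ∀ p ∈ T, -N (-v) ≤ N (v + p.2) - p.1 := by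
    rintro v ⟨a, w⟩ ⟨ha, k, hk, hw⟩
    simp only at ha hw ⊢
    have h1 : a ≤ N w := by
      rcases ha.eq_or_lt with h0 | h0
      · rw [hw, ← h0, zero_smul, N_0]
      · rw [hw, N_hom a h0]
        nlinarith [hN k hk]
    have h2 := N_add (v + w) (-v)
    rw [show v + w + -v = w by abel] at h2
    linarith
  have hbdd : ∀ v, BddBelow (Set.range fun p : T => N (v + p.1.2) - p.1.1) := fun v =>
    ⟨-N (-v), by rintro _ ⟨p, rfl⟩; exact hlow v p.1 p.2⟩
  have hqle : ∀ v, ∀ p ∈ T, q v ≤ N (v + p.2) - p.1 := fun v p hp => ciInf_le (hbdd v) ⟨p, hp⟩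
  have q_hom' : ∀ c : ℝ, 0 < c → ∀ x, c * q x ≤ q (c • x) := by
    intro c hc x
    refine le_ciInf fun p => ?_
    have h1 := hqle x _ (hTsmul c⁻¹ (inv_pos.2 hc) p.1 p.2)
    have h2 : N (c • x + p.1.2) = c * N (x + c⁻¹ • p.1.2) := by
      rw [← N_hom c hc, smul_add, smul_smul, mul_inv_cancel₀ hc.ne', one_smul]
    rw [h2]
    have h3 : c * q x ≤ c * (N (x + c⁻¹ • p.1.2) - c⁻¹ * p.1.1) :=
      mul_le_mul_of_nonneg_left h1 hc.le
    rw [mul_sub, ← mul_assoc, mul_inv_cancel₀ hc.ne', one_mul] at h3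
    exact h3
  have q_hom : ∀ c : ℝ, 0 < c → ∀ x, q (c • x) = c * q x := by
    intro c hc x
    refine le_antisymm ?_ (q_hom' c hc x)
    have := q_hom' c⁻¹ (inv_pos.2 hc) (c • x)
    rw [smul_smul, inv_mul_cancel₀ hc.ne', one_smul] at this
    rwa [inv_mul_le_iff₀ hc] at this
  have q_add : ∀ x y, q (x + y) ≤ q x + q y := by
    intro x y
    have h1 : ∀ p p' : T, q (x + y) ≤ (N (x + p.1.2) - p.1.1) + (N (y + p'.1.2) - p'.1.1) := by
      intro p p'
      have h2 := hqle (x + y) _ (hTadd p.1 p.2 p'.1 p'.2)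
      have h3 := N_add (x + p.1.2) (y + p'.1.2)
      rw [show x + p.1.2 + (y + p'.1.2) = x + y + (p.1 + p'.1).2 by
        rw [Prod.snd_add]; abel] at h3
      rw [Prod.fst_add] at h2
      linarith
    have h2 : ∀ p : T, q (x + y) - (N (x + p.1.2) - p.1.1) ≤ q y := fun p =>
      le_ciInf fun p' => by linarith [h1 p p']
    have h3 : q (x + y) - q y ≤ q x := le_ciInf fun p => by linarith [h2 p]
    linarith
  obtain ⟨g, -, hg⟩ := exists_extension_of_le_sublinear (⊥ : V →ₗ.[ℝ] ℝ) q q_hom q_add (by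
    rintro ⟨x, hx⟩
    have hx0 : x = 0 := (Submodule.mem_bot ℝ).1 hx
    subst hx0
    have h1 : (⊥ : V →ₗ.[ℝ] ℝ) ⟨0, hx⟩ = 0 := LinearPMap.map_zero _
    rw [h1]
    refine le_ciInf fun p => ?_
    have := hlow 0 p.1 p.2
    simpa [N_0] using this)
  refine ⟨g, fun x => (hg x).trans (by simpa using hqle x _ hT0), fun k hk => ?_⟩
  have h1 := (hg (-k)).trans (hqle (-k) (1, k) ⟨zero_le_one, k, hk, by simp⟩)
  simp only [map_neg, neg_add_cancel, N_0] at h1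
  linarith

variable {E : Type*} [MeasurableSpace E]

/-- Indicator functions of measurable sets. -/
noncomputable def bddInd (A : Set E) (hA : MeasurableSet A) : bddMeas E :=
  ⟨A.indicator fun _ => 1, measurable_const.indicator hA, 1, fun x => by
    by_cases h : x ∈ A <;> simp [h]⟩

-- The sum counts the levels `(k + 1) / (n + 1)` below `t`, so it equals `⌊(n + 1) t⌋ / (n + 1)`.
-- This staircase approximates functions with values in `[0, 1]` uniformly.
open Classical in
theorem abs_sub_step_le {t : ℝ} (h0 : 0 ≤ t) (h1 : t ≤ 1) (n : ℕ) :
    0 ≤ t - ∑ k ∈ Finset.range (n + 1), (1 / ((n : ℝ) + 1)) *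
      (if ((k : ℝ) + 1) / ((n : ℝ) + 1) ≤ t then 1 else 0) ∧
    t - ∑ k ∈ Finset.range (n + 1), (1 / ((n : ℝ) + 1)) *
      (if ((k : ℝ) + 1) / ((n : ℝ) + 1) ≤ t then 1 else 0) ≤ 1 / ((n : ℝ) + 1) := by
  have hn : (0 : ℝ) < (n : ℝ) + 1 := by positivity
  set m := ⌊((n : ℝ) + 1) * t⌋₊ with hm
  have hle : (m : ℝ) ≤ ((n : ℝ) + 1) * t := Nat.floor_le (by positivity)
  have hlt : ((n : ℝ) + 1) * t < m + 1 := Nat.lt_floor_add_one _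
  have hmn : m ≤ n + 1 := by
    have : (m : ℝ) ≤ ((n + 1 : ℕ) : ℝ) := by push_cast; nlinarith
    exact_mod_cast this
  have hsum : ∑ k ∈ Finset.range (n + 1), (1 / ((n : ℝ) + 1)) *
      (if ((k : ℝ) + 1) / ((n : ℝ) + 1) ≤ t then (1 : ℝ) else 0) = m / ((n : ℝ) + 1) := by
    rw [← Finset.mul_sum, Finset.sum_boole]
    have : (Finset.range (n + 1)).filter (fun k : ℕ => ((k : ℝ) + 1) / ((n : ℝ) + 1) ≤ t) =
        Finset.range m := by
      ext k
      simp only [Finset.mem_filter, Finset.mem_range]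
      have h2 : ((k : ℝ) + 1) / ((n : ℝ) + 1) ≤ t ↔ k + 1 ≤ m := by
        rw [div_le_iff₀ hn, hm, Nat.le_floor_iff (by positivity), mul_comm]
        push_cast
        rfl
      rw [h2]
      omega
    rw [this, Finset.card_range]
    ring
  rw [hsum]
  constructor
  · rw [sub_nonneg, div_le_iff₀ hn]; linarith
  · rw [sub_le_iff_le_add, ← add_div, le_div_iff₀ hn]; linarith

/-- Two positive functionals that agree on indicators agree on staircase functions. Positivity
converts the uniform error `1 / (n + 1)` into convergence of the values. -/
theorem eq_integral_of_forall_ind (M : Measure E) [IsFiniteMeasure M] (l : bddMeas E →ₗ[ℝ] ℝ)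
    (hpos : ∀ H : bddMeas E, (∀ x, 0 ≤ (H : E → ℝ) x) → 0 ≤ l H)
    (hind : ∀ A (hA : MeasurableSet A), l (bddInd A hA) = M.real A) (H : bddMeas E) :
    l H = ∫ x, (H : E → ℝ) x ∂M := by
  classical
  have hint : ∀ H : bddMeas E, Integrable (H : E → ℝ) M := fun H =>
    (bddMeas_memLp M H 1).integrable le_rfl
  let L : bddMeas E →ₗ[ℝ] ℝ :=
    { toFun := fun H => ∫ x, (H : E → ℝ) x ∂M
      map_add' := fun f g => integral_add (hint f) (hint g)
      map_smul' := fun a f => integral_const_mul a _ }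
  have hLpos : ∀ H : bddMeas E, (∀ x, 0 ≤ (H : E → ℝ) x) → 0 ≤ L H := fun H hH =>
    integral_nonneg hH
  have hLind : ∀ A (hA : MeasurableSet A), l (bddInd A hA) = L (bddInd A hA) := fun A hA => by
    rw [hind]
    change _ = ∫ x, A.indicator (fun _ => (1 : ℝ)) x ∂M
    rw [integral_indicator_const _ hA]; simp
  have hunit : ∀ H : bddMeas E, (∀ x, 0 ≤ (H : E → ℝ) x) → (∀ x, (H : E → ℝ) x ≤ 1) →
      l H = L H := by
    intro H h0 h1
    let one : bddMeas E := bddInd Set.univ MeasurableSet.univ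
    have hA : ∀ n k : ℕ, MeasurableSet {x | ((k : ℝ) + 1) / ((n : ℝ) + 1) ≤ (H : E → ℝ) x} :=
      fun n k => measurableSet_le measurable_const (bddMeas_measurable H)
    let s : ℕ → bddMeas E := fun n => ∑ k ∈ Finset.range (n + 1),
      (1 / ((n : ℝ) + 1)) • bddInd _ (hA n k)
    have hs : ∀ n x, (s n : E → ℝ) x = ∑ k ∈ Finset.range (n + 1), (1 / ((n : ℝ) + 1)) *
      (if ((k : ℝ) + 1) / ((n : ℝ) + 1) ≤ (H : E → ℝ) x then 1 else 0) := by
      intro n x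
      simp only [s, AddSubmonoidClass.coe_finsetSum, Finset.sum_apply]
      refine Finset.sum_congr rfl fun k _ => ?_
      simp [bddInd, Set.indicator_apply]
    have hsl : ∀ n, l (s n) = L (s n) := fun n => by
      simp only [s, map_sum, map_smul, hLind]
    have hbound : ∀ (f : bddMeas E →ₗ[ℝ] ℝ), (∀ H : bddMeas E, (∀ x, 0 ≤ (H : E → ℝ) x) → 0 ≤ f H) →
        ∀ n, 0 ≤ f H - f (s n) ∧ f H - f (s n) ≤ (1 / ((n : ℝ) + 1)) * f one := by
      intro f hf n
      constructor
      · rw [← map_sub]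
        refine hf _ fun x => ?_
        change 0 ≤ (H : E → ℝ) x - (s n : E → ℝ) x
        rw [hs]
        exact (abs_sub_step_le (h0 x) (h1 x) n).1
      · rw [← map_sub, ← smul_eq_mul, ← map_smul, ← sub_nonneg, ← map_sub]
        refine hf _ fun x => ?_
        change 0 ≤ (1 / ((n : ℝ) + 1)) * (Set.univ.indicator (fun _ => (1 : ℝ)) x) -
          ((H : E → ℝ) x - (s n : E → ℝ) x)
        rw [hs, Set.indicator_univ, mul_one, sub_nonneg]
        exact (abs_sub_step_le (h0 x) (h1 x) n).2
    have hlim : ∀ f : bddMeas E →ₗ[ℝ] ℝ, (∀ H : bddMeas E, (∀ x, 0 ≤ (H : E → ℝ) x) → 0 ≤ f H) →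
        Tendsto (fun n => f (s n)) atTop (𝓝 (f H)) := by
      intro f hf
      have h2 : Tendsto (fun n : ℕ => (1 / ((n : ℝ) + 1)) * f one) atTop (𝓝 0) := by
        simpa using (tendsto_one_div_add_atTop_nhds_zero_nat (𝕜 := ℝ)).mul_const (f one)
      have h3 := squeeze_zero (fun n => (hbound f hf n).1) (fun n => (hbound f hf n).2) h2
      simpa using (tendsto_const_nhds (x := f H)).sub h3
    refine tendsto_nhds_unique (hlim l hpos) ?_
    simp only [hsl]
    exact hlim L hLpos
  obtain ⟨c, hc0, hc⟩ := bddMeas_bounded H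
  let one' : bddMeas E := bddInd Set.univ MeasurableSet.univ
  have hone : l one' = L one' := hLind _ _
  -- An affine change of `H`, bounded by `c`, into a function with values in `[0, 1]`; the
  -- denominator `2 (c + 1)` is positive even for `c = 0`.
  let H' : bddMeas E := (1 / (2 * (c + 1))) • (H + c • one')
  have hH' : ∀ x, (H' : E → ℝ) x = (1 / (2 * (c + 1))) * ((H : E → ℝ) x + c) := fun x => by
    change (1 / (2 * (c + 1))) * ((H : E → ℝ) x + c * (Set.univ.indicator (fun _ => (1 : ℝ)) x)) = _
    rw [Set.indicator_univ, mul_one]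
  have h1 : l H' = L H' := by
    refine hunit H' (fun x => ?_) (fun x => ?_)
    · rw [hH']
      have := (abs_le.1 (hc x)).1
      exact mul_nonneg (by positivity) (by linarith)
    · rw [hH', one_div, inv_mul_le_iff₀ (by positivity)]
      have := (abs_le.1 (hc x)).2
      linarith
  have h2 : (1 / (2 * (c + 1))) ≠ 0 := by positivity
  simp only [H', map_smul, map_add, hone, smul_eq_mul] at h1
  have h3 := mul_left_cancel₀ h2 h1
  change l H = L H
  linarith

/-- A positive linear functional on bounded functions which is continuous along indicators of
events of vanishing probability has a density. -/
theorem exists_density_of_functional (ν : Measure E) [IsProbabilityMeasure ν]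
    (l : bddMeas E →ₗ[ℝ] ℝ) (hpos : ∀ H : bddMeas E, (∀ x, 0 ≤ (H : E → ℝ) x) → 0 ≤ l H)
    (hcont : ∀ (A : ℕ → Set E) (hA : ∀ n, MeasurableSet (A n)),
      Tendsto (fun n => ν (A n)) atTop (𝓝 0) →
        Tendsto (fun n => l (bddInd (A n) (hA n))) atTop (𝓝 0)) :
    ∃ Z : E → ℝ, Measurable Z ∧ (∀ x, 0 ≤ Z x) ∧ Integrable Z ν ∧
      ∀ H : bddMeas E, l H = ∫ x, Z x * (H : E → ℝ) x ∂ν := by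
  have hind0 : ∀ A (hA : MeasurableSet A), 0 ≤ l (bddInd A hA) := fun A hA =>
    hpos _ fun x => Set.indicator_nonneg (fun _ _ => zero_le_one) x
  have hlcongr : ∀ A B (hA : MeasurableSet A) (hB : MeasurableSet B), A = B →
      l (bddInd A hA) = l (bddInd B hB) := by
    rintro A _ hA hB rfl; rfl
  have hnull : ∀ A (hA : MeasurableSet A), ν A = 0 → l (bddInd A hA) = 0 := fun A hA h0 =>
    tendsto_nhds_unique tendsto_const_nhds
      (hcont (fun _ => A) (fun _ => hA) (by simp [h0]))
  have hunion : ∀ A B (hA : MeasurableSet A) (hB : MeasurableSet B), Disjoint A B →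
      l (bddInd (A ∪ B) (hA.union hB)) = l (bddInd A hA) + l (bddInd B hB) := by
    intro A B hA hB hAB
    rw [← map_add]
    congr 1
    refine Subtype.ext ?_
    exact Set.indicator_union_of_disjoint hAB _
  -- Finite additivity leaves as error the value on the uncovered rest of the union. The measure of
  -- this rest decreases to zero, so `hcont` applies.
  have hadd : ∀ f : ℕ → Set E, ∀ hf : ∀ i, MeasurableSet (f i), Pairwise (Function.onFun Disjoint f) →
      HasSum (fun i => l (bddInd (f i) (hf i))) (l (bddInd (⋃ i, f i) (MeasurableSet.iUnion hf))) := by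
    intro f hf hd
    rw [hasSum_iff_tendsto_nat_of_nonneg (fun i => hind0 _ _)]
    let U : ℕ → Set E := fun n => ⋃ i ∈ Finset.range n, f i
    have hU : ∀ n, MeasurableSet (U n) := fun n =>
      Finset.measurableSet_biUnion _ fun i _ => hf i
    have hUs : ∀ n, ∑ i ∈ Finset.range n, l (bddInd (f i) (hf i)) = l (bddInd (U n) (hU n)) := by
      intro n
      induction n with
      | zero =>
        rw [Finset.sum_range_zero, eq_comm]
        exact hnull _ _ (by simp [U])
      | succ n ih =>
        have hdis : Disjoint (U n) (f n) := by
          simp only [U, Set.disjoint_iUnion_left, Finset.mem_range]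
          exact fun i hi => hd hi.ne
        rw [Finset.sum_range_succ, ih, ← hunion _ _ _ _ hdis]
        refine hlcongr _ _ _ _ ?_
        simp only [U, Finset.range_add_one, Finset.set_biUnion_insert]
        exact Set.union_comm _ _
    have hrest : ∀ n, MeasurableSet ((⋃ i, f i) \ U n) := fun n =>
      (MeasurableSet.iUnion hf).diff (hU n)
    have hUsub : ∀ n, U n ⊆ ⋃ i, f i := fun n => Set.iUnion₂_subset fun i _ => Set.subset_iUnion f i
    have hsplit : ∀ n, l (bddInd (U n) (hU n)) =
        l (bddInd (⋃ i, f i) (MeasurableSet.iUnion hf)) - l (bddInd _ (hrest n)) := by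
      intro n
      rw [eq_sub_iff_add_eq, ← hunion _ _ _ _ Set.disjoint_sdiff_right]
      exact hlcongr _ _ _ _ (Set.union_sdiff_cancel (hUsub n))
    have hlim : Tendsto (fun n => ν ((⋃ i, f i) \ U n)) atTop (𝓝 0) := by
      have hanti : Antitone fun n => (⋃ i, f i) \ U n := fun m n hmn =>
        Set.sdiff_subset_sdiff_right (Set.biUnion_mono
          (fun i hi => Finset.mem_range.2 ((Finset.mem_range.1 hi).trans_le hmn)) fun _ _ => le_rfl)
      have h1 := tendsto_measure_iInter_atTop (μ := ν)
        (fun n => (hrest n).nullMeasurableSet) hanti ⟨0, measure_ne_top _ _⟩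
      have h2 : ⋂ n, (⋃ i, f i) \ U n = ∅ := by
        rw [Set.eq_empty_iff_forall_notMem]
        intro x hx
        rw [Set.mem_iInter] at hx
        obtain ⟨i, hi⟩ := Set.mem_iUnion.1 (hx 0).1
        exact (hx (i + 1)).2 (Set.mem_iUnion₂.2 ⟨i, by simp, hi⟩)
      rwa [h2, measure_empty] at h1
    simp only [hUs, hsplit]
    simpa using (tendsto_const_nhds (x := l (bddInd (⋃ i, f i) (MeasurableSet.iUnion hf)))).sub
      (hcont _ hrest hlim)
  let M : Measure E := Measure.ofMeasurable (fun A hA => ENNReal.ofReal (l (bddInd A hA)))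
    (by rw [hnull _ _ measure_empty, ENNReal.ofReal_zero])
    (by
      intro f hf hd
      have h := hadd f hf hd
      rw [← h.tsum_eq, ENNReal.ofReal_tsum_of_nonneg (fun i => hind0 _ _) h.summable])
  have hM : ∀ A (hA : MeasurableSet A), M A = ENNReal.ofReal (l (bddInd A hA)) := fun A hA =>
    Measure.ofMeasurable_apply A hA
  have hfin : IsFiniteMeasure M := ⟨by rw [hM _ MeasurableSet.univ]; exact ENNReal.ofReal_lt_top⟩
  have hac : M ≪ ν := Measure.AbsolutelyContinuous.mk fun A hA h0 => by
    rw [hM A hA, hnull A hA h0, ENNReal.ofReal_zero]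
  refine ⟨fun x => (M.rnDeriv ν x).toReal, (Measure.measurable_rnDeriv _ _).ennreal_toReal,
    fun x => ENNReal.toReal_nonneg, Measure.integrable_toReal_rnDeriv, fun H => ?_⟩
  rw [eq_integral_of_forall_ind M l hpos (fun A hA => by
    rw [measureReal_def, hM A hA, ENNReal.toReal_ofReal (hind0 A hA)]) H]
  exact (integral_rnDeriv_smul hac).symm

/-- The positive part of a bounded function. -/
def bddPos (H : bddMeas E) : bddMeas E :=
  ⟨fun x => max ((H : E → ℝ) x) 0, (bddMeas_measurable H).max measurable_const,
    H.2.2.imp fun c hc x => by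
      rw [abs_of_nonneg (le_max_right _ _)]
      exact max_le ((le_abs_self _).trans (hc x)) ((abs_nonneg _).trans (hc x))⟩

theorem bddPos_apply (H : bddMeas E) (x : E) : (bddPos H : E → ℝ) x = max ((H : E → ℝ) x) 0 := rfl

theorem eLpNorm_bddMeas_ne_top (ν : Measure E) [IsFiniteMeasure ν] (H : bddMeas E) (q : ENNReal) :
    eLpNorm (H : E → ℝ) q ν ≠ ⊤ := (bddMeas_memLp ν H q).eLpNorm_ne_top

/-- The one-sided norms `‖H⁺‖_{p_n} / (n + 1)`. -/
noncomputable def scaledNorm (ν : Measure E) (p : ℕ → ℕ) (n : ℕ) (H : bddMeas E) : ℝ :=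
  (eLpNorm (bddPos H : E → ℝ) ((p n + 1 : ℕ) : ENNReal) ν).toReal / ((n : ℝ) + 1)

/-- The factor `1 / (n + 1)` makes all but finitely many of the norms of a bounded function small,
uniformly in the exponents. This is the source of continuity along vanishing events. -/
theorem scaledNorm_le (ν : Measure E) [IsProbabilityMeasure ν] (p : ℕ → ℕ) (n : ℕ)
    (H : bddMeas E) {c : ℝ} (hc0 : 0 ≤ c) (hc : ∀ x, (H : E → ℝ) x ≤ c) :
    scaledNorm ν p n H ≤ c / ((n : ℝ) + 1) := by
  have h1 := eLpNorm_le_of_ae_bound (μ := ν) (f := (bddPos H : E → ℝ)) (C := c)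
    (p := ((p n + 1 : ℕ) : ENNReal)) (.of_forall fun x => by
      rw [Real.norm_eq_abs, bddPos_apply, abs_of_nonneg (le_max_right _ _)]
      exact max_le (hc x) hc0)
  simp only [measure_univ, ENNReal.one_rpow, one_mul] at h1
  have := ENNReal.toReal_le_of_le_ofReal hc0 h1
  unfold scaledNorm
  gcongr

theorem bddAbove_scaledNorm (ν : Measure E) [IsProbabilityMeasure ν] (p : ℕ → ℕ)
    (H : bddMeas E) : BddAbove (Set.range fun n => scaledNorm ν p n H) := by
  obtain ⟨c, hc0, hc⟩ := bddMeas_bounded H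
  refine ⟨c, ?_⟩
  rintro _ ⟨n, rfl⟩
  refine (scaledNorm_le ν p n H hc0 (fun x => (le_abs_self _).trans (hc x))).trans ?_
  exact div_le_self hc0 (by linarith [(Nat.cast_nonneg n : (0 : ℝ) ≤ n)])

theorem scaledNorm_smul (ν : Measure E) (p : ℕ → ℕ) (n : ℕ) {c : ℝ} (hc : 0 < c)
    (H : bddMeas E) : scaledNorm ν p n (c • H) = c * scaledNorm ν p n H := by
  have h2 : (bddPos (c • H) : E → ℝ) = c • (bddPos H : E → ℝ) := by
    funext x
    change max (c * (H : E → ℝ) x) 0 = c * max ((H : E → ℝ) x) 0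
    rw [mul_max_of_nonneg _ _ hc.le, mul_zero]
  unfold scaledNorm
  rw [h2, eLpNorm_const_smul, ENNReal.toReal_mul, toReal_enorm, Real.norm_eq_abs,
    abs_of_pos hc, mul_div_assoc]

theorem scaledNorm_add_le (ν : Measure E) [IsProbabilityMeasure ν] (p : ℕ → ℕ) (n : ℕ)
    (H G : bddMeas E) : scaledNorm ν p n (H + G) ≤ scaledNorm ν p n H + scaledNorm ν p n G := by
  unfold scaledNorm
  rw [← add_div]
  gcongr
  rw [← ENNReal.toReal_add (eLpNorm_bddMeas_ne_top ν _ _) (eLpNorm_bddMeas_ne_top ν _ _)]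
  refine ENNReal.toReal_mono (ENNReal.add_ne_top.2 ⟨eLpNorm_bddMeas_ne_top ν _ _,
    eLpNorm_bddMeas_ne_top ν _ _⟩) ?_
  refine le_trans (eLpNorm_mono_real
    (g := (bddPos H : E → ℝ) + (bddPos G : E → ℝ)) fun x => ?_)
    (eLpNorm_add_le (bddMeas_measurable _).aestronglyMeasurable
      (bddMeas_measurable _).aestronglyMeasurable (by simp))
  rw [Real.norm_eq_abs]
  change |max ((H : E → ℝ) x + (G : E → ℝ) x) 0| ≤
    max ((H : E → ℝ) x) 0 + max ((G : E → ℝ) x) 0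
  rw [abs_of_nonneg (le_max_right _ _)]
  exact max_le (add_le_add (le_max_left _ _) (le_max_left _ _))
    (add_nonneg (le_max_right _ _) (le_max_right _ _))

theorem tendsto_scaledNorm_ind (ν : Measure E) [IsProbabilityMeasure ν] (p : ℕ → ℕ) (n : ℕ)
    (A : ℕ → Set E) (hA : ∀ k, MeasurableSet (A k))
    (hlim : Tendsto (fun k => ν (A k)) atTop (𝓝 0)) :
    Tendsto (fun k => scaledNorm ν p n (bddInd (A k) (hA k))) atTop (𝓝 0) := by
  have hpow : Tendsto (fun k => (ν (A k)) ^ (1 / ((p n + 1 : ℕ) : ℝ))) atTop (𝓝 0) := by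
    have := hlim.ennrpow_const (1 / ((p n + 1 : ℕ) : ℝ))
    rwa [ENNReal.zero_rpow_of_pos (by positivity)] at this
  have hpow' := ((ENNReal.tendsto_toReal ENNReal.zero_ne_top).comp hpow).div_const ((n : ℝ) + 1)
  simp only [ENNReal.toReal_zero, zero_div] at hpow'
  refine hpow'.congr fun k => ?_
  have h1 : (bddPos (bddInd (A k) (hA k)) : E → ℝ) = (A k).indicator fun _ => (1 : ℝ) := by
    funext x
    exact max_eq_left (Set.indicator_nonneg (fun _ _ => zero_le_one) x)
  unfold scaledNorm
  rw [h1, eLpNorm_indicator_const (hA k) (by simp) (by simp), ENNReal.toReal_natCast]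
  simp only [enorm_one, one_mul, Function.comp_apply]

/-- The points `X + 1 / (n + 1)` converge boundedly to `X`, so they cannot all lie in `S`. -/
theorem IsFatouConvex.exists_ball {ν : Measure E} {S : Set (bddMeas E)} (hS : IsFatouConvex ν S)
    {X : bddMeas E} (hX : X ∉ S) :
    ∃ ε : ℝ, 0 < ε ∧ X + ε • bddInd Set.univ MeasurableSet.univ ∉ S := by
  by_contra! hcon
  have hone : ∀ x, (bddInd (Set.univ : Set E) MeasurableSet.univ : E → ℝ) x = 1 := fun x => by
    simp [bddInd]
  obtain ⟨c, hc0, hc⟩ := bddMeas_bounded X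
  refine hX (hS.closed (fun n : ℕ => X + (1 / ((n : ℝ) + 1)) • bddInd Set.univ MeasurableSet.univ)
    X (c + 1) (fun n => hcon _ (by positivity))
    (fun n => .of_forall fun x => ?_) (.of_forall fun x => ?_))
  · simp only [Submodule.coe_add, Submodule.coe_smul, Pi.add_apply, Pi.smul_apply, hone,
      smul_eq_mul, mul_one]
    refine (abs_add_le _ _).trans (add_le_add (hc x) ?_)
    rw [abs_of_nonneg (by positivity), div_le_one (by positivity)]
    linarith [(Nat.cast_nonneg n : (0 : ℝ) ≤ n)]
  · simp only [Submodule.coe_add, Submodule.coe_smul, Pi.add_apply, Pi.smul_apply, hone,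
      smul_eq_mul, mul_one]
    simpa using (tendsto_const_nhds (x := (X : E → ℝ) x)).add
      (tendsto_one_div_add_atTop_nhds_zero_nat (𝕜 := ℝ))

theorem IsFatouConvex.preimage {ν : Measure E} {S : Set (bddMeas E)} (hS : IsFatouConvex ν S)
    (X : bddMeas E) (ε : ℝ) : IsFatouConvex ν {H | X + ε • H ∈ S} where
  convex := by
    intro f hf g hg a b ha hb hab
    have := hS.convex hf hg ha hb hab
    have h2 : a • (X + ε • f) + b • (X + ε • g) = X + ε • (a • f + b • g) := by
      rw [smul_add, smul_add, add_add_add_comm, ← add_smul, hab, one_smul, smul_add,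
        smul_comm a, smul_comm b]
    rwa [h2] at this
  closed := by
    intro H G b hH hb hlim
    obtain ⟨c, hc0, hc⟩ := bddMeas_bounded X
    refine hS.closed (fun n => X + ε • H n) _ (c + |ε| * b) hH (fun n => ?_) ?_
    · filter_upwards [hb n] with x hx
      simp only [Submodule.coe_add, Submodule.coe_smul, Pi.add_apply, Pi.smul_apply, smul_eq_mul]
      refine (abs_add_le _ _).trans (add_le_add (hc x) ?_)
      rw [abs_mul]
      gcongr
    · filter_upwards [hlim] with x hx
      simp only [Submodule.coe_add, Submodule.coe_smul, Pi.add_apply, Pi.smul_apply, smul_eq_mul]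
      exact tendsto_const_nhds.add (hx.const_mul ε)

/-- **Separation.** A point outside of a convex, upward closed set of bounded functions, which is
closed under bounded almost sure convergence, is separated from this set by a density. -/
theorem IsFatouConvex.exists_density {ν : Measure E} [IsProbabilityMeasure ν]
    {S : Set (bddMeas E)} (hS : IsFatouConvex ν S) (hSne : S.Nonempty)
    (hup : ∀ Y ∈ S, ∀ Y' : bddMeas E, (∀ᵐ x ∂ν, (Y : E → ℝ) x ≤ (Y' : E → ℝ) x) → Y' ∈ S)
    {X : bddMeas E} (hX : X ∉ S) :
    ∃ (Z : E → ℝ) (δ : ℝ), Measurable Z ∧ (∀ x, 0 ≤ Z x) ∧ Integrable Z ν ∧ 0 < δ ∧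
      ∀ Y ∈ S, δ ≤ ∫ x, Z x * ((Y : E → ℝ) x - (X : E → ℝ) x) ∂ν := by
  obtain ⟨ε, hε0, hm⟩ := hS.exists_ball hX
  -- If `|H| ≤ 1` and `X + εH` were in `S`, then upward closedness would put `X + ε` into `S`.
  obtain ⟨p, hp⟩ := (hS.preimage X ε).exists_exponents fun H hH hle => by
    refine hm (hup _ hH _ ?_)
    filter_upwards [hle] with x hx
    simp only [Submodule.coe_add, Submodule.coe_smul, Pi.add_apply, Pi.smul_apply, smul_eq_mul]
    have : (bddInd (Set.univ : Set E) MeasurableSet.univ : E → ℝ) x = 1 := by simp [bddInd]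
    rw [this]
    have := (le_abs_self _).trans hx
    gcongr
  obtain ⟨N, hN⟩ : ∃ N : bddMeas E → ℝ, ∀ H, N H = ⨆ n, scaledNorm ν p n H := ⟨_, fun _ => rfl⟩
  have N_hom : ∀ c : ℝ, 0 < c → ∀ H, N (c • H) = c * N H := by
    intro c hc H
    simp only [hN, scaledNorm_smul ν p _ hc]
    exact (Real.mul_iSup_of_nonneg hc.le _).symm
  have N_add : ∀ H G, N (H + G) ≤ N H + N G := fun H G => by
    simp only [hN]
    exact ciSup_le fun n => (scaledNorm_add_le ν p n H G).trans
      (add_le_add (le_ciSup (bddAbove_scaledNorm ν p H) n) (le_ciSup (bddAbove_scaledNorm ν p G) n))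
  let K : Set (bddMeas E) := (fun Y => ε⁻¹ • (Y - X)) '' S
  have hKconv : Convex ℝ K := by
    have : K = (fun Y => -(ε⁻¹ • X) + Y) '' ((fun Y => ε⁻¹ • Y) '' S) := by
      rw [Set.image_image]
      refine Set.image_congr fun Y _ => ?_
      rw [smul_sub]; abel
    rw [this]
    exact (hS.convex.smul ε⁻¹).translate _
  have hNK : ∀ k ∈ K, 1 ≤ N k := by
    rintro _ ⟨Y, hY, rfl⟩
    -- Replacing the increment by its positive part only moves upward, hence stays in `S`. So the
    -- exponents control the one-sided norms.
    have hmem : X + ε • bddPos (ε⁻¹ • (Y - X)) ∈ S := by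
      refine hup Y hY _ (.of_forall fun x => ?_)
      change (Y : E → ℝ) x ≤ (X : E → ℝ) x + ε * max (ε⁻¹ * ((Y : E → ℝ) x - (X : E → ℝ) x)) 0
      have h1 := mul_le_mul_of_nonneg_left
        (le_max_left (ε⁻¹ * ((Y : E → ℝ) x - (X : E → ℝ) x)) 0) hε0.le
      rw [← mul_assoc, mul_inv_cancel₀ hε0.ne', one_mul] at h1
      linarith
    obtain ⟨n, hn⟩ := hp _ hmem
    rw [hN]
    refine le_trans ?_ (le_ciSup (bddAbove_scaledNorm ν p _) n)
    unfold scaledNorm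
    rw [le_div_iff₀ (by positivity), one_mul]
    exact (ENNReal.ofReal_le_iff_le_toReal (eLpNorm_bddMeas_ne_top ν _ _)).1 hn.le
  obtain ⟨l, hlN, hl1⟩ := exists_linear_le_of_one_le N N_hom N_add hKconv (hSne.image _) hNK
  have hlpos : ∀ H : bddMeas E, (∀ x, 0 ≤ (H : E → ℝ) x) → 0 ≤ l H := by
    intro H hH
    have h0 : ∀ x, ((-H : bddMeas E) : E → ℝ) x ≤ 0 := fun x => neg_nonpos.2 (hH x)
    -- The norms see only positive parts, so they vanish on `-H`. Domination by a one-sided norm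
    -- thus yields positivity of `l`.
    have h1 : N (-H) ≤ 0 := by
      rw [hN]
      exact ciSup_le fun n => (scaledNorm_le ν p n (-H) le_rfl h0).trans_eq (zero_div _)
    have h2 := hlN (-H)
    rw [map_neg] at h2
    linarith
  have hlcont : ∀ (A : ℕ → Set E) (hA : ∀ n, MeasurableSet (A n)),
      Tendsto (fun n => ν (A n)) atTop (𝓝 0) →
        Tendsto (fun n => l (bddInd (A n) (hA n))) atTop (𝓝 0) := by
    intro A hA hlim
    refine tendsto_order.2 ⟨fun a ha => .of_forall fun n => ha.trans_le
      (hlpos _ fun x => Set.indicator_nonneg (fun _ _ => zero_le_one) x), fun a ha => ?_⟩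
    -- For `n ≥ n₀` the factor `1 / (n + 1)` suffices for any indicator; for the finitely many `n <
    -- n₀` the norms of the indicators tend to zero.
    obtain ⟨n₀, hn₀⟩ := exists_nat_one_div_lt (half_pos ha)
    have hev : ∀ᶠ k in atTop, ∀ n ∈ Finset.range n₀,
        scaledNorm ν p n (bddInd (A k) (hA k)) < a / 2 := by
      rw [Finset.eventually_all]
      exact fun n _ => (tendsto_order.1 (tendsto_scaledNorm_ind ν p n A hA hlim)).2 _ (half_pos ha)
    filter_upwards [hev] with k hk
    refine (hlN _).trans_lt (lt_of_le_of_lt ?_ (half_lt_self ha))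
    rw [hN]
    refine ciSup_le fun n => ?_
    by_cases hn : n < n₀
    · exact (hk n (Finset.mem_range.2 hn)).le
    · refine (scaledNorm_le ν p n _ zero_le_one
        (fun x => Set.indicator_le_self' (fun _ _ => zero_le_one) x)).trans (le_trans ?_ hn₀.le)
      have : (n₀ : ℝ) ≤ n := by exact_mod_cast not_lt.1 hn
      gcongr
  obtain ⟨Z, hZm, hZ0, hZi, hZ⟩ := exists_density_of_functional ν l hlpos hlcont
  refine ⟨Z, ε, hZm, hZ0, hZi, hε0, fun Y hY => ?_⟩
  have h1 := hl1 _ ⟨Y, hY, rfl⟩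
  rw [map_smul, smul_eq_mul, le_inv_mul_iff₀ hε0, mul_one, hZ] at h1
  exact h1

end ProcessRisk

namespace ProcessRisk

/-! Sums over time sets -/

variable {h : Horizon}

theorem coe_mem_times_of_le {h : Horizon} {m n : ℕ} (hmn : m ≤ n) (hn : (n : ℕ∞) ∈ h.times) :
    (m : ℕ∞) ∈ h.times := by
  cases h with
  | finite T => exact (show (m : ℕ∞) ≤ n by exact_mod_cast hmn).trans hn
  | nat => exact ENat.natCast_ne_top m
  | natTop => trivial

theorem zero_mem_times (h : Horizon) : (0 : ℕ∞) ∈ h.times := by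
  cases h with
  | finite T => exact (bot_le : (⊥ : ℕ∞) ≤ T)
  | nat => exact ENat.zero_ne_top
  | natTop => trivial

open Classical in
theorem hasSum_time_iff {M : Type*} [AddCommMonoid M] [TopologicalSpace M] (f : h.Time → M)
    (a : M) : HasSum f a ↔
      HasSum (fun s : ℕ∞ => if hs : s ∈ h.times then f ⟨s, hs⟩ else 0) a := by
  have h1 := hasSum_subtype_iff_of_support_subset (s := h.times) (a := a)
    (f := fun s : ℕ∞ => if hs : s ∈ h.times then f ⟨s, hs⟩ else 0) (fun s hs => by
      by_contra h'
      exact hs (dif_neg h'))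
  rw [← h1]
  have h2 : (fun s : ℕ∞ => if hs : s ∈ h.times then f ⟨s, hs⟩ else 0) ∘ (fun x : h.times => x.1) =
      f := by
    funext s
    simp [s.2]
  exact (by rw [h2] : HasSum ((fun s : ℕ∞ => if hs : s ∈ h.times then f ⟨s, hs⟩ else 0) ∘
    (fun x : h.times => x.1)) a ↔ HasSum f a).symm

theorem hasSum_enat {M : Type*} [AddCommMonoid M] [TopologicalSpace M] [ContinuousAdd M]
    {g : ℕ∞ → M} {b : M} (hb : HasSum (fun n : ℕ => g n) b) : HasSum g (b + g ⊤) := by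
  have hinj : Function.Injective (fun n : ℕ => (n : ℕ∞)) := Nat.cast_injective
  have h1 : HasSum (fun x : Set.range (fun n : ℕ => (n : ℕ∞)) => g x) b :=
    (hinj.hasSum_range_iff (f := g)).2 hb
  have h2 : HasSum (fun x : ({⊤} : Set ℕ∞) => g x) (g ⊤) := by
    have := hasSum_unique (fun x : ({⊤} : Set ℕ∞) => g x)
    exact this
  refine HasSum.add_isCompl ?_ h1 h2
  refine IsCompl.of_eq ?_ ?_
  · refine Set.eq_empty_iff_forall_notMem.2 ?_
    rintro _ ⟨⟨n, rfl⟩, h3⟩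
    exact ENat.natCast_ne_top n h3
  · refine Set.eq_univ_iff_forall.2 fun s => ?_
    induction s using ENat.recTopCoe with
    | top => exact Or.inr rfl
    | coe n => exact Or.inl ⟨n, rfl⟩

/-- The increments of a function on `ℕ₀ ∪ {∞}`. -/
def decr (d : ℕ∞ → ℝ) : ℕ∞ → ℝ
  | ⊤ => d ⊤
  | (n : ℕ) => d n - d ((n + 1 : ℕ) : ℕ∞)

@[simp] theorem decr_top (d : ℕ∞ → ℝ) : decr d ⊤ = d ⊤ := rfl

@[simp] theorem decr_coe (d : ℕ∞ → ℝ) (n : ℕ) : decr d n = d n - d ((n + 1 : ℕ) : ℕ∞) := rfl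

/-- The finite times telescope to `d k - d ⊤`, and the limit mass `d ⊤` sits at time `⊤`. -/
theorem hasSum_decr {d : ℕ∞ → ℝ} (hlim : Tendsto (fun n : ℕ => d n) atTop (𝓝 (d ⊤)))
    (hanti : ∀ n : ℕ, d ((n + 1 : ℕ) : ℕ∞) ≤ d n) (k : ℕ∞) :
    HasSum (fun s : ℕ∞ => if k ≤ s then decr d s else 0) (d k) := by
  induction k using ENat.recTopCoe with
  | top =>
    have : (fun s : ℕ∞ => if ⊤ ≤ s then decr d s else 0) = fun s => if s = ⊤ then d ⊤ else 0 := by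
      funext s
      by_cases hs : s = ⊤ <;> simp [hs]
    rw [this]
    exact hasSum_ite_eq ⊤ (d ⊤)
  | coe j =>
    have h1 : HasSum (fun n : ℕ => if (j : ℕ∞) ≤ n then decr d n else 0) (d j - d ⊤) := by
      rw [hasSum_iff_tendsto_nat_of_nonneg (fun n => by
        split_ifs with hjn
        · rw [decr_coe]; linarith [hanti n]
        · exact le_rfl)]
      have h2 : ∀ n, j ≤ n → ∑ i ∈ Finset.range n,
          (if (j : ℕ∞) ≤ i then decr d i else 0) = d j - d n := by
        intro n hn
        induction n, hn using Nat.le_induction with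
        | base =>
          rw [sub_self]
          refine Finset.sum_eq_zero fun i hi => if_neg ?_
          simpa using Finset.mem_range.1 hi
        | succ n hn ih =>
          rw [Finset.sum_range_succ, ih, if_pos (by exact_mod_cast hn), decr_coe]
          ring
      refine (tendsto_const_nhds.sub hlim).congr' ?_
      filter_upwards [eventually_ge_atTop j] with n hn using (h2 n hn).symm
    have h3 := hasSum_enat (g := fun s : ℕ∞ => if (j : ℕ∞) ≤ s then decr d s else 0) h1
    simpa using h3

variable {Ω : Type*} {mΩ : MeasurableSpace Ω} {F : Filtration ℕ mΩ} {P Q : Measure Ω}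

theorem extend_of_mem (D : h.Time → Ω → ℝ) {s : ℕ∞} (hs : s ∈ h.times) (ω : Ω) :
    extend D s ω = D ⟨s, hs⟩ ω := dif_pos hs

theorem extend_of_notMem (D : h.Time → Ω → ℝ) {s : ℕ∞} (hs : s ∉ h.times) (ω : Ω) :
    extend D s ω = 0 := dif_neg hs

theorem ofDiscounting_eq (D : h.Time → Ω → ℝ) (s : h.Time) (ω : Ω) :
    ofDiscounting D s ω = decr (fun r => extend D r ω) s := by
  obtain ⟨s, hs⟩ := s
  induction s using ENat.recTopCoe with
  | top => exact (extend_of_mem D hs ω).symm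
  | coe n =>
    change D ⟨(n : ℕ∞), hs⟩ ω - _ = extend D n ω - _
    rw [extend_of_mem D hs ω]

theorem extend_succ_le {D : h.Time → Ω → ℝ} {ω : Ω} (h0 : ∀ s, 0 ≤ D s ω)
    (ha : Antitone fun s => D s ω) (n : ℕ) : extend D ((n + 1 : ℕ) : ℕ∞) ω ≤ extend D n ω := by
  by_cases hn : ((n + 1 : ℕ) : ℕ∞) ∈ h.times
  · rw [extend_of_mem D hn, extend_of_mem D (coe_mem_times_of_le n.le_succ hn)]
    exact ha (show (n : ℕ∞) ≤ ((n + 1 : ℕ) : ℕ∞) by exact_mod_cast n.le_succ)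
  · rw [extend_of_notMem D hn]
    unfold extend
    split_ifs
    exacts [h0 _, le_rfl]

theorem IsDiscounting.hasSum_tail {D : h.Time → Ω → ℝ} (hD : IsDiscounting F P Q D) :
    ∀ᵐ ω ∂Q, ∀ k : ℕ∞, HasSum (fun s : h.Time => if k ≤ s then ofDiscounting D s ω else 0)
      (extend D k ω) := by
  classical
  filter_upwards [hD.nonneg, hD.antitone, hD.tendsto] with ω h0 ha hlim k
  rw [hasSum_time_iff]
  have h1 := hasSum_decr (d := fun r => extend D r ω) hlim (extend_succ_le h0 ha) k
  convert h1 using 2 with s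
  by_cases hs : s ∈ h.times
  · rw [dif_pos hs, ofDiscounting_eq]
  · rw [dif_neg hs]
    split_ifs
    · induction s using ENat.recTopCoe with
      | top => exact (extend_of_notMem D hs ω).symm
      | coe n =>
        -- A time beyond the horizon has its successor beyond the horizon too, so both terms of the
        -- increment vanish.
        have : ((n + 1 : ℕ) : ℕ∞) ∉ h.times := fun h' => hs (coe_mem_times_of_le n.le_succ h')
        rw [decr_coe, extend_of_notMem D hs, extend_of_notMem D this, sub_zero]
    · rfl

theorem ofDiscounting_nonneg {D : h.Time → Ω → ℝ} {ω : Ω} (h0 : ∀ s, 0 ≤ D s ω)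
    (ha : Antitone fun s => D s ω) (s : h.Time) : 0 ≤ ofDiscounting D s ω := by
  rw [ofDiscounting_eq]
  obtain ⟨s, hs⟩ := s
  induction s using ENat.recTopCoe with
  | top =>
    simp only [decr_top]
    rw [extend_of_mem D hs]
    exact h0 _
  | coe n =>
    simp only [decr_coe]
    linarith [extend_succ_le h0 ha n]

theorem predSig_le_sig (F : Filtration ℕ mΩ) (s : ℕ∞) : predSig F s ≤ sig F s := by
  induction s using ENat.recTopCoe with
  | top => exact le_rfl
  | coe n => exact F.mono (Nat.sub_le n 1)

theorem sig_le (F : Filtration ℕ mΩ) (s : ℕ∞) : sig F s ≤ mΩ := by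
  induction s using ENat.recTopCoe with
  | top => exact iSup_le F.le
  | coe n => exact F.le n

theorem sig_mono (F : Filtration ℕ mΩ) {r s : ℕ∞} (hrs : r ≤ s) : sig F r ≤ sig F s := by
  induction s using ENat.recTopCoe with
  | top =>
    induction r using ENat.recTopCoe with
    | top => exact le_rfl
    | coe m => exact le_iSup (fun n => (F n : MeasurableSpace Ω)) m
  | coe n =>
    induction r using ENat.recTopCoe with
    | top => exact absurd hrs (by simp)
    | coe m => exact F.mono (by exact_mod_cast hrs)

theorem IsDiscounting.measurable_extend {D : h.Time → Ω → ℝ} (hD : IsDiscounting F P Q D) (s : ℕ∞) :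
    Measurable[predSig F s] (extend D s) := by
  by_cases hs : s ∈ h.times
  · have : extend D s = D ⟨s, hs⟩ := funext fun ω => extend_of_mem D hs ω
    rw [this]
    exact hD.predictable ⟨s, hs⟩
  · have : extend D s = fun _ => 0 := funext fun ω => extend_of_notMem D hs ω
    rw [this]
    exact measurable_const

theorem IsDiscounting.isOptionalRandomMeasure {D : h.Time → Ω → ℝ} (hD : IsDiscounting F P Q D) :
    IsOptionalRandomMeasure F P Q (ofDiscounting D) where
  adapted := by
    rintro ⟨s, hs⟩
    have : ofDiscounting D ⟨s, hs⟩ = fun ω => decr (fun r => extend D r ω) s :=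
      funext fun ω => ofDiscounting_eq D ⟨s, hs⟩ ω
    rw [this]
    induction s using ENat.recTopCoe with
    | top => exact hD.measurable_extend ⊤
    | coe n =>
      exact ((hD.measurable_extend n).mono (predSig_le_sig F n) le_rfl).sub
        (hD.measurable_extend ((n + 1 : ℕ) : ℕ∞))
  nonneg := by
    filter_upwards [hD.nonneg, hD.antitone] with ω h0 ha using ofDiscounting_nonneg h0 ha
  sum_one := by
    filter_upwards [hD.hasSum_tail, hD.init] with ω h1 h2
    simpa [h2] using h1 0
  null_singular := by
    rintro ⟨s, hs⟩ hst
    simp only at hst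
    subst hst
    filter_upwards [hD.null_singular] with ω h1 h2
    rw [ofDiscounting_eq]
    exact h1 h2

theorem IsDiscounting.discount_eq {D : h.Time → Ω → ℝ} (hD : IsDiscounting F P Q D) (t : ℕ) :
    discount (ofDiscounting D) t =ᵐ[Q] extend D t := by
  filter_upwards [hD.hasSum_tail] with ω h1 using (h1 t).tsum_eq

end ProcessRisk

namespace ProcessRisk

/-! Absolute continuity along the filtration and optional weights -/

variable {h : Horizon} {Ω : Type*} {mΩ : MeasurableSpace Ω} {F : Filtration ℕ mΩ}
  {P Q : Measure Ω}

theorem measurableSet_le_of {m : MeasurableSpace Ω} {α : Type*} [TopologicalSpace α]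
    [MeasurableSpace α] [BorelSpace α] [LinearOrder α] [OrderClosedTopology α]
    [SecondCountableTopology α] {f g : Ω → α} (hf : Measurable[m] f) (hg : Measurable[m] g) :
    MeasurableSet[m] {ω | f ω ≤ g ω} := measurableSet_le hf hg

theorem measurable_abs_of {m : MeasurableSpace Ω} {f : Ω → ℝ} (hf : Measurable[m] f) :
    Measurable[m] fun ω => |f ω| := hf.abs

theorem exists_algebra_approx {m : MeasurableSpace Ω} (μ : Measure[m] Ω) [IsFiniteMeasure μ]
    {A : Set (Set Ω)} (hA : IsSetAlgebra A) (hm : m = MeasurableSpace.generateFrom A)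
    {B : Set Ω} (hB : MeasurableSet[m] B) {ε : ℝ} (hε : 0 < ε) :
    ∃ C ∈ A, μ (symmDiff B C) < ENNReal.ofReal ε :=
  (Measure.MeasureDense.of_generateFrom_isSetAlgebra_finite μ hA hm).approx B hB
    (measure_ne_top _ _) ε hε

theorem exists_nat_bound_of_limsup_lt_top {x : ℕ → ENNReal} (hx : ∀ n, x n < ⊤)
    (hlim : limsup x atTop < ⊤) : ∃ K : ℕ, ∀ n, x n ≤ K := by
  obtain ⟨c, hc1, hc2⟩ := exists_between hlim
  have hev : ∀ᶠ n in atTop, x n < c := eventually_lt_of_limsup_lt hc1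
  obtain ⟨N, hN⟩ := eventually_atTop.1 hev
  have hsup : (Finset.range N).sup x ⊔ c < ⊤ := by
    refine max_lt ?_ hc2
    rw [Finset.sup_lt_iff (by simp)]
    exact fun n _ => hx n
  obtain ⟨K, hK⟩ := ENNReal.exists_nat_gt hsup.ne
  refine ⟨K, fun n => ?_⟩
  by_cases hn : n < N
  · exact ((Finset.le_sup (f := x) (Finset.mem_range.2 hn)).trans le_sup_left).trans hK.le
  · exact ((hN n (not_lt.1 hn)).le.trans le_sup_right).trans hK.le

theorem isSetAlgebra_filtration (F : Filtration ℕ mΩ) :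
    IsSetAlgebra {A | ∃ n, MeasurableSet[F n] A} where
  empty_mem := ⟨0, @MeasurableSet.empty _ (F 0)⟩
  compl_mem := by
    rintro s ⟨n, hn⟩
    exact ⟨n, hn.compl⟩
  union_mem := by
    rintro s s' ⟨n, hn⟩ ⟨m, hm⟩
    exact ⟨max n m, (F.mono (le_max_left n m) s hn).union (F.mono (le_max_right n m) s' hm)⟩

theorem generateFrom_filtration (F : Filtration ℕ mΩ) :
    (⨆ n, F n : MeasurableSpace Ω) =
      MeasurableSpace.generateFrom {A | ∃ n, MeasurableSet[F n] A} := by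
  refine le_antisymm (iSup_le fun n A hA => MeasurableSpace.measurableSet_generateFrom ⟨n, hA⟩)
    (MeasurableSpace.generateFrom_le ?_)
  rintro A ⟨n, hA⟩
  exact le_iSup (fun n => (F n : MeasurableSpace Ω)) n A hA

theorem measurable_trim_rnDeriv (F : Filtration ℕ mΩ) (P Q : Measure Ω) (n : ℕ) :
    Measurable[F n] ((Q.trim (F.le n)).rnDeriv (P.trim (F.le n))) :=
  Measure.measurable_rnDeriv _ _

theorem setLIntegral_trim_rnDeriv [IsFiniteMeasure P] [IsFiniteMeasure Q] {n : ℕ}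
    (hac : Q.trim (F.le n) ≪ P.trim (F.le n)) {A : Set Ω} (hA : MeasurableSet[F n] A) :
    ∫⁻ ω in A, (Q.trim (F.le n)).rnDeriv (P.trim (F.le n)) ω ∂P = Q A := by
  rw [← setLIntegral_trim (F.le n) (measurable_trim_rnDeriv F P Q n) hA,
    Measure.setLIntegral_rnDeriv hac, trim_measurableSet_eq _ hA]

theorem ae_trim_rnDeriv_lt_top [IsFiniteMeasure P] [IsFiniteMeasure Q]
    (hac : ∀ n, Q.trim (F.le n) ≪ P.trim (F.le n)) :
    ∀ᵐ ω ∂Q, ∀ n, (Q.trim (F.le n)).rnDeriv (P.trim (F.le n)) ω < ⊤ :=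
  ae_all_iff.2 fun n => ae_of_ae_trim (F.le n) ((hac n).ae_le (Measure.rnDeriv_lt_top _ _))

/-- `Q` is absolutely continuous with respect to `P` on the set where the density process stays
bounded. -/
theorem measure_inter_densityLimit_ne_top [IsFiniteMeasure P] [IsFiniteMeasure Q]
    (hac : ∀ n, Q.trim (F.le n) ≪ P.trim (F.le n)) {B : Set Ω}
    (hB : MeasurableSet[⨆ n, F n] B) (hPB : P B = 0) :
    Q (B ∩ {ω | densityLimit F P Q ω ≠ ⊤}) = 0 := by
  let m : ℕ → Ω → ENNReal := fun n => (Q.trim (F.le n)).rnDeriv (P.trim (F.le n))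
  let C : ℕ → Set Ω := fun K => {ω | ∀ n, m n ω ≤ K}
  have hle : (⨆ n, F n : MeasurableSpace Ω) ≤ mΩ := iSup_le F.le
  -- On `C K` the density process is at most `K`, so `Q ≤ K P` there for events of any `F n`.
  -- Approximation of `B` by such events under `P + Q` carries this over to `F_∞`.
  have h1 : ∀ K n A, MeasurableSet[F n] A → Q (A ∩ C K) ≤ K * P A := by
    intro K n A hA
    have hm : MeasurableSet[F n] {ω | m n ω ≤ K} :=
      measurableSet_le_of (measurable_trim_rnDeriv F P Q n) measurable_const
    calc Q (A ∩ C K) ≤ Q (A ∩ {ω | m n ω ≤ K}) :=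
          measure_mono (Set.inter_subset_inter_right _ fun ω hω => hω n)
      _ = ∫⁻ ω in A ∩ {ω | m n ω ≤ K}, m n ω ∂P :=
          (setLIntegral_trim_rnDeriv (hac n) (hA.inter hm)).symm
      _ ≤ ∫⁻ ω in A ∩ {ω | m n ω ≤ K}, K ∂P :=
          setLIntegral_mono' (F.le n _ (hA.inter hm)) fun ω hω => hω.2
      _ ≤ K * P A := by
          rw [setLIntegral_const]
          gcongr
          exact Set.inter_subset_left
  have h2 : ∀ K, Q (B ∩ C K) = 0 := by
    intro K
    refine le_antisymm (le_of_forall_pos_le_add fun ε hε => ?_) bot_le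
    rw [zero_add]
    by_cases hεt : ε = ⊤
    · rw [hεt]; exact le_top
    -- The total error below is `(K + 1)` times the approximation error.
    have hη : (0 : ℝ) < ε.toReal / (K + 1) := by
      have := ENNReal.toReal_pos hε.ne' hεt
      positivity
    obtain ⟨A, ⟨n, hA⟩, hAB⟩ := exists_algebra_approx ((P + Q).trim hle)
      (isSetAlgebra_filtration F) (generateFrom_filtration F) hB hη
    have hAm : MeasurableSet[⨆ n, F n] A := le_iSup (fun n => (F n : MeasurableSpace Ω)) n A hA
    rw [trim_measurableSet_eq hle (@MeasurableSet.symmDiff _ (⨆ n, F n) _ _ hB hAm)] at hAB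
    have h3 : P A ≤ (P + Q) (symmDiff B A) := by
      calc P A ≤ P (B ∪ symmDiff B A) := measure_mono fun ω hω => by
            by_cases hωB : ω ∈ B
            · exact Or.inl hωB
            · exact Or.inr (Or.inr ⟨hω, hωB⟩)
        _ ≤ P B + P (symmDiff B A) := measure_union_le _ _
        _ ≤ (P + Q) (symmDiff B A) := by
            rw [hPB, zero_add]; exact Measure.le_add_right le_rfl _
    calc Q (B ∩ C K) ≤ Q ((A ∩ C K) ∪ symmDiff B A) := measure_mono fun ω hω => by
            by_cases hωA : ω ∈ A
            · exact Or.inl ⟨hωA, hω.2⟩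
            · exact Or.inr (Or.inl ⟨hω.1, hωA⟩)
      _ ≤ Q (A ∩ C K) + Q (symmDiff B A) := measure_union_le _ _
      _ ≤ K * P A + (P + Q) (symmDiff B A) :=
          add_le_add (h1 K n A hA) (Measure.le_add_left le_rfl _)
      _ ≤ K * (P + Q) (symmDiff B A) + (P + Q) (symmDiff B A) := by gcongr
      _ = (K + 1) * (P + Q) (symmDiff B A) := by ring
      _ ≤ (K + 1) * ENNReal.ofReal (ε.toReal / (K + 1)) := by gcongr
      _ = ε := by
          rw [ENNReal.ofReal_div_of_pos (by positivity), ENNReal.ofReal_toReal hεt,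
            ENNReal.ofReal_add (by positivity) zero_le_one, ENNReal.ofReal_natCast,
            ENNReal.ofReal_one]
          exact ENNReal.mul_div_cancel (by simp) (by simp)
  have h3 : ∀ᵐ ω ∂Q, ∀ K, ω ∉ B ∩ C K := ae_all_iff.2 fun K => measure_eq_zero_iff_ae_notMem.1 (h2 K)
  rw [measure_eq_zero_iff_ae_notMem]
  filter_upwards [h3, ae_trim_rnDeriv_lt_top hac] with ω hω hlt hmem
  obtain ⟨K, hK⟩ := exists_nat_bound_of_limsup_lt_top hlt (lt_top_iff_ne_top.2 hmem.2)
  exact hω K ⟨hmem.1, hK⟩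

theorem measure_eq_zero_of_trim_ac {m : MeasurableSpace Ω} (hm : m ≤ mΩ)
    (hac : Q.trim hm ≪ P.trim hm) {B : Set Ω} (hB : MeasurableSet[m] B) (hPB : P B = 0) :
    Q B = 0 := by
  rw [← trim_measurableSet_eq hm hB] at hPB ⊢
  exact hac hPB

theorem ae_of_trim_ac {m : MeasurableSpace Ω} (hm : m ≤ mΩ)
    (hac : Q.trim hm ≪ P.trim hm) {p : Ω → Prop} (hp : MeasurableSet[m] {ω | p ω})
    (hP : ∀ᵐ ω ∂P, p ω) : ∀ᵐ ω ∂Q, p ω := by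
  rw [ae_iff] at hP ⊢
  exact measure_eq_zero_of_trim_ac hm hac hp.compl hP

/-- A measure in `𝓜_loc(P)` weighted by an optional random measure charges no `P`-null sets. -/
theorem IsOptionalRandomMeasure.ae_eq_zero [IsProbabilityMeasure P] {γ : h.Time → Ω → ℝ}
    (hγ : IsOptionalRandomMeasure F P Q γ) (hQ : IsLocAC h F P Q) (s : h.Time) {B : Set Ω}
    (hB : MeasurableSet[sig F s] B) (hPB : P B = 0) : ∀ᵐ ω ∂Q, ω ∈ B → γ s ω = 0 := by
  have := hQ.1
  obtain ⟨s, hs⟩ := s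
  induction s using ENat.recTopCoe with
  | top =>
    have hall : ∀ n : ℕ, Q.trim (F.le n) ≪ P.trim (F.le n) := fun n => hQ.2 n (by
      cases h with
      | finite T => exact absurd (top_le_iff.1 hs) (ENat.natCast_ne_top T)
      | nat => exact absurd rfl hs
      | natTop => trivial)
    have h1 := measure_eq_zero_iff_ae_notMem.1 (measure_inter_densityLimit_ne_top hall hB hPB)
    filter_upwards [h1, hγ.null_singular ⟨⊤, hs⟩ rfl] with ω h1 h2 hω
    by_contra h3
    exact h1 ⟨hω, fun h4 => h3 (h2 h4)⟩
  | coe n =>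
    have h1 := measure_eq_zero_of_trim_ac (F.le n) (hQ.2 n hs) hB hPB
    filter_upwards [measure_eq_zero_iff_ae_notMem.1 h1] with ω h1 hω using absurd hω h1

/-- Random sub-probability weights on `𝕋` that charge no `P`-null optional events. -/
structure IsWeight (F : Filtration ℕ mΩ) (P Q : Measure Ω) (w : h.Time → Ω → ℝ) : Prop where
  measurable : ∀ s, Measurable (w s)
  nonneg : ∀ᵐ ω ∂Q, ∀ s, 0 ≤ w s ω
  sum_le : ∀ᵐ ω ∂Q, ∃ a ≤ 1, HasSum (fun s => w s ω) a
  ac : ∀ (s : h.Time) (B : Set Ω), MeasurableSet[sig F s] B → P B = 0 →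
    ∀ᵐ ω ∂Q, ω ∈ B → w s ω = 0

/-- The normalized weights `γ_s / D_t`, `s ≥ t`. -/
noncomputable def condWeight (γ : h.Time → Ω → ℝ) (t : ℕ) (s : h.Time) (ω : Ω) : ℝ :=
  if (t : ℕ∞) ≤ s then γ s ω / discount γ t ω else 0

/-- The weighted sum `∑_s w_s X_s`. -/
noncomputable def pair (w X : h.Time → Ω → ℝ) (ω : Ω) : ℝ := ∑' s, w s ω * X s ω

theorem measurable_tsum_time {m : MeasurableSpace Ω} {f : h.Time → Ω → ℝ}
    (hf : ∀ s, Measurable[m] (f s)) : Measurable[m] fun ω => ∑' s, f s ω :=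
  Measurable.tsum hf

theorem IsOptionalRandomMeasure.measurable {γ : h.Time → Ω → ℝ}
    (hγ : IsOptionalRandomMeasure F P Q γ) (s : h.Time) : Measurable (γ s) :=
  (hγ.adapted s).mono (sig_le F s) le_rfl

theorem IsOptionalRandomMeasure.measurable_discount {γ : h.Time → Ω → ℝ}
    (hγ : IsOptionalRandomMeasure F P Q γ) (t : ℕ) : Measurable (discount γ t) := by
  refine measurable_tsum_time fun s => ?_
  by_cases hs : (t : ℕ∞) ≤ s
  · simpa only [hs, if_true] using hγ.measurable s
  · simp only [hs, if_false]; exact measurable_const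

theorem IsOptionalRandomMeasure.isWeight [IsProbabilityMeasure P] {γ : h.Time → Ω → ℝ}
    (hγ : IsOptionalRandomMeasure F P Q γ) (hQ : IsLocAC h F P Q) (t : ℕ) :
    IsWeight F P Q (condWeight γ t) where
  measurable := fun s => by
    unfold condWeight
    split_ifs
    · exact (hγ.measurable s).div (hγ.measurable_discount t)
    · exact measurable_const
  nonneg := by
    filter_upwards [hγ.nonneg] with ω h0 s
    unfold condWeight
    split_ifs
    · exact div_nonneg (h0 s) (tsum_nonneg fun r => by split_ifs; exacts [h0 r, le_rfl])
    · exact le_rfl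
  sum_le := by
    filter_upwards [hγ.nonneg, hγ.sum_one] with ω h0 h1
    have h2 : Summable fun s : h.Time => if (t : ℕ∞) ≤ s then γ s ω else 0 :=
      Summable.of_nonneg_of_le (fun s => by split_ifs; exacts [h0 s, le_rfl])
        (fun s => by split_ifs; exacts [le_rfl, h0 s]) h1.summable
    -- The total weight is `D_t / D_t`, which is `0` and not `1` where `D_t = 0`. For this reason
    -- weights are only required to have mass at most one.
    refine ⟨discount γ t ω / discount γ t ω, div_self_le_one _, ?_⟩
    have h3 : (fun s => condWeight γ t s ω) =
        fun s : h.Time => (if (t : ℕ∞) ≤ s then γ s ω else 0) / discount γ t ω := by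
      funext s
      rw [ite_div, zero_div]
      rfl
    rw [h3]
    exact h2.hasSum.div_const _
  ac := by
    intro s B hB hPB
    filter_upwards [hγ.ae_eq_zero hQ s hB hPB] with ω h1 hω
    unfold condWeight
    rw [h1 hω, zero_div, ite_self]

namespace IsWeight

variable {w w' X Y : h.Time → Ω → ℝ} {c : ℝ}

/-- `Q` need not be absolutely continuous on `F_∞`, so `P`-almost sure properties carry over to `Q`
only where the weight is nonzero. This is enough for everything that enters through `pair`. -/
theorem ae_imp (hw : IsWeight F P Q w) {p : h.Time → Ω → Prop}
    (hp : ∀ s : h.Time, MeasurableSet[sig F s] {ω | p s ω}) (hP : ∀ s, ∀ᵐ ω ∂P, p s ω) :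
    ∀ᵐ ω ∂Q, ∀ s, w s ω ≠ 0 → p s ω := by
  refine ae_all_iff.2 fun s => ?_
  filter_upwards [hw.ac s _ (hp s).compl (ae_iff.1 (hP s))] with ω h1 h2
  by_contra h3
  exact h2 (h1 h3)

theorem ae_bound (hw : IsWeight F P Q w) (hX : IsAdapted F X)
    (hc : ∀ s, ∀ᵐ ω ∂P, |X s ω| ≤ c) : ∀ᵐ ω ∂Q, ∀ s, |w s ω * X s ω| ≤ c * w s ω := by
  have h1 := hw.ae_imp (p := fun s ω => |X s ω| ≤ c) (fun s => by
    have hm : Measurable[sig F s] fun ω => |X s ω| := measurable_abs_of (hX s)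
    exact measurableSet_le_of hm measurable_const) hc
  filter_upwards [h1, hw.nonneg] with ω h1 h2 s
  rw [abs_mul, abs_of_nonneg (h2 s), mul_comm]
  rcases (h2 s).eq_or_lt with h0 | h0
  · simp [← h0]
  · exact mul_le_mul_of_nonneg_right (h1 s h0.ne') h0.le

theorem ae_summable (hw : IsWeight F P Q w) (hX : IsAdapted F X)
    (hc : ∀ s, ∀ᵐ ω ∂P, |X s ω| ≤ c) :
    ∀ᵐ ω ∂Q, Summable (fun s => w s ω * X s ω) := by
  filter_upwards [hw.ae_bound hX hc, hw.sum_le] with ω h1 ⟨a, _, ha⟩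
  exact Summable.of_norm_bounded (ha.summable.mul_left c) h1

theorem ae_abs_pair_le (hw : IsWeight F P Q w) (hX : IsAdapted F X) (hc0 : 0 ≤ c)
    (hc : ∀ s, ∀ᵐ ω ∂P, |X s ω| ≤ c) : ∀ᵐ ω ∂Q, |pair w X ω| ≤ c := by
  filter_upwards [hw.ae_bound hX hc, hw.sum_le] with ω h1 ⟨a, ha1, ha⟩
  have h2 := tsum_of_norm_bounded (f := fun s => w s ω * X s ω) (ha.mul_left c) h1
  exact h2.trans (mul_le_of_le_one_right hc0 ha1)

theorem measurable_pair (hw : IsWeight F P Q w) (hX : IsAdapted F X) :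
    Measurable (pair w X) :=
  measurable_tsum_time fun s => (hw.measurable s).mul ((hX s).mono (sig_le F s) le_rfl)

theorem integrable_pair [IsFiniteMeasure Q] (hw : IsWeight F P Q w) (hX : IsAdapted F X)
    (hc0 : 0 ≤ c) (hc : ∀ s, ∀ᵐ ω ∂P, |X s ω| ≤ c) : Integrable (pair w X) Q :=
  Integrable.of_bound (hw.measurable_pair hX).aestronglyMeasurable c (hw.ae_abs_pair_le hX hc0 hc)

end IsWeight

end ProcessRisk

namespace ProcessRisk

/-! Multiplicative decomposition of supermartingales into a martingale and a discounting process -/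

open scoped NNReal ENNReal

variable {h : Horizon} {Ω : Type*} {mΩ : MeasurableSpace Ω} {F : Filtration ℕ mΩ}
  {P : Measure Ω} {a w : ℕ → Ω → ℝ≥0}

/-- The predictable factor of the multiplicative decomposition of `a + w`. -/
noncomputable def multD (a w : ℕ → Ω → ℝ≥0) : ℕ → Ω → ℝ≥0
  | 0 => fun _ => 1
  | n + 1 => fun ω => multD a w n ω * (w n ω / (a n ω + w n ω))

/-- The martingale factor of the multiplicative decomposition of `a + w`. -/
noncomputable def multM (a w : ℕ → Ω → ℝ≥0) : ℕ → Ω → ℝ≥0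
  | 0 => fun ω => a 0 ω + w 0 ω
  | n + 1 => fun ω => if w n ω = 0 then multM a w n ω else
      multM a w n ω * ((a (n + 1) ω + w (n + 1) ω) / w n ω)

/-- The supermartingale `a + w`, where `w` is its one-step conditional expectation. -/
structure IsPotentialPair (F : Filtration ℕ mΩ) (P : Measure Ω) (a w : ℕ → Ω → ℝ≥0) : Prop where
  measurable_left : ∀ n, Measurable[F n] (a n)
  measurable_right : ∀ n, Measurable[F n] (w n)
  step : ∀ n A, MeasurableSet[F n] A →
    ∫⁻ ω in A, ((a (n + 1) ω + w (n + 1) ω : ℝ≥0) : ℝ≥0∞) ∂P = ∫⁻ ω in A, (w n ω : ℝ≥0∞) ∂P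
  total : ∫⁻ ω, ((a 0 ω + w 0 ω : ℝ≥0) : ℝ≥0∞) ∂P = 1

theorem multD_succ_le (a w : ℕ → Ω → ℝ≥0) (n : ℕ) (ω : Ω) :
    multD a w (n + 1) ω ≤ multD a w n ω :=
  mul_le_of_le_one_right bot_le (div_le_one_of_le₀ le_add_self bot_le)

theorem multD_antitone (a w : ℕ → Ω → ℝ≥0) (ω : Ω) : Antitone fun n => multD a w n ω :=
  antitone_nat_of_succ_le fun n => multD_succ_le a w n ω

theorem multD_le_one (a w : ℕ → Ω → ℝ≥0) (n : ℕ) (ω : Ω) : multD a w n ω ≤ 1 :=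
  multD_antitone a w ω (Nat.zero_le n)

namespace IsPotentialPair

theorem measurable_multD (hp : IsPotentialPair F P a w) (n : ℕ) :
    Measurable[F (n - 1)] (multD a w n) := by
  induction n with
  | zero => exact measurable_const
  | succ n ih =>
    have h1 : Measurable[F n] (multD a w n) := ih.mono (F.mono (Nat.sub_le n 1)) le_rfl
    exact h1.mul ((hp.measurable_right n).div
      ((hp.measurable_left n).add (hp.measurable_right n)))

theorem measurable_sum (hp : IsPotentialPair F P a w) (n : ℕ) :
    Measurable[F n] fun ω => a n ω + w n ω :=
  (hp.measurable_left n).add (hp.measurable_right n)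

theorem measurableSet_eq_zero (hp : IsPotentialPair F P a w) (n : ℕ) :
    MeasurableSet[F n] {ω | w n ω = 0} :=
  hp.measurable_right n (measurableSet_singleton 0)

theorem measurable_multM (hp : IsPotentialPair F P a w) (n : ℕ) :
    Measurable[F n] (multM a w n) := by
  induction n with
  | zero => exact hp.measurable_sum 0
  | succ n ih =>
    have h1 : Measurable[F (n + 1)] (multM a w n) := ih.mono (F.mono n.le_succ) le_rfl
    have h2 : Measurable[F (n + 1)] (w n) :=
      (hp.measurable_right n).mono (F.mono n.le_succ) le_rfl
    exact Measurable.ite (F.mono n.le_succ _ (hp.measurableSet_eq_zero n)) h1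
      (h1.mul ((hp.measurable_sum (n + 1)).div h2))

theorem ae_multM_mul_multD (hp : IsPotentialPair F P a w) :
    ∀ᵐ ω ∂P, ∀ n, multM a w n ω * multD a w n ω = a n ω + w n ω := by
  -- Where the one-step conditional expectation vanishes, the nonnegative next value vanishes almost
  -- surely. This handles the division by zero in `multD` and `multM`.
  have h0 : ∀ n, ∀ᵐ ω ∂P, w n ω = 0 → a (n + 1) ω + w (n + 1) ω = 0 := by
    intro n
    have h1 := hp.step n _ (hp.measurableSet_eq_zero n)
    have hm := F.le n _ (hp.measurableSet_eq_zero n)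
    have h2 : ∫⁻ ω in {ω | w n ω = 0}, (w n ω : ℝ≥0∞) ∂P = 0 := by
      rw [setLIntegral_congr_fun hm (g := fun _ => 0) fun ω hω => by
        rw [show w n ω = 0 from hω]; rfl]
      simp
    rw [h2, lintegral_eq_zero_iff ((hp.measurable_sum (n + 1)).mono
      (F.le _) le_rfl).coe_nnreal_ennreal, Filter.EventuallyEq, ae_restrict_iff' hm] at h1
    filter_upwards [h1] with ω h1 hω
    have h2 := h1 hω
    simp only [Pi.zero_apply] at h2
    exact_mod_cast h2
  filter_upwards [ae_all_iff.2 h0] with ω h0 n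
  induction n with
  | zero => simp [multM, multD]
  | succ n ih =>
    by_cases hw : w n ω = 0
    · simp [multD, hw, h0 n hw]
    · have hs : a n ω + w n ω ≠ 0 := fun h' => hw (add_eq_zero.1 h').2
      simp only [multM, multD, if_neg hw]
      rw [mul_mul_mul_comm, ih]
      field_simp

theorem lintegral_mul_step (hp : IsPotentialPair F P a w) [IsFiniteMeasure P] (n : ℕ)
    {g : Ω → ℝ≥0∞} (hg : Measurable[F n] g) :
    ∫⁻ ω, g ω * ((a (n + 1) ω + w (n + 1) ω : ℝ≥0) : ℝ≥0∞) ∂P =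
      ∫⁻ ω, g ω * (w n ω : ℝ≥0∞) ∂P := by
  have hg' : Measurable g := hg.mono (F.le n) le_rfl
  have hm1 : Measurable fun ω => ((a (n + 1) ω + w (n + 1) ω : ℝ≥0) : ℝ≥0∞) :=
    ((hp.measurable_sum (n + 1)).mono (F.le _) le_rfl).coe_nnreal_ennreal
  have hm2 : Measurable fun ω => (w n ω : ℝ≥0∞) :=
    ((hp.measurable_right n).mono (F.le _) le_rfl).coe_nnreal_ennreal
  have h1 : (P.withDensity fun ω => ((a (n + 1) ω + w (n + 1) ω : ℝ≥0) : ℝ≥0∞)).trim (F.le n) =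
      (P.withDensity fun ω => (w n ω : ℝ≥0∞)).trim (F.le n) := by
    refine @Measure.ext _ (F n) _ _ fun A hA => ?_
    rw [trim_measurableSet_eq _ hA, trim_measurableSet_eq _ hA, withDensity_apply _ (F.le n A hA),
      withDensity_apply _ (F.le n A hA), hp.step n A hA]
  have h2 := congrArg (fun m => @lintegral _ (F n) m g) h1
  simp only [lintegral_trim (F.le n) hg] at h2
  rw [lintegral_withDensity_eq_lintegral_mul _ hm1 hg',
    lintegral_withDensity_eq_lintegral_mul _ hm2 hg'] at h2
  simpa only [Pi.mul_apply, mul_comm] using h2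

/-- The martingale property of the first factor. On `{w n = 0}` the factor is frozen; elsewhere the
next value is the `F n`-measurable `M_n / w_n` times the next value of the supermartingale, whose
conditional expectation is `w_n`. -/
theorem setLIntegral_multM_succ (hp : IsPotentialPair F P a w) [IsFiniteMeasure P] (n : ℕ)
    {A : Set Ω} (hA : MeasurableSet[F n] A) :
    ∫⁻ ω in A, (multM a w (n + 1) ω : ℝ≥0∞) ∂P = ∫⁻ ω in A, (multM a w n ω : ℝ≥0∞) ∂P := by
  have hZ := hp.measurableSet_eq_zero n
  have hAm := F.le n A hA
  have hZm := F.le n _ hZ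
  rw [← lintegral_inter_add_sdiff (μ := P) (A := A) _ hZm,
    ← lintegral_inter_add_sdiff (μ := P) (A := A) (fun ω => (multM a w n ω : ℝ≥0∞)) hZm]
  congr 1
  · refine setLIntegral_congr_fun (hAm.inter hZm) fun ω hω => ?_
    have : w n ω = 0 := hω.2
    simp [multM, this]
  · have hB : MeasurableSet[F n] (A \ {ω | w n ω = 0}) := hA.diff hZ
    have hBm := F.le n _ hB
    let g : Ω → ℝ≥0∞ := (A \ {ω | w n ω = 0}).indicator
      fun ω => ((multM a w n ω / w n ω : ℝ≥0) : ℝ≥0∞)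
    have hg : Measurable[F n] g :=
      (((hp.measurable_multM n).div (hp.measurable_right n)).coe_nnreal_ennreal).indicator hB
    have h1 := hp.lintegral_mul_step n hg
    rw [← lintegral_indicator hBm, ← lintegral_indicator hBm]
    convert h1 using 2 with ω ω
    · funext ω
      by_cases hω : ω ∈ A \ {ω | w n ω = 0}
      · have hw : w n ω ≠ 0 := hω.2
        simp only [g, Set.indicator_of_mem hω, multM, if_neg hw]
        rw [← ENNReal.coe_mul, ENNReal.coe_inj]
        field_simp
      · simp only [g, Set.indicator_of_notMem hω, zero_mul]
    · funext ω
      by_cases hω : ω ∈ A \ {ω | w n ω = 0}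
      · have hw : w n ω ≠ 0 := hω.2
        simp only [g, Set.indicator_of_mem hω]
        rw [← ENNReal.coe_mul, ENNReal.coe_inj]
        field_simp
      · simp only [g, Set.indicator_of_notMem hω, zero_mul]

theorem lintegral_multM (hp : IsPotentialPair F P a w) [IsFiniteMeasure P] (n : ℕ) :
    ∫⁻ ω, (multM a w n ω : ℝ≥0∞) ∂P = 1 := by
  induction n with
  | zero => exact hp.total
  | succ n ih =>
    have h1 := hp.setLIntegral_multM_succ n (A := Set.univ) MeasurableSet.univ
    rw [setLIntegral_univ, setLIntegral_univ] at h1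
    rw [h1, ih]

/-- Since `M_n D_n = a_n + w_n` and `M_n D_{n+1} = w_n`, the increment of the discount factor
recovers the density `a_n`. -/
theorem ae_multM_mul_sub (hp : IsPotentialPair F P a w) :
    ∀ᵐ ω ∂P, ∀ n, multM a w n ω * (multD a w n ω - multD a w (n + 1) ω) = a n ω := by
  filter_upwards [hp.ae_multM_mul_multD] with ω hω n
  have h1 : multM a w n ω * multD a w (n + 1) ω = w n ω := by
    simp only [multD]
    rw [← mul_assoc, hω n]
    by_cases hs : a n ω + w n ω = 0
    · rw [hs, zero_mul, (add_eq_zero.1 hs).2]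
    · field_simp
  rw [mul_tsub, hω n, h1, add_tsub_cancel_right]

end IsPotentialPair

/-- A martingale of densities defines a probability measure in `𝓜_loc(P)`. -/
theorem exists_measure_of_densities [IsProbabilityMeasure P]
    (hFT : ⨆ s : h.Time, sig F s = mΩ) (hstd : h.IsInfinite → IsStandardFiltration F)
    {M : ℕ → Ω → ℝ≥0}
    (hM1 : ∀ n, ∫⁻ ω, (M n ω : ℝ≥0∞) ∂P = 1)
    (hMs : ∀ n A, MeasurableSet[F n] A →
      ∫⁻ ω in A, (M (n + 1) ω : ℝ≥0∞) ∂P = ∫⁻ ω in A, (M n ω : ℝ≥0∞) ∂P) :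
    ∃ Q : Measure Ω, IsProbabilityMeasure Q ∧ ∀ n : ℕ, (n : ℕ∞) ∈ h.times →
      ∀ A, MeasurableSet[F n] A → Q A = ∫⁻ ω in A, (M n ω : ℝ≥0∞) ∂P := by
  let q : ℕ → Measure Ω := fun n => P.withDensity fun ω => (M n ω : ℝ≥0∞)
  have hqp : ∀ n, IsProbabilityMeasure (q n) := fun n => ⟨by
    rw [withDensity_apply _ MeasurableSet.univ, setLIntegral_univ, hM1]⟩
  have hqA : ∀ n A, MeasurableSet[F n] A → q n A = ∫⁻ ω in A, (M n ω : ℝ≥0∞) ∂P :=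
    fun n A hA => withDensity_apply _ (F.le n A hA)
  have hq : ∀ n A, MeasurableSet[F n] A → q (n + 1) A = q n A := fun n A hA => by
    rw [hqA n A hA, hqA (n + 1) A (F.mono n.le_succ A hA), hMs n A hA]
  have hqle : ∀ N n, N ≤ n → ∀ A, MeasurableSet[F N] A → q n A = q N A := by
    intro N n hn
    induction n, hn using Nat.le_induction with
    | base => simp
    | succ n hn ih => exact fun A hA => (hq n A (F.mono hn A hA)).trans (ih A hA)
  -- Only an infinite horizon needs the extension theorem. For a finite horizon the density at the
  -- last time already defines the measure.
  by_cases hinf : h.IsInfinite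
  · have hsup : ⨆ n, (F n : MeasurableSpace Ω) = mΩ := by
      refine le_antisymm (iSup_le F.le) ?_
      exact hFT.symm.le.trans (iSup_le fun s => sig_mono F le_top)
    obtain ⟨Q, hQ, hQq⟩ := (hstd hinf).exists_extension hsup q hq
    exact ⟨Q, hQ, fun n _ A hA => (hQq n A hA).trans (hqA n A hA)⟩
  · cases h with
    | finite T =>
      refine ⟨q T, hqp T, fun n hn A hA => ?_⟩
      have hnT : n ≤ T := by exact_mod_cast (show (n : ℕ∞) ≤ T from hn)
      rw [hqle n T hnT A hA, hqA n A hA]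
    | nat => exact absurd trivial hinf
    | natTop => exact absurd trivial hinf

end ProcessRisk

namespace ProcessRisk

/-! Models with prescribed optional densities -/

open scoped NNReal ENNReal

variable {h : Horizon} {Ω : Type*} {mΩ : MeasurableSpace Ω} {F : Filtration ℕ mΩ}
  {P Q : Measure Ω} {a : ℕ∞ → Ω → ℝ≥0}

/-- The sum `∑_{s ≥ n} a_s`. -/
noncomputable def tailSum (a : ℕ∞ → Ω → ℝ≥0) (n : ℕ) (ω : Ω) : ℝ≥0∞ :=
  ∑' k : ℕ, (a ((k + n : ℕ) : ℕ∞) ω : ℝ≥0∞) + a ⊤ ω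

/-- Adapted families `(a_s)_{s ∈ 𝕋}` of nonnegative random variables with `E_P[∑ a_s] = 1`. -/
structure IsOptionalDensity (h : Horizon) (F : Filtration ℕ mΩ) (P : Measure Ω)
    (a : ℕ∞ → Ω → ℝ≥0) : Prop where
  measurable : ∀ s, Measurable[sig F s] (a s)
  null : ∀ s ∉ h.times, ∀ ω, a s ω = 0
  total : ∫⁻ ω, tailSum a 0 ω ∂P = 1

theorem tailSum_eq_add (a : ℕ∞ → Ω → ℝ≥0) (n : ℕ) (ω : Ω) :
    tailSum a n ω = a n ω + tailSum a (n + 1) ω := by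
  unfold tailSum
  rw [tsum_eq_zero_add' ENNReal.summable, zero_add, add_assoc]
  congr 2
  exact tsum_congr fun k => by rw [add_right_comm, add_assoc]

theorem tailSum_antitone (a : ℕ∞ → Ω → ℝ≥0) (ω : Ω) : Antitone fun n => tailSum a n ω :=
  antitone_nat_of_succ_le fun n => (tailSum_eq_add a n ω).symm ▸ le_add_self

theorem tendsto_tailSum (a : ℕ∞ → Ω → ℝ≥0) {ω : Ω} (hω : tailSum a 0 ω ≠ ⊤) :
    Tendsto (fun n => tailSum a n ω) atTop (𝓝 (a ⊤ ω : ℝ≥0∞)) := by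
  have h1 := ENNReal.tendsto_sum_nat_add (fun k : ℕ => (a (k : ℕ∞) ω : ℝ≥0∞))
    (ne_top_of_le_ne_top hω le_self_add)
  simpa only [zero_add, tailSum] using h1.add_const (a ⊤ ω : ℝ≥0∞)

/-- The conditional expectation of the remaining sum. -/
noncomputable def remainder (F : Filtration ℕ mΩ) (P : Measure Ω) (a : ℕ∞ → Ω → ℝ≥0) (n : ℕ)
    (ω : Ω) : ℝ≥0 :=
  ((P⁻[tailSum a (n + 1)|F n]) ω).toNNReal

namespace IsOptionalDensity

theorem measurable' (ha : IsOptionalDensity h F P a) (s : ℕ∞) : Measurable (a s) :=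
  (ha.measurable s).mono (sig_le F s) le_rfl

theorem measurable_tailSum (ha : IsOptionalDensity h F P a) (n : ℕ) :
    Measurable (tailSum a n) :=
  (Measurable.tsum fun _ => (ha.measurable' _).coe_nnreal_ennreal).add
    (ha.measurable' _).coe_nnreal_ennreal

theorem lintegral_tailSum_ne_top (ha : IsOptionalDensity h F P a) (n : ℕ) :
    ∫⁻ ω, tailSum a n ω ∂P ≠ ⊤ :=
  ne_top_of_le_ne_top (ha.total.trans_ne ENNReal.one_ne_top)
    (lintegral_mono fun ω => tailSum_antitone a ω (Nat.zero_le n))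

theorem setLIntegral_remainder (ha : IsOptionalDensity h F P a) [IsFiniteMeasure P] (n : ℕ)
    {A : Set Ω} (hA : MeasurableSet[F n] A) :
    ∫⁻ ω in A, (remainder F P a n ω : ℝ≥0∞) ∂P = ∫⁻ ω in A, tailSum a (n + 1) ω ∂P := by
  rw [← setLIntegral_condLExp (F.le n) P (tailSum a (n + 1)) hA]
  refine lintegral_congr_ae (ae_restrict_of_ae ?_)
  -- The truncation to `ℝ≥0` loses nothing, because the conditional expectation is almost surely
  -- finite.
  filter_upwards [condLExp_ne_top (mΩ := F n) (ha.lintegral_tailSum_ne_top (n + 1))] with ω hω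
  exact ENNReal.coe_toNNReal hω

theorem setLIntegral_add_remainder (ha : IsOptionalDensity h F P a) [IsFiniteMeasure P] (n : ℕ)
    {A : Set Ω} (hA : MeasurableSet[F n] A) :
    ∫⁻ ω in A, ((a n ω + remainder F P a n ω : ℝ≥0) : ℝ≥0∞) ∂P =
      ∫⁻ ω in A, tailSum a n ω ∂P := by
  simp only [ENNReal.coe_add, tailSum_eq_add a n]
  rw [lintegral_add_left (ha.measurable' _).coe_nnreal_ennreal,
    lintegral_add_left (ha.measurable' _).coe_nnreal_ennreal, ha.setLIntegral_remainder n hA]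

/-- The tower property: `a_{n+1} + w_{n+1}` is the conditional expectation of the mass from `n + 1`
on, and `w_n` is the same with respect to `F n`. -/
theorem isPotentialPair (ha : IsOptionalDensity h F P a) [IsFiniteMeasure P] :
    IsPotentialPair F P (fun n => a n) (remainder F P a) where
  measurable_left n := ha.measurable n
  measurable_right n := (measurable_condLExp _ _ _).ennreal_toNNReal
  step n A hA := by
    rw [ha.setLIntegral_add_remainder (n + 1) (F.mono n.le_succ A hA),
      ha.setLIntegral_remainder n hA]
  total := by
    have h1 := ha.setLIntegral_add_remainder 0 (A := Set.univ) MeasurableSet.univ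
    rw [setLIntegral_univ, setLIntegral_univ, ha.total] at h1
    exact h1

end IsOptionalDensity

/-- The discounting process of the multiplicative decomposition, including its limit. -/
noncomputable def multDTop (a w : ℕ → Ω → ℝ≥0) : ℕ∞ → Ω → ℝ≥0
  | ⊤ => fun ω => ⨅ n, multD a w n ω
  | (n : ℕ) => multD a w n

theorem multDTop_antitone (a w : ℕ → Ω → ℝ≥0) (ω : Ω) : Antitone fun s => multDTop a w s ω := by
  intro r s hrs
  induction s using ENat.recTopCoe with
  | top =>
    induction r using ENat.recTopCoe with
    | top => exact le_rfl
    | coe m => exact ciInf_le (OrderBot.bddBelow _) m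
  | coe n =>
    induction r using ENat.recTopCoe with
    | top => exact absurd hrs (by simp)
    | coe m => exact multD_antitone a w ω (by exact_mod_cast hrs)

theorem tendsto_multD (a w : ℕ → Ω → ℝ≥0) (ω : Ω) :
    Tendsto (fun n => multD a w n ω) atTop (𝓝 (multDTop a w ⊤ ω)) :=
  tendsto_atTop_ciInf (multD_antitone a w ω) (OrderBot.bddBelow _)

theorem IsPotentialPair.measurable_multDTop {a w : ℕ → Ω → ℝ≥0} (hp : IsPotentialPair F P a w)
    (s : ℕ∞) : Measurable[predSig F s] (multDTop a w s) := by
  induction s using ENat.recTopCoe with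
  | top =>
    refine Measurable.iInf fun n => (hp.measurable_multD n).mono ?_ le_rfl
    exact le_iSup (fun n => (F n : MeasurableSpace Ω)) (n - 1)
  | coe n => exact hp.measurable_multD n

/-- The density process of a locally absolutely continuous measure does not explode `P`-almost
surely. -/
theorem measure_densityLimit_eq_top [IsProbabilityMeasure P] [IsProbabilityMeasure Q]
    (hac : ∀ n, Q.trim (F.le n) ≪ P.trim (F.le n)) :
    P {ω | densityLimit F P Q ω = ⊤} = 0 := by
  let m : ℕ → Ω → ENNReal := fun n => (Q.trim (F.le n)).rnDeriv (P.trim (F.le n))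
  have hm : ∀ n, Measurable[F n] (m n) := measurable_trim_rnDeriv F P Q
  let E : ℕ → ℕ → Set Ω := fun K n => {ω | (K : ℝ≥0∞) ≤ m n ω}
  have hE : ∀ K n, MeasurableSet[F n] (E K n) := fun K n =>
    measurableSet_le_of measurable_const (hm n)
  -- On the disjoint events that the density first reaches level `K` at time `n`, one has `K P ≤ Q`.
  -- Summation gives the maximal inequality with bound `1 / K`.
  have hEd : ∀ K n, MeasurableSet[F n] (disjointed (E K) n) := by
    intro K n
    rw [disjointed_eq_inter_compl]
    exact (hE K n).inter (MeasurableSet.biInter (Set.to_countable _) fun j hj =>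
      (F.mono (le_of_lt hj) _ (hE K j)).compl)
  have h1 : ∀ K n : ℕ, (K : ℝ≥0∞) * P (disjointed (E K) n) ≤ Q (disjointed (E K) n) := by
    intro K n
    rw [← setLIntegral_trim_rnDeriv (hac n) (hEd K n), ← setLIntegral_const]
    exact setLIntegral_mono' (F.le n _ (hEd K n)) fun ω hω => disjointed_subset (E K) n hω
  have h2 : ∀ K : ℕ, (K : ℝ≥0∞) * P (⋃ n, E K n) ≤ 1 := by
    intro K
    rw [← iUnion_disjointed, measure_iUnion (disjoint_disjointed _) fun n => F.le n _ (hEd K n),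
      ← ENNReal.tsum_mul_left]
    refine (ENNReal.tsum_le_tsum fun n => h1 K n).trans ?_
    rw [← measure_iUnion (disjoint_disjointed _) fun n => F.le n _ (hEd K n)]
    exact prob_le_one
  have hfin : ∀ᵐ ω ∂P, ∀ n, m n ω < ⊤ :=
    ae_all_iff.2 fun n => ae_of_ae_trim (F.le n) (Measure.rnDeriv_lt_top _ _)
  have h3 : P (⋂ K, ⋃ n, E K n) = 0 := by
    by_contra h0
    obtain ⟨K, hK⟩ := ENNReal.exists_nat_gt (ENNReal.inv_ne_top.2 h0)
    have h4 : (K : ℝ≥0∞) * P (⋂ K, ⋃ n, E K n) ≤ 1 :=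
      (mul_le_mul_right (measure_mono (Set.iInter_subset _ K)) _).trans (h2 K)
    have h5 := ENNReal.mul_lt_mul_left h0 (measure_ne_top P _) hK
    rw [ENNReal.inv_mul_cancel h0 (measure_ne_top _ _)] at h5
    exact (h5.trans_le h4).false
  refine measure_mono_null_ae ?_ h3
  filter_upwards [hfin] with ω hω hlim
  refine Set.mem_iInter.2 fun K => Set.mem_iUnion.2 ?_
  by_contra hK
  push Not at hK
  have h6 : densityLimit F P Q ω ≤ K := by
    refine limsup_le_of_le (by isBoundedDefault) (.of_forall fun n => ?_)
    exact (not_le.1 (hK n)).le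
  rw [show densityLimit F P Q ω = ⊤ from hlim] at h6
  exact absurd h6 (by simp)

theorem lintegral_eq_of_density {n : ℕ} {M : Ω → ℝ≥0} (hM : Measurable[F n] M)
    (hQ : ∀ A, MeasurableSet[F n] A → Q A = ∫⁻ ω in A, (M ω : ℝ≥0∞) ∂P)
    {g : Ω → ℝ≥0} (hg : Measurable[F n] g) {A : Set Ω} (hA : MeasurableSet[F n] A) :
    ∫⁻ ω in A, (g ω : ℝ≥0∞) ∂Q = ∫⁻ ω in A, ((M ω * g ω : ℝ≥0) : ℝ≥0∞) ∂P := by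
  have h1 : Q.trim (F.le n) = (P.withDensity fun ω => (M ω : ℝ≥0∞)).trim (F.le n) := by
    refine @Measure.ext _ (F n) _ _ fun B hB => ?_
    rw [trim_measurableSet_eq _ hB, trim_measurableSet_eq _ hB, hQ B hB,
      withDensity_apply _ (F.le n B hB)]
  have hg' : Measurable[F n] (A.indicator fun ω => (g ω : ℝ≥0∞)) :=
    hg.coe_nnreal_ennreal.indicator hA
  have h2 := congrArg (fun m => @lintegral _ (F n) m (A.indicator fun ω => (g ω : ℝ≥0∞))) h1
  simp only [lintegral_trim (F.le n) hg'] at h2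
  rw [lintegral_withDensity_eq_lintegral_mul _ (hM.mono (F.le n) le_rfl).coe_nnreal_ennreal
    (hg'.mono (F.le n) le_rfl), lintegral_indicator (F.le n A hA)] at h2
  rw [h2, ← lintegral_indicator (F.le n A hA)]
  refine lintegral_congr fun ω => ?_
  by_cases hω : ω ∈ A <;> simp [hω]

end ProcessRisk

/-! ### The measure and the discounting process of an optional density -/

namespace ProcessRisk

open scoped NNReal ENNReal

variable {h : Horizon} {Ω : Type*} {mΩ : MeasurableSpace Ω} {F : Filtration ℕ mΩ}
  {P Q : Measure Ω} {a : ℕ∞ → Ω → ℝ≥0}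

namespace IsOptionalDensity

/-- The martingale factor of an optional density. -/
noncomputable abbrev mart (F : Filtration ℕ mΩ) (P : Measure Ω) (a : ℕ∞ → Ω → ℝ≥0) :
    ℕ → Ω → ℝ≥0 :=
  multM (fun n => a n) (remainder F P a)

/-- The discounting factor of an optional density. -/
noncomputable abbrev disc (F : Filtration ℕ mΩ) (P : Measure Ω) (a : ℕ∞ → Ω → ℝ≥0) :
    ℕ∞ → Ω → ℝ≥0 :=
  multDTop (fun n => a n) (remainder F P a)

/-- `Q` has the densities given by the martingale factor. -/
def IsModel (h : Horizon) (F : Filtration ℕ mΩ) (P : Measure Ω) (a : ℕ∞ → Ω → ℝ≥0)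
    (Q : Measure Ω) : Prop :=
  ∀ n : ℕ, (n : ℕ∞) ∈ h.times →
    ∀ A, MeasurableSet[F n] A → Q A = ∫⁻ ω in A, (mart F P a n ω : ℝ≥0∞) ∂P

theorem IsModel.trim_ac (hQ : IsModel h F P a Q) {n : ℕ} (hn : (n : ℕ∞) ∈ h.times) :
    Q.trim (F.le n) ≪ P.trim (F.le n) := by
  refine Measure.AbsolutelyContinuous.mk fun A hA h0 => ?_
  rw [trim_measurableSet_eq _ hA] at h0 ⊢
  rw [hQ n hn A hA, Measure.restrict_eq_zero.2 h0, lintegral_zero_measure]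

/-- A change of measure with density `M_n`, because `M_n D_n` is the conditional expectation of the
mass from `n` on. -/
theorem setLIntegral_disc [IsFiniteMeasure P] (ha : IsOptionalDensity h F P a)
    (hQ : IsModel h F P a Q) {n : ℕ} (hn : (n : ℕ∞) ∈ h.times) {A : Set Ω}
    (hA : MeasurableSet[F n] A) :
    ∫⁻ ω in A, (disc F P a n ω : ℝ≥0∞) ∂Q = ∫⁻ ω in A, tailSum a n ω ∂P := by
  have hp := ha.isPotentialPair
  have hD : Measurable[F n] (disc F P a n) :=
    (hp.measurable_multD n).mono (F.mono (Nat.sub_le n 1)) le_rfl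
  rw [lintegral_eq_of_density (hp.measurable_multM n) (hQ n hn) hD hA,
    ← ha.setLIntegral_add_remainder n hA]
  refine lintegral_congr_ae (ae_restrict_of_ae ?_)
  filter_upwards [hp.ae_multM_mul_multD] with ω hω
  exact congrArg _ (hω n)

theorem setLIntegral_disc_sub [IsFiniteMeasure P] (ha : IsOptionalDensity h F P a)
    (hQ : IsModel h F P a Q) {n : ℕ} (hn : (n : ℕ∞) ∈ h.times) {A : Set Ω}
    (hA : MeasurableSet[F n] A) :
    ∫⁻ ω in A, ((disc F P a n ω - disc F P a (n + 1 : ℕ) ω : ℝ≥0) : ℝ≥0∞) ∂Q =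
      ∫⁻ ω in A, (a n ω : ℝ≥0∞) ∂P := by
  have hp := ha.isPotentialPair
  have h1 : Measurable[F n] fun ω => disc F P a n ω - disc F P a (n + 1 : ℕ) ω :=
    Measurable.sub ((hp.measurable_multD n).mono (F.mono (Nat.sub_le n 1)) le_rfl)
      (hp.measurable_multD (n + 1))
  rw [lintegral_eq_of_density (hp.measurable_multM n) (hQ n hn) h1 hA]
  refine lintegral_congr_ae (ae_restrict_of_ae ?_)
  filter_upwards [hp.ae_multM_mul_sub] with ω hω
  exact congrArg _ (hω n)

/-- `Q` has no density at infinity, so the identity is obtained as a limit. For an event in some `F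
n`, dominated convergence passes to the limit on both sides of `setLIntegral_disc`; a π-system
argument then covers `F_∞`. -/
theorem setLIntegral_disc_top [IsProbabilityMeasure P] [IsProbabilityMeasure Q]
    (ha : IsOptionalDensity h F P a) (hQ : IsModel h F P a Q)
    (hall : ∀ n : ℕ, (n : ℕ∞) ∈ h.times) {A : Set Ω} (hA : MeasurableSet[⨆ n, F n] A) :
    ∫⁻ ω in A, (disc F P a ⊤ ω : ℝ≥0∞) ∂Q = ∫⁻ ω in A, (a ⊤ ω : ℝ≥0∞) ∂P := by
  have hp := ha.isPotentialPair
  have hle : (⨆ n, F n : MeasurableSpace Ω) ≤ mΩ := iSup_le F.le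
  have hdm : ∀ s, Measurable (disc F P a s) := fun s =>
    (hp.measurable_multDTop s).mono ((predSig_le_sig F s).trans (sig_le F s)) le_rfl
  have halg : ∀ n A, MeasurableSet[F n] A →
      ∫⁻ ω in A, (disc F P a ⊤ ω : ℝ≥0∞) ∂Q = ∫⁻ ω in A, (a ⊤ ω : ℝ≥0∞) ∂P := by
    intro n A hA
    have h1 : Tendsto (fun k => ∫⁻ ω in A, (disc F P a (k : ℕ) ω : ℝ≥0∞) ∂Q) atTop
        (𝓝 (∫⁻ ω in A, (disc F P a ⊤ ω : ℝ≥0∞) ∂Q)) := by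
      refine tendsto_lintegral_of_dominated_convergence (fun _ => 1)
        (fun k => (hdm k).coe_nnreal_ennreal) (fun k => .of_forall fun ω => ?_) (by simp)
        (.of_forall fun ω => ?_)
      · exact ENNReal.coe_le_one_iff.2 (multD_le_one _ _ k ω)
      · exact (ENNReal.continuous_coe.tendsto _).comp (tendsto_multD _ _ ω)
    have h2 : Tendsto (fun k => ∫⁻ ω in A, tailSum a k ω ∂P) atTop
        (𝓝 (∫⁻ ω in A, (a ⊤ ω : ℝ≥0∞) ∂P)) := by
      have hfin : ∫⁻ ω in A, tailSum a 0 ω ∂P ≠ ⊤ :=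
        ne_top_of_le_ne_top (ha.lintegral_tailSum_ne_top 0) (setLIntegral_le_lintegral _ _)
      refine tendsto_lintegral_of_dominated_convergence (tailSum a 0)
        (fun k => ha.measurable_tailSum k) (fun k => .of_forall fun ω =>
          tailSum_antitone a ω (Nat.zero_le k)) hfin ?_
      filter_upwards [ae_lt_top (ha.measurable_tailSum 0) hfin] with ω hω
      exact tendsto_tailSum a hω.ne
    refine tendsto_nhds_unique h1 (h2.congr' ?_)
    filter_upwards [eventually_ge_atTop n] with k hk
    exact (ha.setLIntegral_disc hQ (hall k) (F.mono hk A hA)).symm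
  let ν₁ := (Q.withDensity fun ω => (disc F P a ⊤ ω : ℝ≥0∞)).trim hle
  let ν₂ := (P.withDensity fun ω => (a ⊤ ω : ℝ≥0∞)).trim hle
  have hν₁ : ∀ B, MeasurableSet[⨆ n, F n] B → ν₁ B = ∫⁻ ω in B, (disc F P a ⊤ ω : ℝ≥0∞) ∂Q :=
    fun B hB => by rw [trim_measurableSet_eq hle hB, withDensity_apply _ (hle B hB)]
  have hν₂ : ∀ B, MeasurableSet[⨆ n, F n] B → ν₂ B = ∫⁻ ω in B, (a ⊤ ω : ℝ≥0∞) ∂P :=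
    fun B hB => by rw [trim_measurableSet_eq hle hB, withDensity_apply _ (hle B hB)]
  have hfin : ν₁ Set.univ < ⊤ := by
    rw [hν₁ _ MeasurableSet.univ, setLIntegral_univ]
    refine (lintegral_mono (g := fun _ => 1) fun ω => ?_).trans_lt (by simp)
    exact ENNReal.coe_le_one_iff.2
      ((multDTop_antitone (fun n => a n) (remainder F P a) ω (le_top : (0 : ℕ∞) ≤ ⊤)).trans
        (multD_le_one (fun n => a n) (remainder F P a) 0 ω))
  have heq : ν₁ = ν₂ := @ext_of_generate_finite Ω (⨆ n, F n) _ _ {A | ∃ n, MeasurableSet[F n] A}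
    (generateFrom_filtration F) (isSetAlgebra_filtration F).isSetRing.isSetSemiring.isPiSystem
    ⟨hfin⟩ (by
      rintro B ⟨n, hB⟩
      have hB' := le_iSup (fun n => (F n : MeasurableSpace Ω)) n B hB
      rw [hν₁ B hB', hν₂ B hB', halg n B hB])
    (by rw [hν₁ _ MeasurableSet.univ, hν₂ _ MeasurableSet.univ, halg 0 _ MeasurableSet.univ])
  rw [← hν₁ A hA, ← hν₂ A hA, heq]

/-- The discounting process as a process on `𝕋`. -/
noncomputable def discProcess (h : Horizon) (F : Filtration ℕ mΩ) (P : Measure Ω)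
    (a : ℕ∞ → Ω → ℝ≥0) (s : h.Time) (ω : Ω) : ℝ :=
  disc F P a s ω

/-- With a last time `T` no mass remains after it, so `D_{T+1}` has the factor `w_T = 0`. For `𝕋 =
ℕ₀` the mass at infinity is zero, so `D_∞` has zero `Q`-integral. -/
theorem disc_ae_eq_zero [IsProbabilityMeasure P] [IsProbabilityMeasure Q]
    (ha : IsOptionalDensity h F P a) (hQ : IsModel h F P a Q) {s : ℕ∞} (hs : s ∉ h.times) :
    ∀ᵐ ω ∂Q, disc F P a s ω = 0 := by
  have hp := ha.isPotentialPair
  cases h with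
  | finite T =>
    have hT : ((T : ℕ) : ℕ∞) ∈ (Horizon.finite T).times := le_refl (T : ℕ∞)
    have hlt : ((T + 1 : ℕ) : ℕ∞) ≤ s := by
      have : (T : ℕ∞) < s := not_le.1 hs
      simpa using Order.add_one_le_of_lt this
    have h1 : ∀ ω, tailSum a (T + 1) ω = 0 := fun ω => by
      have hz : ∀ r : ℕ∞, (T : ℕ∞) < r → a r ω = 0 := fun r hr => ha.null r (not_le.2 hr) ω
      unfold tailSum
      rw [hz ⊤ (WithTop.coe_lt_top T), ENNReal.coe_zero, add_zero, ENNReal.tsum_eq_zero]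
      intro k
      rw [hz, ENNReal.coe_zero]
      exact_mod_cast Nat.lt_of_lt_of_le T.lt_succ_self (Nat.le_add_left _ k)
    have h2 : ∀ᵐ ω ∂P, remainder F P a T ω = 0 := by
      have h3 := ha.setLIntegral_remainder T (A := Set.univ) MeasurableSet.univ
      simp only [h1, lintegral_zero, setLIntegral_univ] at h3
      rw [lintegral_eq_zero_iff ((hp.measurable_right T).mono
        (F.le _) le_rfl).coe_nnreal_ennreal] at h3
      filter_upwards [h3] with ω hω
      simpa using hω
    have h4 : ∀ᵐ ω ∂Q, remainder F P a T ω = 0 :=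
      ae_of_trim_ac (F.le T) (hQ.trim_ac hT) (hp.measurableSet_eq_zero T) h2
    filter_upwards [h4] with ω hω
    refine le_antisymm ((multDTop_antitone _ _ ω hlt).trans ?_) bot_le
    simp [multDTop, multD, hω]
  | nat =>
    have hs' : s = ⊤ := not_not.1 hs
    subst hs'
    have h1 := ha.setLIntegral_disc_top hQ (fun n => ENat.natCast_ne_top n) (A := Set.univ)
      MeasurableSet.univ
    simp only [ha.null ⊤ hs, ENNReal.coe_zero, lintegral_zero, setLIntegral_univ] at h1
    rw [lintegral_eq_zero_iff ((hp.measurable_multDTop ⊤).mono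
      ((predSig_le_sig F ⊤).trans (sig_le F ⊤)) le_rfl).coe_nnreal_ennreal] at h1
    filter_upwards [h1] with ω hω
    simpa using hω
  | natTop => exact absurd trivial hs

theorem ae_extend_discProcess [IsProbabilityMeasure P] [IsProbabilityMeasure Q]
    (ha : IsOptionalDensity h F P a) (hQ : IsModel h F P a Q) :
    ∀ᵐ ω ∂Q, ∀ s : ℕ∞, extend (discProcess h F P a) s ω = disc F P a s ω := by
  refine ae_all_iff.2 fun s => ?_
  by_cases hs : s ∈ h.times
  · exact .of_forall fun ω => extend_of_mem _ hs ω
  · filter_upwards [ha.disc_ae_eq_zero hQ hs] with ω hω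
    rw [extend_of_notMem _ hs, hω, NNReal.coe_zero]

theorem isDiscounting [IsProbabilityMeasure P] [IsProbabilityMeasure Q]
    (ha : IsOptionalDensity h F P a) (hQ : IsModel h F P a Q) :
    IsDiscounting F P Q (discProcess h F P a) where
  predictable s := (ha.isPotentialPair.measurable_multDTop s).coe_nnreal_real
  nonneg := .of_forall fun ω s => NNReal.coe_nonneg _
  antitone := .of_forall fun ω r s hrs => by
    exact_mod_cast multDTop_antitone _ _ ω (show (r : ℕ∞) ≤ s from hrs)
  init := by
    filter_upwards [ha.ae_extend_discProcess hQ] with ω hω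
    rw [hω]
    exact NNReal.coe_one
  tendsto := by
    filter_upwards [ha.ae_extend_discProcess hQ] with ω hω
    simp only [hω]
    exact NNReal.tendsto_coe.2 (tendsto_multD _ _ ω)
  null_singular := by
    by_cases htop : (⊤ : ℕ∞) ∈ h.times
    · have hall : ∀ n : ℕ, (n : ℕ∞) ∈ h.times := by
        cases h with
        | finite T => exact absurd htop (not_le.2 (WithTop.coe_lt_top T))
        | nat => exact absurd rfl htop
        | natTop => exact fun n => trivial
      have hac : ∀ n, Q.trim (F.le n) ≪ P.trim (F.le n) := fun n => hQ.trim_ac (hall n)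
      have hm : MeasurableSet[⨆ n, F n] {ω | densityLimit F P Q ω = ⊤} := by
        have : Measurable[⨆ n, F n] (densityLimit F P Q) := Measurable.limsup fun n =>
          (measurable_trim_rnDeriv F P Q n).mono
            (le_iSup (fun n => (F n : MeasurableSpace Ω)) n) le_rfl
        exact this (measurableSet_singleton ⊤)
      -- `P` does not charge the explosion set, so the `Q`-integral of `D_∞` over it is an integral
      -- of `a ⊤` over a `P`-null set.
      have h1 := ha.setLIntegral_disc_top hQ hall hm
      rw [Measure.restrict_eq_zero.2 (measure_densityLimit_eq_top hac), lintegral_zero_measure,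
        lintegral_eq_zero_iff ((ha.isPotentialPair.measurable_multDTop ⊤).mono
          ((predSig_le_sig F ⊤).trans (sig_le F ⊤)) le_rfl).coe_nnreal_ennreal,
        Filter.EventuallyEq, ae_restrict_iff' (iSup_le F.le _ hm)] at h1
      filter_upwards [h1, ha.ae_extend_discProcess hQ] with ω h1 h2 hω
      have h3 := h1 hω
      simp only [Pi.zero_apply, ENNReal.coe_eq_zero] at h3
      rw [h2, NNReal.coe_eq_zero]
      exact h3
    · exact .of_forall fun ω _ => extend_of_notMem _ htop ω

theorem setLIntegral_ofDiscounting [IsProbabilityMeasure P] [IsProbabilityMeasure Q]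
    (ha : IsOptionalDensity h F P a) (hQ : IsModel h F P a Q) (s : h.Time) {A : Set Ω}
    (hA : MeasurableSet[sig F s] A) :
    ∫⁻ ω in A, ENNReal.ofReal (ofDiscounting (discProcess h F P a) s ω) ∂Q =
      ∫⁻ ω in A, (a s ω : ℝ≥0∞) ∂P := by
  obtain ⟨s, hs⟩ := s
  induction s using ENat.recTopCoe with
  | top =>
    have hall : ∀ n : ℕ, (n : ℕ∞) ∈ h.times := by
      cases h with
      | finite T => exact absurd hs (not_le.2 (WithTop.coe_lt_top T))
      | nat => exact absurd rfl hs
      | natTop => exact fun n => trivial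
    rw [← ha.setLIntegral_disc_top hQ hall hA]
    refine lintegral_congr_ae (ae_restrict_of_ae ?_)
    filter_upwards [ha.ae_extend_discProcess hQ] with ω hω
    rw [ofDiscounting_eq, decr_top, hω, ENNReal.ofReal_coe_nnreal]
  | coe n =>
    rw [← ha.setLIntegral_disc_sub hQ hs hA]
    refine lintegral_congr_ae (ae_restrict_of_ae ?_)
    filter_upwards [ha.ae_extend_discProcess hQ] with ω hω
    rw [ofDiscounting_eq, decr_coe, hω, hω, NNReal.sub_def, ENNReal.ofReal]

/-- If the total mass has conditional expectation one given `F_t`, then up to `t` the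
supermartingale is the deterministic one minus the mass already spent. It is thus predictable, its
martingale factor is one, and `D_t` is the unspent mass. -/
theorem agreeOn [IsProbabilityMeasure P] [IsProbabilityMeasure Q]
    (ha : IsOptionalDensity h F P a) (hQ : IsModel h F P a Q) {t : ℕ} (ht : (t : ℕ∞) ∈ h.times)
    (hone : ∀ A, MeasurableSet[F t] A → ∫⁻ ω in A, tailSum a 0 ω ∂P = P A) :
    AgreeOn (F t) Q P ∧
      ∀ᵐ ω ∂Q, extend (discProcess h F P a) t ω = 1 - ∑ j ∈ Finset.range t, (a j ω : ℝ) := by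
  have hp := ha.isPotentialPair
  have hsum : ∀ n ω, tailSum a 0 ω = ∑ j ∈ Finset.range n, (a j ω : ℝ≥0∞) + tailSum a n ω := by
    intro n ω
    induction n with
    | zero => simp
    | succ n ih => rw [Finset.sum_range_succ, add_assoc, ← tailSum_eq_add, ih]
  have hu : ∀ᵐ ω ∂P, ∀ n ≤ t,
      ∑ j ∈ Finset.range n, a j ω + (a n ω + remainder F P a n ω) = 1 := by
    refine ae_all_iff.2 fun n => ?_
    by_cases hn : n ≤ t
    swap
    · exact .of_forall fun ω hn' => absurd hn' hn
    have hSm : Measurable[F n] fun ω => ∑ j ∈ Finset.range n, a j ω := by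
      refine Finset.measurable_fun_sum _ fun j hj => ?_
      exact (ha.measurable j).mono (F.mono (Finset.mem_range.1 hj).le) le_rfl
    have hm : Measurable[F n] fun ω =>
        (((∑ j ∈ Finset.range n, a j ω + (a n ω + remainder F P a n ω) : ℝ≥0)) : ℝ≥0∞) :=
      (hSm.add (hp.measurable_sum n)).coe_nnreal_ennreal
    have h1 : (fun ω => (((∑ j ∈ Finset.range n, a j ω + (a n ω + remainder F P a n ω) : ℝ≥0)) :
        ℝ≥0∞)) =ᵐ[P.trim (F.le n)] fun _ => 1 := by
      refine ae_eq_of_forall_setLIntegral_eq_of_sigmaFinite hm measurable_const fun A hA _ => ?_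
      rw [setLIntegral_trim _ hm hA, setLIntegral_trim _ measurable_const hA]
      simp only [ENNReal.coe_add (∑ j ∈ Finset.range n, a j _)]
      rw [lintegral_add_left (hSm.mono (F.le n) le_rfl).coe_nnreal_ennreal,
        ha.setLIntegral_add_remainder n hA,
        ← lintegral_add_left (hSm.mono (F.le n) le_rfl).coe_nnreal_ennreal]
      simp only [ENNReal.ofNNReal_finsetSum, ← hsum n]
      rw [hone A (F.mono hn A hA), setLIntegral_const, one_mul]
    filter_upwards [ae_of_ae_trim _ h1] with ω hω _
    exact_mod_cast hω
  -- Comparing `hu` at `n` and `n + 1` gives `a_{n+1} + w_{n+1} = w_n`, so the martingale factor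
  -- does not move.
  have hM : ∀ᵐ ω ∂P, ∀ n ≤ t, mart F P a n ω = 1 := by
    filter_upwards [hu] with ω hω n
    induction n with
    | zero =>
      intro _
      simpa [multM] using hω 0 (Nat.zero_le t)
    | succ n ih =>
      intro hn
      have h1 := hω (n + 1) hn
      have h2 := hω n (Nat.le_of_succ_le hn)
      rw [Finset.sum_range_succ, add_assoc] at h1
      have h3 := add_left_cancel (add_left_cancel (h1.trans h2.symm))
      simp only [mart, multM] at ih ⊢
      split_ifs with hw
      · exact ih (Nat.le_of_succ_le hn)
      · rw [ih (Nat.le_of_succ_le hn), h3, div_self hw, one_mul]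
  refine ⟨fun A hA => ?_, ?_⟩
  · rw [hQ t ht A hA, ← one_mul (P A), ← setLIntegral_const]
    refine lintegral_congr_ae (ae_restrict_of_ae ?_)
    filter_upwards [hM] with ω hω
    rw [hω t le_rfl, ENNReal.coe_one]
  · have hD : ∀ᵐ ω ∂P, ∑ j ∈ Finset.range t, a j ω + disc F P a t ω = 1 := by
      filter_upwards [hM, hu, hp.ae_multM_mul_multD] with ω h1 h2 h3
      have h4 := h3 t
      rw [show multM (fun n => a n) (remainder F P a) t ω = 1 from h1 t le_rfl, one_mul] at h4
      rw [← h2 t le_rfl, ← h4]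
      rfl
    have hSm : Measurable[F t] fun ω => ∑ j ∈ Finset.range t, a j ω + disc F P a t ω := by
      refine Measurable.add (Finset.measurable_fun_sum _ fun j hj => ?_) ?_
      · exact (ha.measurable j).mono (F.mono (Finset.mem_range.1 hj).le) le_rfl
      · exact (hp.measurable_multD t).mono (F.mono (Nat.sub_le t 1)) le_rfl
    have hD' := ae_of_trim_ac (F.le t) (hQ.trim_ac ht) (hSm (measurableSet_singleton 1)) hD
    filter_upwards [hD', ha.ae_extend_discProcess hQ] with ω h1 h2
    have h3 : ((∑ j ∈ Finset.range t, a j ω + disc F P a t ω : ℝ≥0) : ℝ) = 1 := by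
      rw [show ∑ j ∈ Finset.range t, a j ω + disc F P a t ω = 1 from h1, NNReal.coe_one]
    rw [h2, eq_sub_iff_add_eq, ← h3]
    push_cast
    ring

/-- Every optional density comes from a locally absolutely continuous measure and a discounting
process. -/
theorem exists_model [IsProbabilityMeasure P] (ha : IsOptionalDensity h F P a)
    (hFT : ⨆ s : h.Time, sig F s = mΩ) (hstd : h.IsInfinite → IsStandardFiltration F) :
    ∃ (Q : Measure Ω) (D : h.Time → Ω → ℝ), IsLocAC h F P Q ∧ IsDiscounting F P Q D ∧
      (∀ (s : h.Time) (A : Set Ω), MeasurableSet[sig F s] A →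
        ∫⁻ ω in A, ENNReal.ofReal (ofDiscounting D s ω) ∂Q = ∫⁻ ω in A, (a s ω : ℝ≥0∞) ∂P) ∧
      ∀ t : ℕ, (t : ℕ∞) ∈ h.times →
        (∀ A, MeasurableSet[F t] A → ∫⁻ ω in A, tailSum a 0 ω ∂P = P A) →
        AgreeOn (F t) Q P ∧
          ∀ᵐ ω ∂Q, extend D t ω = 1 - ∑ j ∈ Finset.range t, (a j ω : ℝ) := by
  have hp := ha.isPotentialPair
  obtain ⟨Q, hQp, hQ⟩ := exists_measure_of_densities hFT hstd (M := mart F P a)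
    hp.lintegral_multM fun n A hA => hp.setLIntegral_multM_succ n hA
  have hQ' : IsModel h F P a Q := hQ
  exact ⟨Q, discProcess h F P a, ⟨hQp, fun n hn => hQ'.trim_ac hn⟩, ha.isDiscounting hQ',
    fun s A hA => ha.setLIntegral_ofDiscounting hQ' s hA, fun t ht hone => ha.agreeOn hQ' ht hone⟩

end IsOptionalDensity

end ProcessRisk

namespace ProcessRisk

/-! Elementary properties of bounded processes and risk measures -/

variable {h : Horizon} {Ω : Type*} {mΩ : MeasurableSpace Ω} {F : Filtration ℕ mΩ}
  {P : Measure Ω} {t : ℕ} {ρ : (h.Time → Ω → ℝ) → Ω → ℝ}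

theorem isLInfty_const (m : MeasurableSpace Ω) (P : @Measure Ω mΩ) (c : ℝ) :
    IsLInfty m P fun _ => c :=
  ⟨measurable_const, |c|, .of_forall fun _ => le_rfl⟩

theorem IsLInfty.neg {m : MeasurableSpace Ω} {P : @Measure Ω mΩ} {X : Ω → ℝ}
    (hX : IsLInfty m P X) : IsLInfty m P fun ω => -X ω := by
  obtain ⟨c, hc⟩ := hX.2
  exact ⟨hX.1.neg, c, by simpa only [abs_neg] using hc⟩

theorem IsLInfty.add {m : MeasurableSpace Ω} {P : @Measure Ω mΩ} {X Y : Ω → ℝ}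
    (hX : IsLInfty m P X) (hY : IsLInfty m P Y) : IsLInfty m P fun ω => X ω + Y ω := by
  obtain ⟨c, hc⟩ := hX.2
  obtain ⟨d, hd⟩ := hY.2
  refine ⟨hX.1.add hY.1, c + d, ?_⟩
  filter_upwards [hc, hd] with ω h1 h2 using (abs_add_le _ _).trans (add_le_add h1 h2)

theorem IsLInfty.integrable [IsFiniteMeasure P] {m : MeasurableSpace Ω} (hm : m ≤ mΩ) {X : Ω → ℝ}
    (hX : IsLInfty m P X) : Integrable X P := by
  obtain ⟨c, hc⟩ := hX.2
  exact Integrable.of_bound (hX.1.mono hm le_rfl).aestronglyMeasurable c hc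

theorem sig_coe_le_of_le {s : ℕ∞} {n : ℕ} (hs : (n : ℕ∞) ≤ s) : (F n : MeasurableSpace Ω) ≤ sig F s :=
  sig_mono F hs

namespace IsRInfty

variable {X Y : h.Time → Ω → ℝ}

theorem zero : IsRInfty F P t (fun (_ : h.Time) _ => 0) where
  adapted _ := measurable_const
  bounded := ⟨0, .of_forall fun _ _ => by simp⟩
  null_before _ _ := Filter.EventuallyEq.rfl

theorem exists_bound (hX : IsRInfty F P t X) :
    ∃ c : ℝ, 0 ≤ c ∧ ∀ s, ∀ᵐ ω ∂P, |X s ω| ≤ c := by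
  obtain ⟨c, hc⟩ := hX.bounded
  refine ⟨max c 0, le_max_right _ _, fun s => ?_⟩
  filter_upwards [hc] with ω hω using (hω s).trans (le_max_left _ _)

theorem of_bound (ha : IsAdapted F X) {c : ℝ} (hc : ∀ s, ∀ᵐ ω ∂P, |X s ω| ≤ c)
    (h0 : ∀ s : h.Time, (s : ℕ∞) < t → X s =ᵐ[P] 0) : IsRInfty F P t X :=
  ⟨ha, ⟨c, ae_all_iff.2 hc⟩, h0⟩

theorem add (hX : IsRInfty F P t X) (hY : IsRInfty F P t Y) :
    IsRInfty F P t fun s ω => X s ω + Y s ω := by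
  obtain ⟨c, -, hc⟩ := hX.exists_bound
  obtain ⟨d, -, hd⟩ := hY.exists_bound
  refine of_bound (fun s => (hX.adapted s).add (hY.adapted s)) (c := c + d) (fun s => ?_)
    fun s hs => ?_
  · filter_upwards [hc s, hd s] with ω h1 h2 using (abs_add_le _ _).trans (add_le_add h1 h2)
  · filter_upwards [hX.null_before s hs, hY.null_before s hs] with ω h1 h2
    simp [h1, h2]

/-- The values before `t` have to vanish identically: an `F_t`-measurable factor times a process
that is only null there need not be adapted. -/
theorem mul {m : Ω → ℝ} (hm : IsLInfty (F t) P m) (hX : IsRInfty F P t X)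
    (h0 : ∀ s : h.Time, (s : ℕ∞) < t → X s = 0) :
    IsRInfty F P t fun s ω => m ω * X s ω := by
  obtain ⟨c, -, hc⟩ := hX.exists_bound
  obtain ⟨d, hd⟩ := hm.2
  refine of_bound (fun s => ?_) (c := d * c) (fun s => ?_) fun s hs => ?_
  · by_cases hs : (t : ℕ∞) ≤ s
    · exact (hm.1.mono (sig_coe_le_of_le hs) le_rfl).mul (hX.adapted s)
    · simp only [h0 s (not_le.1 hs), Pi.zero_apply, mul_zero]
      exact measurable_const
  · filter_upwards [hc s, hd] with ω h1 h2
    rw [abs_mul]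
    exact mul_le_mul h2 h1 (abs_nonneg _) ((abs_nonneg _).trans h2)
  · simp only [h0 s hs, Pi.zero_apply, mul_zero]
    rfl

theorem payFrom {m : Ω → ℝ} (hm : IsLInfty (F t) P m) {s : ℕ∞} (hs : (t : ℕ∞) ≤ s) :
    IsRInfty F P t (payFrom (h := h) s m) := by
  obtain ⟨d, hd⟩ := hm.2
  refine of_bound (fun r => ?_) (c := max d 0) (fun r => ?_) fun r hr => ?_
  · by_cases hr : s ≤ r
    · rw [show ProcessRisk.payFrom (h := h) s m r = m from funext fun ω => if_pos hr]
      exact hm.1.mono (sig_coe_le_of_le (hs.trans hr)) le_rfl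
    · rw [show ProcessRisk.payFrom (h := h) s m r = fun _ => 0 from funext fun ω => if_neg hr]
      exact measurable_const
  · filter_upwards [hd] with ω h1
    unfold ProcessRisk.payFrom
    split_ifs
    · exact h1.trans (le_max_left _ _)
    · simp
  · refine .of_forall fun ω => ?_
    exact if_neg (not_le.2 (hr.trans_le hs))

theorem congr (hX : IsRInfty F P t X) (hY : IsAdapted F Y) (hXY : ∀ s, X s =ᵐ[P] Y s) :
    IsRInfty F P t Y := by
  obtain ⟨c, -, hc⟩ := hX.exists_bound
  refine of_bound hY (c := c) (fun s => ?_) fun s hs => (hXY s).symm.trans (hX.null_before s hs)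
  filter_upwards [hc s, hXY s] with ω h1 h2 using h2 ▸ h1

/-- Every element of `𝓡^∞_t` has a bounded version that vanishes before `t`. -/
theorem exists_version (hX : IsRInfty F P t X) : ∃ Y, IsRInfty F P t Y ∧ (∀ s, X s =ᵐ[P] Y s) ∧
    (∃ c : ℝ, ∀ s ω, |Y s ω| ≤ c) ∧ ∀ s : h.Time, (s : ℕ∞) < t → Y s = 0 := by
  obtain ⟨c, hc0, hc⟩ := hX.exists_bound
  let Y : h.Time → Ω → ℝ := fun s ω => if (t : ℕ∞) ≤ s then max (-c) (min c (X s ω)) else 0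
  have hXY : ∀ s, X s =ᵐ[P] Y s := fun s => by
    by_cases hs : (t : ℕ∞) ≤ s
    · filter_upwards [hc s] with ω hω
      have h1 := abs_le.1 hω
      simp only [Y, if_pos hs, min_eq_right h1.2, max_eq_right h1.1]
    · filter_upwards [hX.null_before s (not_le.1 hs)] with ω hω
      simp only [Y, if_neg hs, hω, Pi.zero_apply]
  have hYa : IsAdapted F Y := fun s => by
    by_cases hs : (t : ℕ∞) ≤ s
    · simp only [Y, if_pos hs]
      exact measurable_const.max (measurable_const.min (hX.adapted s))
    · simp only [Y, if_neg hs]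
      exact measurable_const
  refine ⟨Y, hX.congr hYa hXY, hXY, ⟨c, fun s ω => ?_⟩, fun s hs => ?_⟩
  · by_cases hs : (t : ℕ∞) ≤ s
    · simp only [Y, if_pos hs]
      exact abs_le.2 ⟨le_max_left _ _, max_le (by linarith) (min_le_left _ _)⟩
    · simpa only [Y, if_neg hs, abs_zero] using hc0
  · funext ω
    simp only [Y, if_neg (not_le.2 hs), Pi.zero_apply]

theorem convex_comb {l : Ω → ℝ} (hl : Measurable[F t] l) (hl01 : ∀ᵐ ω ∂P, 0 ≤ l ω ∧ l ω ≤ 1)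
    (hX : IsRInfty F P t X) (hY : IsRInfty F P t Y)
    (hX0 : ∀ s : h.Time, (s : ℕ∞) < t → X s = 0) (hY0 : ∀ s : h.Time, (s : ℕ∞) < t → Y s = 0) :
    IsRInfty F P t fun s ω => l ω * X s ω + (1 - l ω) * Y s ω := by
  have h1 : IsLInfty (F t) P l := ⟨hl, 1, by
    filter_upwards [hl01] with ω hω using abs_le.2 ⟨by linarith, hω.2⟩⟩
  exact (hX.mul h1 hX0).add (hY.mul ((isLInfty_const _ _ 1).add h1.neg) hY0)

end IsRInfty

namespace IsProcessRiskMeasure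

variable {X Y : h.Time → Ω → ℝ}

theorem congr (hρ : IsProcessRiskMeasure F P t ρ) (hX : IsRInfty F P t X) (hY : IsRInfty F P t Y)
    (hXY : ∀ s, X s =ᵐ[P] Y s) : ρ X =ᵐ[P] ρ Y :=
  (hρ.monotone Y X hY hX fun s => (hXY s).symm.le).antisymm
    (hρ.monotone X Y hX hY fun s => (hXY s).le)

theorem payFrom_eq (hρ : IsProcessRiskMeasure F P t ρ) {m : Ω → ℝ} (hm : IsLInfty (F t) P m) :
    ρ (payFrom (h := h) t m) =ᵐ[P] fun ω => -m ω := by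
  have h1 := hρ.cash_invariant _ IsRInfty.zero m hm
  simp only [zero_add] at h1
  filter_upwards [h1, hρ.normalized] with ω h1 h2
  rw [show payFrom (h := h) t m = fun s ω => payFrom t m s ω from rfl, h1, h2]
  simp

theorem abs_le (hρ : IsProcessRiskMeasure F P t ρ) (hX : IsRInfty F P t X) {c : ℝ}
    (hc : ∀ s, ∀ᵐ ω ∂P, |X s ω| ≤ c) : ∀ᵐ ω ∂P, |ρ X ω| ≤ c := by
  have key : ∀ s : h.Time, ∀ᵐ ω ∂P, payFrom t (fun _ => -c) s ω ≤ X s ω ∧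
      X s ω ≤ payFrom t (fun _ => c) s ω := by
    intro s
    by_cases hs : (t : ℕ∞) ≤ s
    · filter_upwards [hc s] with ω hω
      simp only [payFrom, if_pos hs]
      exact _root_.abs_le.1 hω
    · filter_upwards [hX.null_before s (not_le.1 hs)] with ω hω
      simp only [payFrom, if_neg hs, hω, Pi.zero_apply, le_refl, and_self]
  have hm := isLInfty_const (F t) P
  have h1 := hρ.monotone _ X (IsRInfty.payFrom (hm (-c)) le_rfl) hX
    fun s => (key s).mono fun ω hω => hω.1
  have h2 := hρ.monotone X _ hX (IsRInfty.payFrom (hm c) le_rfl)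
    fun s => (key s).mono fun ω hω => hω.2
  filter_upwards [h1, h2, hρ.payFrom_eq (hm (-c)), hρ.payFrom_eq (hm c)] with ω h1 h2 h3 h4
  rw [h3, neg_neg] at h1
  rw [h4] at h2
  exact _root_.abs_le.2 ⟨h2, h1⟩

theorem integrable [IsFiniteMeasure P] (hρ : IsProcessRiskMeasure F P t ρ)
    (hX : IsRInfty F P t X) : Integrable (ρ X) P :=
  (hρ.mem X hX).integrable (F.le t)

end IsProcessRiskMeasure

/-- The acceptance set. -/
structure IsAccepted (F : Filtration ℕ mΩ) (P : Measure Ω) (t : ℕ)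
    (ρ : (h.Time → Ω → ℝ) → Ω → ℝ) (X : h.Time → Ω → ℝ) : Prop where
  isRInfty : IsRInfty F P t X
  nonpos : ρ X ≤ᵐ[P] 0

namespace IsAccepted

variable {X Y : h.Time → Ω → ℝ}

theorem zero (hρ : IsProcessRiskMeasure F P t ρ) : IsAccepted F P t ρ fun (_ : h.Time) _ => 0 :=
  ⟨IsRInfty.zero, hρ.normalized.le⟩

theorem add_risk (hρ : IsProcessRiskMeasure F P t ρ) (hX : IsRInfty F P t X) :
    IsAccepted F P t ρ fun s ω => X s ω + payFrom t (ρ X) s ω := by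
  refine ⟨hX.add (IsRInfty.payFrom (hρ.mem X hX) le_rfl), ?_⟩
  filter_upwards [hρ.cash_invariant X hX _ (hρ.mem X hX)] with ω hω
  rw [hω, sub_self]
  rfl

theorem congr (hρ : IsProcessRiskMeasure F P t ρ) (hX : IsAccepted F P t ρ X)
    (hY : IsAdapted F Y) (hXY : ∀ s, X s =ᵐ[P] Y s) : IsAccepted F P t ρ Y := by
  have h1 := hX.isRInfty.congr hY hXY
  exact ⟨h1, (hρ.congr hX.isRInfty h1 hXY).symm.le.trans hX.nonpos⟩

theorem convex_comb (hρ : IsProcessRiskMeasure F P t ρ) {l : Ω → ℝ} (hl : Measurable[F t] l)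
    (hl01 : ∀ᵐ ω ∂P, 0 ≤ l ω ∧ l ω ≤ 1) (hX : IsAccepted F P t ρ X) (hY : IsAccepted F P t ρ Y)
    (hX0 : ∀ s : h.Time, (s : ℕ∞) < t → X s = 0) (hY0 : ∀ s : h.Time, (s : ℕ∞) < t → Y s = 0) :
    IsAccepted F P t ρ fun s ω => l ω * X s ω + (1 - l ω) * Y s ω := by
  refine ⟨IsRInfty.convex_comb hl hl01 hX.isRInfty hY.isRInfty hX0 hY0, ?_⟩
  filter_upwards [hρ.convex X Y hX.isRInfty hY.isRInfty l hl hl01, hX.nonpos, hY.nonpos, hl01]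
    with ω h1 h2 h3 h4
  have h5 : l ω * ρ X ω ≤ 0 := mul_nonpos_of_nonneg_of_nonpos h4.1 h2
  have h6 : (1 - l ω) * ρ Y ω ≤ 0 := mul_nonpos_of_nonneg_of_nonpos (by linarith) h3
  exact h1.trans (add_nonpos h5 h6)

end IsAccepted

end ProcessRisk

namespace ProcessRisk

/-! Essential suprema and penalty functions -/

variable {h : Horizon} {Ω : Type*} {mΩ : MeasurableSpace Ω} {F : Filtration ℕ mΩ}
  {P Q : Measure Ω} {t : ℕ} {ρ : (h.Time → Ω → ℝ) → Ω → ℝ}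

/-- The essential supremum of a nonempty family is the supremum of a sequence in the family. -/
theorem exists_seq_isEssSup {m : MeasurableSpace Ω} (hm : m ≤ mΩ) (μ : @Measure Ω mΩ)
    [IsFiniteMeasure μ] {S : Set (Ω → EReal)} (hS : ∀ f ∈ S, Measurable[m] f) (hne : S.Nonempty) :
    ∃ w : ℕ → Ω → EReal, (∀ k, w k ∈ S) ∧ IsEssSup m μ S fun ω => ⨆ k, w k ω := by
  obtain ⟨f₀, hf₀⟩ := hne
  -- A bounded strictly increasing transform makes all integrals finite. A countable subfamily whose
  -- supremum attains the largest transformed integral cannot be enlarged by any further member, so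
  -- it dominates the family almost surely.
  let g : EReal → ENNReal := fun x => (ENNReal.orderIsoIicOneBirational (EReal.expOrderIso x)).1
  have hg : StrictMono g := fun a b hab =>
    ENNReal.orderIsoIicOneBirational.strictMono (EReal.expOrderIso.strictMono hab)
  have hg1 : ∀ x, g x ≤ 1 := fun x => (ENNReal.orderIsoIicOneBirational (EReal.expOrderIso x)).2
  have hgm : Measurable g := hg.monotone.measurable
  have hfin : ∀ Z : Ω → EReal, ∫⁻ ω, g (Z ω) ∂μ ≠ ⊤ := fun Z => by
    refine ((lintegral_mono (μ := μ) (g := fun _ => 1) fun ω => hg1 (Z ω)).trans_lt ?_).ne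
    simp
  let I : Set ENNReal := {c | ∃ u : ℕ → Ω → EReal, (∀ n, u n ∈ S) ∧
    c = ∫⁻ ω, g (⨆ n, u n ω) ∂μ}
  have hI : I.Nonempty := ⟨_, fun _ => f₀, fun _ => hf₀, rfl⟩
  obtain ⟨c, -, hc, hcI⟩ := exists_seq_tendsto_sSup hI (OrderTop.bddAbove I)
  choose u hu hcu using hcI
  let w : ℕ → Ω → EReal := fun k => u k.unpair.1 k.unpair.2
  have hw : ∀ k, w k ∈ S := fun k => hu _ _
  let Z : Ω → EReal := fun ω => ⨆ k, w k ω
  have hZm : Measurable[m] Z := Measurable.iSup fun k => hS _ (hw k)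
  have hZ : sSup I ≤ ∫⁻ ω, g (Z ω) ∂μ := by
    refine le_of_tendsto' hc fun n => ?_
    rw [hcu n]
    refine lintegral_mono fun ω => hg.monotone (iSup_le fun j => ?_)
    have := le_iSup (fun k => w k ω) (Nat.pair n j)
    simpa [w] using this
  refine ⟨w, hw, hZm, fun f hf => ?_, fun Z' _ hZ' => ?_⟩
  · let w' : ℕ → Ω → EReal := fun k => Nat.casesOn k f w
    have hw' : ∀ k, w' k ∈ S := fun k => by cases k with
      | zero => exact hf
      | succ k => exact hw k
    have hle : ∀ ω, Z ω ≤ ⨆ k, w' k ω := fun ω =>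
      iSup_le fun k => le_iSup (fun k => w' k ω) (k + 1)
    have hmem : ∫⁻ ω, g (⨆ k, w' k ω) ∂μ ≤ sSup I := le_sSup ⟨w', hw', rfl⟩
    have hm' : Measurable[mΩ] fun ω => ⨆ k, w' k ω :=
      Measurable.mono (Measurable.iSup fun k => hS _ (hw' k)) hm le_rfl
    have := ae_eq_of_ae_le_of_lintegral_le (μ := μ)
      (.of_forall fun ω => hg.monotone (hle ω)) (hfin Z)
      (@Measurable.comp _ _ _ mΩ _ _ g _ hgm hm').aemeasurable (hmem.trans hZ)
    filter_upwards [this] with ω hω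
    have h2 := hg.injective hω
    change f ω ≤ Z ω
    rw [h2]
    exact le_iSup (fun k => w' k ω) 0
  · filter_upwards [ae_all_iff.2 fun k => hZ' _ (hw k)] with ω hω
    exact iSup_le hω

theorem isEssSup_essSupOf {m : MeasurableSpace Ω} (hm : m ≤ mΩ) (μ : @Measure Ω mΩ)
    [IsFiniteMeasure μ] (S : Set (Ω → EReal)) (hS : ∀ f ∈ S, Measurable[m] f) :
    IsEssSup m μ S (essSupOf m μ S) := by
  have H := exists_isEssSup hm μ S hS
  rw [essSupOf, dif_pos H]
  exact H.choose_spec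

theorem IsEssSup.ae_eq {m : MeasurableSpace Ω} {μ : @Measure Ω mΩ} {S : Set (Ω → EReal)}
    {Z Z' : Ω → EReal} (h1 : IsEssSup m μ S Z) (h2 : IsEssSup m μ S Z') : Z =ᵐ[μ] Z' :=
  (h1.2.2 Z' h2.1 h2.2.1).antisymm (h2.2.2 Z h1.1 h1.2.1)

theorem AgreeOn.ae_of {m : MeasurableSpace Ω} (hA : AgreeOn m Q P) {p : Ω → Prop}
    (hp : MeasurableSet[m] {ω | p ω}) (hP : ∀ᵐ ω ∂P, p ω) : ∀ᵐ ω ∂Q, p ω := by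
  rw [ae_iff] at hP ⊢
  rw [← hP]
  exact hA _ hp.compl

theorem AgreeOn.symm {m : MeasurableSpace Ω} (hA : AgreeOn m Q P) : AgreeOn m P Q :=
  fun A h => (hA A h).symm

theorem AgreeOn.integral_eq {m : MeasurableSpace Ω} (hA : AgreeOn m Q P) (hm : m ≤ mΩ)
    {f : Ω → ℝ} (hf : Measurable[m] f) : ∫ ω, f ω ∂Q = ∫ ω, f ω ∂P := by
  have h1 : Q.trim hm = P.trim hm := @Measure.ext _ m _ _ fun A h => by
    rw [trim_measurableSet_eq hm h, trim_measurableSet_eq hm h, hA A h]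
  rw [integral_trim hm hf.stronglyMeasurable, integral_trim hm hf.stronglyMeasurable, h1]

namespace IsWeight

variable {w w' X Y : h.Time → Ω → ℝ} {c : ℝ}

theorem pair_congr (hw : IsWeight F P Q w) (hX : IsAdapted F X) (hY : IsAdapted F Y)
    (hXY : ∀ s, X s =ᵐ[P] Y s) : pair w X =ᵐ[Q] pair w Y := by
  have h1 := hw.ae_imp (p := fun s ω => X s ω - Y s ω = 0) (fun s => by
    have hm : Measurable[sig F s] fun ω => X s ω - Y s ω := (hX s).sub (hY s)
    exact hm (measurableSet_singleton 0)) fun s => by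
      filter_upwards [hXY s] with ω hω
      rw [hω, sub_self]
  filter_upwards [h1] with ω hω
  refine tsum_congr fun s => ?_
  by_cases h0 : w s ω = 0
  · rw [h0, zero_mul, zero_mul]
  · rw [sub_eq_zero.1 (hω s h0)]

theorem ae_summable_of_isRInfty (hw : IsWeight F P Q w) (hX : IsRInfty F P t X) :
    ∀ᵐ ω ∂Q, Summable (fun s => w s ω * X s ω) := by
  obtain ⟨c, -, hc⟩ := hX.exists_bound
  exact hw.ae_summable hX.adapted hc

theorem integrable_pair_of_isRInfty [IsFiniteMeasure Q] (hw : IsWeight F P Q w)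
    (hX : IsRInfty F P t X) : Integrable (pair w X) Q := by
  obtain ⟨c, hc0, hc⟩ := hX.exists_bound
  exact hw.integrable_pair hX.adapted hc0 hc

theorem pair_add_payFrom (hw : IsWeight F P Q w) (hX : IsRInfty F P t X) {k : ℕ∞} {m : Ω → ℝ}
    {a : Ω → ℝ} (hk : ∀ᵐ ω ∂Q, HasSum (fun s : h.Time => if k ≤ s then w s ω else 0) (a ω)) :
    pair w (fun s ω => X s ω + payFrom k m s ω) =ᵐ[Q] fun ω => pair w X ω + a ω * m ω := by
  filter_upwards [hw.ae_summable_of_isRInfty hX, hk] with ω h1 h2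
  have h3 := h1.hasSum.add (h2.mul_right (m ω))
  refine HasSum.tsum_eq (h3.congr_fun fun s => ?_)
  unfold payFrom
  by_cases hs : k ≤ s
  · simp only [if_pos hs, mul_add]
  · simp only [if_neg hs, add_zero, zero_mul]

end IsWeight

/-- The conditional expectation `E_Q[-∑_s w_s X_s | F_t]`. -/
noncomputable def condLoss (F : Filtration ℕ mΩ) (t : ℕ) (Q : Measure Ω) (w X : h.Time → Ω → ℝ) :
    Ω → ℝ :=
  Q[fun ω => -pair w X ω | F t]

theorem measurable_condLoss (w X : h.Time → Ω → ℝ) : Measurable[F t] (condLoss F t Q w X) :=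
  stronglyMeasurable_condExp.measurable

theorem integral_condLoss [IsFiniteMeasure Q] (w X : h.Time → Ω → ℝ) :
    ∫ ω, condLoss F t Q w X ω ∂Q = -∫ ω, pair w X ω ∂Q := by
  rw [condLoss, integral_condExp (F.le t), integral_neg]

theorem integrable_condLoss (w X : h.Time → Ω → ℝ) : Integrable (condLoss F t Q w X) Q :=
  integrable_condExp

/-- The conditional expectations in the definition of the penalty function. -/
def penaltySet (F : Filtration ℕ mΩ) (P : Measure Ω) (t : ℕ) (ρ : (h.Time → Ω → ℝ) → Ω → ℝ)
    (Q : Measure Ω) (w : h.Time → Ω → ℝ) : Set (Ω → EReal) :=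
  {f | ∃ X, IsAccepted F P t ρ X ∧ f = fun ω => (condLoss F t Q w X ω : EReal)}

theorem measurable_of_mem_penaltySet {w : h.Time → Ω → ℝ} {f : Ω → EReal}
    (hf : f ∈ penaltySet F P t ρ Q w) : Measurable[F t] f := by
  obtain ⟨X, -, rfl⟩ := hf
  exact (measurable_condLoss w X).coe_real_ereal

theorem isEssSup_penalty [IsFiniteMeasure Q] (γ : h.Time → Ω → ℝ) :
    IsEssSup (F t) Q (penaltySet F P t ρ Q (condWeight γ t)) (penalty F P t ρ Q γ) := by
  have h1 : penalty F P t ρ Q γ = essSupOf (F t) Q (penaltySet F P t ρ Q (condWeight γ t)) := by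
    unfold penalty penaltySet condLoss pair condWeight
    congr 1
    ext f
    simp only [ite_mul, zero_mul]
    exact ⟨fun ⟨X, h1, h2, h3⟩ => ⟨X, ⟨h1, h2⟩, h3⟩, fun ⟨X, h1, h3⟩ => ⟨X, h1.1, h1.2, h3⟩⟩
  rw [h1]
  exact isEssSup_essSupOf (F.le t) Q _ fun f hf => measurable_of_mem_penaltySet hf

/-- Accepted positions can be pasted along events in `F_t`. -/
theorem exists_accepted_paste [IsFiniteMeasure Q] (hρ : IsProcessRiskMeasure F P t ρ)
    {w Y₁ Y₂ : h.Time → Ω → ℝ} (hw : IsWeight F P Q w)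
    (h1 : IsAccepted F P t ρ Y₁) (h2 : IsAccepted F P t ρ Y₂) :
    ∃ W, IsAccepted F P t ρ W ∧ ∀ᵐ ω ∂Q, condLoss F t Q w Y₁ ω ≤ condLoss F t Q w W ω ∧
      condLoss F t Q w Y₂ ω ≤ condLoss F t Q w W ω := by
  -- Versions that vanish identically before `t` remain adapted after multiplication by an indicator
  -- from `F_t`.
  obtain ⟨V₁, hV₁, hYV₁, -, hV₁0⟩ := h1.isRInfty.exists_version
  obtain ⟨V₂, hV₂, hYV₂, -, hV₂0⟩ := h2.isRInfty.exists_version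
  have hp1 := hw.pair_congr h1.isRInfty.adapted hV₁.adapted hYV₁
  have hp2 := hw.pair_congr h2.isRInfty.adapted hV₂.adapted hYV₂
  have hc1 : condLoss F t Q w Y₁ =ᵐ[Q] condLoss F t Q w V₁ := condExp_congr_ae hp1.neg
  have hc2 : condLoss F t Q w Y₂ =ᵐ[Q] condLoss F t Q w V₂ := condExp_congr_ae hp2.neg
  have hB : MeasurableSet[F t] {ω | condLoss F t Q w Y₂ ω ≤ condLoss F t Q w Y₁ ω} :=
    measurableSet_le_of (measurable_condLoss w Y₂) (measurable_condLoss w Y₁)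
  obtain ⟨B, hBdef⟩ : ∃ B, B = {ω | condLoss F t Q w Y₂ ω ≤ condLoss F t Q w Y₁ ω} := ⟨_, rfl⟩
  rw [← hBdef] at hB
  have hl : Measurable[F t] (B.indicator fun _ => (1 : ℝ)) := measurable_const.indicator hB
  have hl01 : ∀ ω, 0 ≤ B.indicator (fun _ => (1 : ℝ)) ω ∧ B.indicator (fun _ => (1 : ℝ)) ω ≤ 1 :=
    fun ω => by by_cases hω : ω ∈ B <;> simp [hω]
  have hW := IsAccepted.convex_comb hρ hl (.of_forall hl01)
    (h1.congr hρ hV₁.adapted hYV₁) (h2.congr hρ hV₂.adapted hYV₂) hV₁0 hV₂0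
  refine ⟨_, hW, ?_⟩
  have hi1 : Integrable (fun ω => -pair w V₁ ω) Q := (hw.integrable_pair_of_isRInfty hV₁).neg
  have hi2 : Integrable (fun ω => -pair w V₂ ω) Q := (hw.integrable_pair_of_isRInfty hV₂).neg
  have hpair : (fun ω => -pair w (fun s ω => B.indicator (fun _ => (1 : ℝ)) ω * V₁ s ω +
      (1 - B.indicator (fun _ => (1 : ℝ)) ω) * V₂ s ω) ω) =
      B.indicator (fun ω => -pair w V₁ ω) + Bᶜ.indicator (fun ω => -pair w V₂ ω) := by
    funext ω
    by_cases hω : ω ∈ B <;> simp [pair, hω]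
  have hBm := F.le t B hB
  have hcond := (condExp_add (hi1.indicator hBm) (hi2.indicator hBm.compl) (F t)).trans
    ((condExp_indicator hi1 hB).add (condExp_indicator hi2 hB.compl))
  rw [← hpair] at hcond
  filter_upwards [hcond, hc1, hc2] with ω h3 h4 h5
  have h6 : condLoss F t Q w (fun s ω => B.indicator (fun _ => (1 : ℝ)) ω * V₁ s ω +
      (1 - B.indicator (fun _ => (1 : ℝ)) ω) * V₂ s ω) ω =
      B.indicator (condLoss F t Q w V₁) ω + Bᶜ.indicator (condLoss F t Q w V₂) ω := h3
  rw [h6]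
  by_cases hω : ω ∈ B
  · have : condLoss F t Q w Y₂ ω ≤ condLoss F t Q w Y₁ ω := by rw [hBdef] at hω; exact hω
    simp [hω, ← h4, this]
  · have : ¬ condLoss F t Q w Y₂ ω ≤ condLoss F t Q w Y₁ ω := by rw [hBdef] at hω; exact hω
    simp [hω, ← h5, (not_le.1 this).le]

/-- A bound on all expected losses of accepted positions is a bound on the expected penalty. -/
theorem integral_le_of_le_penalty [IsFiniteMeasure Q] (hρ : IsProcessRiskMeasure F P t ρ)
    {γ : h.Time → Ω → ℝ} (hw : IsWeight F P Q (condWeight γ t)) {b : ℝ}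
    (hb : ∀ Y, IsAccepted F P t ρ Y → -∫ ω, pair (condWeight γ t) Y ω ∂Q ≤ b)
    {u : Ω → ℝ} (hu : Integrable u Q) (hule : ∀ᵐ ω ∂Q, (u ω : EReal) ≤ penalty F P t ρ Q γ ω) :
    ∫ ω, u ω ∂Q ≤ b := by
  set w := condWeight γ t with hwdef
  obtain ⟨v, hv, hvs⟩ := exists_seq_isEssSup (F.le t) Q (S := penaltySet F P t ρ Q w)
    (fun f hf => measurable_of_mem_penaltySet hf) ⟨_, _, IsAccepted.zero hρ, rfl⟩
  have hpen := (isEssSup_penalty (F := F) (P := P) (t := t) (ρ := ρ) (Q := Q) γ).ae_eq hvs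
  choose Y hY hvY using hv
  -- Repeated pasting yields a single accepted position whose conditional loss dominates the first
  -- `n + 1` losses of the sequence.
  have hW : ∀ n, ∃ W, IsAccepted F P t ρ W ∧
      ∀ᵐ ω ∂Q, ∀ k ≤ n, condLoss F t Q w (Y k) ω ≤ condLoss F t Q w W ω := by
    intro n
    induction n with
    | zero =>
      refine ⟨Y 0, hY 0, .of_forall fun ω k hk => ?_⟩
      rw [Nat.le_zero.1 hk]
    | succ n ih =>
      obtain ⟨W, hW, hWle⟩ := ih
      obtain ⟨W', hW', hW'le⟩ := exists_accepted_paste hρ hw hW (hY (n + 1))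
      refine ⟨W', hW', ?_⟩
      filter_upwards [hWle, hW'le] with ω h1 h2 k hk
      rcases Nat.le_succ_iff.1 hk with hk | rfl
      · exact (h1 k hk).trans h2.1
      · exact h2.2
  choose W hWa hWle using hW
  -- The truncated losses lie between the minimum of the loss of `Y 0` and `u`, and `u` itself. As
  -- `u` is below the supremum of the losses, they converge to `u`.
  have hlim : Tendsto (fun n => ∫ ω, min (condLoss F t Q w (W n) ω) (u ω) ∂Q) atTop
      (𝓝 (∫ ω, u ω ∂Q)) := by
    refine tendsto_integral_of_dominated_convergence
      (fun ω => |condLoss F t Q w (Y 0) ω| + |u ω|)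
      (fun n => ((integrable_condLoss w (W n)).inf hu).aestronglyMeasurable)
      ((integrable_condLoss w (Y 0)).abs.add hu.abs) (fun n => ?_) ?_
    · filter_upwards [hWle n] with ω hω
      have h1 := hω 0 (Nat.zero_le n)
      have h2 := neg_abs_le (condLoss F t Q w (Y 0) ω)
      have h3 := neg_abs_le (u ω)
      have h4 := abs_nonneg (u ω)
      have h5 := abs_nonneg (condLoss F t Q w (Y 0) ω)
      refine abs_le.2 ⟨le_min (by linarith) (by linarith), (min_le_right _ _).trans ?_⟩
      linarith [le_abs_self (u ω)]
    · filter_upwards [ae_all_iff.2 hWle, hule, hpen] with ω h1 h2 h3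
      rw [h3] at h2
      refine Metric.tendsto_atTop.2 fun ε hε => ?_
      have h4 : ((u ω - ε : ℝ) : EReal) < ⨆ k, v k ω :=
        (EReal.coe_lt_coe_iff.2 (sub_lt_self _ hε)).trans_le h2
      obtain ⟨k, hk⟩ := lt_iSup_iff.1 h4
      rw [hvY k, EReal.coe_lt_coe_iff] at hk
      refine ⟨k, fun n hn => ?_⟩
      have h5 := hk.trans_le (h1 n k hn)
      rw [Real.dist_eq, abs_lt]
      exact ⟨by linarith [lt_min h5 (sub_lt_self (u ω) hε)], by
        linarith [min_le_right (condLoss F t Q w (W n) ω) (u ω)]⟩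
  refine le_of_tendsto' hlim fun n => ?_
  refine le_trans ?_ (hb (W n) (hWa n))
  rw [← integral_condLoss (F := F) (t := t)]
  exact integral_mono ((integrable_condLoss w (W n)).inf hu) (integrable_condLoss w (W n))
    fun ω => min_le_left _ _

theorem penalty_nonneg [IsFiniteMeasure Q] (hρ : IsProcessRiskMeasure F P t ρ)
    (γ : h.Time → Ω → ℝ) : ∀ᵐ ω ∂Q, 0 ≤ penalty F P t ρ Q γ ω := by
  have h1 := (isEssSup_penalty (F := F) (P := P) (t := t) (ρ := ρ) (Q := Q) γ).2.1 _
    ⟨_, IsAccepted.zero hρ, rfl⟩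
  have h2 : condLoss F t Q (condWeight γ t) (fun (_ : h.Time) _ => 0) = 0 := by
    unfold condLoss pair
    simp only [mul_zero, tsum_zero, neg_zero]
    exact condExp_zero
  filter_upwards [h1] with ω hω
  rw [h2] at hω
  exact hω

/-- The function equal to `K` on `{penalty = ∞}` and `0` elsewhere lies below the penalty, so `K`
times the probability of this event is at most `b`, for every `K`. -/
theorem penalty_lt_top [IsFiniteMeasure Q] (hρ : IsProcessRiskMeasure F P t ρ)
    {γ : h.Time → Ω → ℝ} (hw : IsWeight F P Q (condWeight γ t)) {b : ℝ}
    (hb : ∀ Y, IsAccepted F P t ρ Y → -∫ ω, pair (condWeight γ t) Y ω ∂Q ≤ b) :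
    ∀ᵐ ω ∂Q, penalty F P t ρ Q γ ω < ⊤ := by
  have hZ := (isEssSup_penalty (F := F) (P := P) (t := t) (ρ := ρ) (Q := Q) γ).1
  have hA : MeasurableSet {ω | penalty F P t ρ Q γ ω = ⊤} :=
    F.le t _ (hZ (measurableSet_singleton ⊤))
  have h1 : ∀ K : ℕ, K * Q.real {ω | penalty F P t ρ Q γ ω = ⊤} ≤ b := by
    intro K
    have h2 := integral_le_of_le_penalty hρ hw hb
      (u := {ω | penalty F P t ρ Q γ ω = ⊤}.indicator fun _ => (K : ℝ))
      ((integrable_const _).indicator hA) (by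
        filter_upwards [penalty_nonneg hρ γ] with ω hω
        by_cases h3 : penalty F P t ρ Q γ ω = ⊤
        · rw [h3]; exact le_top
        · rw [Set.indicator_of_notMem (show ω ∉ {ω | penalty F P t ρ Q γ ω = ⊤} from h3)]
          exact hω)
    rwa [integral_indicator_const _ hA, smul_eq_mul, mul_comm] at h2
  have h4 : Q.real {ω | penalty F P t ρ Q γ ω = ⊤} = 0 := by
    by_contra h0
    have hpos := lt_of_le_of_ne measureReal_nonneg (Ne.symm h0)
    obtain ⟨K, hK⟩ := exists_nat_gt (b / Q.real {ω | penalty F P t ρ Q γ ω = ⊤})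
    exact absurd (h1 K) (not_le.2 ((div_lt_iff₀ hpos).1 hK))
  rw [measureReal_eq_zero_iff] at h4
  filter_upwards [measure_eq_zero_iff_ae_notMem.1 h4] with ω hω
  exact lt_top_iff_ne_top.2 hω

theorem IsLInfty.integrable_of_agreeOn [IsFiniteMeasure Q] (hA : AgreeOn (F t) Q P) {m : Ω → ℝ}
    (hm : IsLInfty (F t) P m) : Integrable m Q := by
  obtain ⟨c, hc⟩ := hm.2
  refine Integrable.of_bound (hm.1.mono (F.le t) le_rfl).aestronglyMeasurable c ?_
  exact hA.ae_of (measurableSet_le_of (measurable_abs_of hm.1) measurable_const) hc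

theorem AgreeOn.ae_eq_of_ae_eq {m : MeasurableSpace Ω} (hA : AgreeOn m Q P) {f g : Ω → ℝ}
    (hf : Measurable[m] f) (hg : Measurable[m] g) (hfg : f =ᵐ[P] g) : f =ᵐ[Q] g := by
  have h1 : Measurable[m] fun ω => f ω - g ω := hf.sub hg
  filter_upwards [hA.ae_of (h1 (measurableSet_singleton 0))
    (hfg.mono fun ω hω => sub_eq_zero.2 hω)] with ω hω using sub_eq_zero.1 hω

/-- Conditional cash additivity of the conditional losses. -/
theorem condLoss_add_payFrom [IsFiniteMeasure Q] (hA : AgreeOn (F t) Q P)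
    {w X : h.Time → Ω → ℝ} (hw : IsWeight F P Q w) {k : ℕ∞}
    (hk : ∀ᵐ ω ∂Q, HasSum (fun s : h.Time => if k ≤ s then w s ω else 0) 1)
    (hX : IsRInfty F P t X) {m : Ω → ℝ} (hm : IsLInfty (F t) P m) :
    condLoss F t Q w (fun s ω => X s ω + payFrom k m s ω) =ᵐ[P]
      fun ω => condLoss F t Q w X ω - m ω := by
  have hmi := hm.integrable_of_agreeOn hA
  refine hA.symm.ae_eq_of_ae_eq (measurable_condLoss _ _)
    ((measurable_condLoss _ _).sub hm.1) ?_
  have h3 := hw.pair_add_payFrom hX (k := k) (m := m) (a := fun _ => 1) hk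
  have h4 : (fun ω => -pair w (fun s ω => X s ω + payFrom k m s ω) ω)
      =ᵐ[Q] (fun ω => -pair w X ω) - m := by
    filter_upwards [h3] with ω hω
    simp only [hω, Pi.sub_apply]
    ring
  refine (condExp_congr_ae h4).trans ((condExp_sub (hw.integrable_pair_of_isRInfty hX).neg hmi
    (F t)).trans ?_)
  rw [condExp_of_stronglyMeasurable (F.le t) hm.1.stronglyMeasurable hmi]
  rfl

/-- The upper bound in the robust representation. -/
theorem condLoss_sub_penalty_le [IsFiniteMeasure Q] (hρ : IsProcessRiskMeasure F P t ρ)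
    (hA : AgreeOn (F t) Q P) {γ X : h.Time → Ω → ℝ} (hw : IsWeight F P Q (condWeight γ t))
    (hone : ∀ᵐ ω ∂Q, HasSum (fun s => condWeight γ t s ω) 1) (hX : IsRInfty F P t X) :
    (fun ω => (condLoss F t Q (condWeight γ t) X ω : EReal) - penalty F P t ρ Q γ ω)
      ≤ᵐ[P] fun ω => (ρ X ω : EReal) := by
  have hpen := isEssSup_penalty (F := F) (P := P) (t := t) (ρ := ρ) (Q := Q) γ
  have hρm := hρ.mem X hX
  -- The position `X + ρ(X) 1_{𝕋_t}` is accepted, and its conditional loss is that of `X` minus `ρ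
  -- X`.
  have h1 := hpen.2.1 _ ⟨_, IsAccepted.add_risk hρ hX, rfl⟩
  have h2 := hA.ae_eq_of_ae_eq (measurable_condLoss _ _) ((measurable_condLoss _ _).sub hρm.1)
    (condLoss_add_payFrom hA hw (k := t) (by
      filter_upwards [hone] with ω hω
      refine hω.congr_fun fun s => ?_
      unfold condWeight
      split_ifs <;> rfl) hX hρm)
  refine hA.symm.ae_of (measurableSet_le_of ?_ hρm.1.coe_real_ereal) ?_
  · exact (measurable_condLoss _ X).coe_real_ereal.sub hpen.1
  · filter_upwards [h1, h2] with ω h1 h2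
    rw [h2, Pi.sub_apply, EReal.coe_sub] at h1
    rw [EReal.sub_le_iff_le_add (Or.inr (EReal.coe_ne_top _)) (Or.inr (EReal.coe_ne_bot _))]
    have h5 := EReal.sub_le_iff_le_add (a := (condLoss F t Q (condWeight γ t) X ω : EReal))
      (b := (ρ X ω : EReal)) (c := penalty F P t ρ Q γ ω) (Or.inl (EReal.coe_ne_bot _))
      (Or.inl (EReal.coe_ne_top _))
    rw [add_comm]
    exact h5.1 h1

/-- The lower bound in the robust representation: it suffices to find, for every `c < E[ρ(X)]`,
a model whose expected loss minus penalty is at least `c`. -/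
theorem le_of_forall_exists_model [IsProbabilityMeasure P] (hρ : IsProcessRiskMeasure F P t ρ)
    {X : h.Time → Ω → ℝ} (hX : IsRInfty F P t X) {G : Ω → EReal} (hG : Measurable[F t] G)
    (H : ∀ c < ∫ ω, ρ X ω ∂P, ∃ (Q : Measure Ω) (γ : h.Time → Ω → ℝ), IsProbabilityMeasure Q ∧
      AgreeOn (F t) Q P ∧ IsWeight F P Q (condWeight γ t) ∧
      (∀ᵐ ω ∂Q, HasSum (fun s => condWeight γ t s ω) 1) ∧
      (∀ Y, IsAccepted F P t ρ Y → -∫ ω, pair (condWeight γ t) Y ω ∂Q ≤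
        -∫ ω, pair (condWeight γ t) X ω ∂Q - c) ∧
      (fun ω => (condLoss F t Q (condWeight γ t) X ω : EReal) - penalty F P t ρ Q γ ω) ≤ᵐ[P] G) :
    (fun ω => (ρ X ω : EReal)) ≤ᵐ[P] G := by
  have hρm := hρ.mem X hX
  obtain ⟨K, hK⟩ := hρm.2
  -- `G` may take infinite values, so it is cut to lie between `-(K + 1)` and `ρ X`. The lower level
  -- is strictly below `-K ≤ ρ X`, hence where the cut function equals `ρ X` one has `ρ X ≤ G`.
  obtain ⟨b, hb⟩ : ∃ b : Ω → EReal, ∀ ω, b ω = min (ρ X ω : EReal) (max (G ω) ((-(K + 1) : ℝ) : EReal)) :=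
    ⟨_, fun _ => rfl⟩
  have hbm : Measurable[F t] b := by
    rw [funext hb]
    exact hρm.1.coe_real_ereal.min (hG.max measurable_const)
  have hbt : ∀ ω, b ω ≠ ⊤ := fun ω => by
    rw [hb]
    exact ((min_le_left _ _).trans_lt (EReal.coe_lt_top _)).ne
  have hbb : ∀ ω, b ω ≠ ⊥ := fun ω => by
    rw [hb]
    exact (lt_min (EReal.bot_lt_coe _) ((EReal.bot_lt_coe _).trans_le (le_max_right _ _))).ne'
  obtain ⟨g, hg⟩ : ∃ g : Ω → ℝ, ∀ ω, g ω = (b ω).toReal := ⟨_, fun _ => rfl⟩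
  have hgb : ∀ ω, (g ω : EReal) = b ω := fun ω => by
    rw [hg, EReal.coe_toReal (hbt ω) (hbb ω)]
  have hgm : Measurable[F t] g := by
    rw [funext hg]
    exact hbm.ereal_toReal
  have hgle : ∀ ω, g ω ≤ ρ X ω := fun ω => by
    rw [← EReal.coe_le_coe_iff, hgb, hb]
    exact min_le_left _ _
  have hgL : IsLInfty (F t) P g := by
    refine ⟨hgm, K + 1, ?_⟩
    filter_upwards [hK] with ω hω
    have h1 := _root_.abs_le.1 hω
    refine _root_.abs_le.2 ⟨?_, by linarith [hgle ω]⟩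
    rw [← EReal.coe_le_coe_iff, hgb, hb]
    exact le_min (EReal.coe_le_coe_iff.2 (by linarith)) (le_max_right _ _)
  -- As `g ≤ ρ X` everywhere, the inequality of integrals forces almost sure equality.
  have hint : ∫ ω, ρ X ω ∂P ≤ ∫ ω, g ω ∂P := by
    refine le_of_forall_lt fun c hc => ?_
    obtain ⟨c', hcc', hc'⟩ := exists_between hc
    obtain ⟨Q, γ, hQ, hA, hw, hone, hY, hle⟩ := H c' hc'
    refine hcc'.trans_le ?_
    have hpen := (isEssSup_penalty (F := F) (P := P) (t := t) (ρ := ρ) (Q := Q) γ).1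
    have hupper := condLoss_sub_penalty_le hρ hA hw hone hX
    have h1 : ∀ᵐ ω ∂P, (condLoss F t Q (condWeight γ t) X ω : EReal) - penalty F P t ρ Q γ ω ≤
        b ω := by
      filter_upwards [hle, hupper] with ω h2 h3
      rw [hb]
      exact le_min h3 (h2.trans (le_max_left _ _))
    have h2 : ∀ᵐ ω ∂Q, (condLoss F t Q (condWeight γ t) X ω : EReal) -
        penalty F P t ρ Q γ ω ≤ b ω :=
      hA.ae_of (measurableSet_le_of ((measurable_condLoss _ X).coe_real_ereal.sub hpen) hbm) h1
    have hgi := hgL.integrable_of_agreeOn hA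
    -- The loss minus `g` lies below the penalty, so its integral is at most the expected loss minus
    -- `c'`. This says `c' ≤ E[g]`.
    have h3 := integral_le_of_le_penalty hρ hw hY
      (u := fun ω => condLoss F t Q (condWeight γ t) X ω - g ω)
      ((integrable_condLoss _ X).sub hgi) (by
        filter_upwards [h2] with ω h4
        rw [EReal.coe_sub, hgb]
        rw [EReal.sub_le_iff_le_add (Or.inr (hbt ω)) (Or.inr (hbb ω))] at h4
        rw [EReal.sub_le_iff_le_add (Or.inl (hbb ω)) (Or.inl (hbt ω)), add_comm]
        exact h4)
    rw [integral_sub (integrable_condLoss _ X) hgi, integral_condLoss,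
      hA.integral_eq (F.le t) hgm] at h3
    linarith
  have hgP := hgL.integrable (F.le t)
  have hρP := hρ.integrable hX
  have heq : g =ᵐ[P] ρ X := by
    have h1 := (integral_eq_zero_iff_of_nonneg (μ := P) (f := fun ω => ρ X ω - g ω)
      (fun ω => sub_nonneg.2 (hgle ω)) (hρP.sub hgP)).1 (by
        rw [integral_sub hρP hgP]
        linarith [integral_mono hgP hρP hgle])
    filter_upwards [h1] with ω hω
    exact (sub_eq_zero.1 hω).symm
  filter_upwards [heq, hK] with ω h1 h2
  have h3 : (ρ X ω : EReal) ≤ max (G ω) ((-(K + 1) : ℝ) : EReal) := by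
    rw [← h1, hgb, hb]
    exact min_le_right _ _
  rcases le_max_iff.1 h3 with h4 | h4
  · exact h4
  · rw [EReal.coe_le_coe_iff] at h4
    linarith [(_root_.abs_le.1 h2).1]

end ProcessRisk

namespace ProcessRisk

/-! The product space with the optional σ-field -/

open scoped ENNReal

variable {h : Horizon} {Ω : Type*} {mΩ : MeasurableSpace Ω} {F : Filtration ℕ mΩ}
  {P Q : Measure Ω} {t : ℕ} {ρ : (h.Time → Ω → ℝ) → Ω → ℝ}

/-- The product space `Ω × 𝕋`, to be equipped with the optional σ-field. -/
def OptSpace (h : Horizon) (_ : Filtration ℕ mΩ) : Type _ := Ω × h.Time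

instance : MeasurableSpace (OptSpace h F) := optionalField h F

/-- The section map at time `s`. -/
def optMk (F : Filtration ℕ mΩ) (s : h.Time) (ω : Ω) : OptSpace h F := (ω, s)

theorem preimage_optMk_prod (s r : h.Time) (A : Set Ω) [Decidable (r = s)] :
    optMk F s ⁻¹' (A ×ˢ {r} : Set (Ω × h.Time)) = if r = s then A else ∅ := by
  ext ω
  change (ω ∈ A ∧ s = r) ↔ _
  split_ifs with hrs
  · exact ⟨fun h' => h'.1, fun h' => ⟨h', hrs.symm⟩⟩
  · exact ⟨fun h' => hrs h'.2.symm, fun h' => h'.elim⟩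

theorem measurable_optMk (s : h.Time) :
    @Measurable _ _ (sig F s) _ (optMk F s) := by
  classical
  refine @measurable_generateFrom _ _ (sig F s) _ _ ?_
  rintro B ⟨r, A, hA, rfl⟩
  have h1 := preimage_optMk_prod (F := F) s r A
  by_cases hrs : r = s
  · subst hrs
    rw [if_pos rfl] at h1
    exact (congrArg _ h1).mpr hA
  · rw [if_neg hrs] at h1
    exact (congrArg _ h1).mpr (@MeasurableSet.empty _ (sig F s))

theorem measurable_optMk' (s : h.Time) : Measurable (optMk F s) :=
  (measurable_optMk s).mono (sig_le F s) le_rfl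

/-- The function on the product space given by a process. -/
def uncurryProc {α : Type*} (F : Filtration ℕ mΩ) (X : h.Time → Ω → α) (p : OptSpace h F) : α :=
  X (Prod.snd p) (Prod.fst p)

theorem uncurryProc_optMk {α : Type*} (X : h.Time → Ω → α) (s : h.Time) (ω : Ω) :
    uncurryProc F X (optMk F s ω) = X s ω := rfl

theorem measurable_uncurryProc {α : Type*} [MeasurableSpace α] {X : h.Time → Ω → α}
    (hX : ∀ s : h.Time, Measurable[sig F s] (X s)) : Measurable (uncurryProc F X) := by
  intro U hU
  have h1 : uncurryProc F X ⁻¹' U = ⋃ s : h.Time, ((X s ⁻¹' U) ×ˢ {s} : Set (Ω × h.Time)) := by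
    ext ⟨ω, r⟩
    refine Iff.trans ?_ Set.mem_iUnion.symm
    exact ⟨fun hp => ⟨r, hp, rfl⟩, fun ⟨s, hs1, hs2⟩ => by
      have hs3 : r = s := hs2
      rw [← hs3] at hs1
      exact hs1⟩
  rw [h1]
  exact MeasurableSet.iUnion fun s =>
    MeasurableSpace.measurableSet_generateFrom ⟨s, _, hX s hU, rfl⟩

/-- The measure `Q ⊗ w`, as a measure on `OptSpace h F`. -/
noncomputable def optMeasure (F : Filtration ℕ mΩ) (Q : Measure Ω) (w : h.Time → Ω → ℝ) :
    Measure (OptSpace h F) :=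
  Measure.sum fun s : h.Time => (Q.withDensity fun ω => ENNReal.ofReal (w s ω)).map (optMk F s)

theorem otimes_eq (w : h.Time → Ω → ℝ) : otimes F Q w = optMeasure F Q w := rfl

theorem optMeasure_apply {w : h.Time → Ω → ℝ} {B : Set (OptSpace h F)} (hB : MeasurableSet B) :
    optMeasure F Q w B = ∑' s : h.Time, ∫⁻ ω in optMk F s ⁻¹' B, ENNReal.ofReal (w s ω) ∂Q := by
  rw [optMeasure, Measure.sum_apply _ hB]
  refine tsum_congr fun s => ?_
  rw [Measure.map_apply (measurable_optMk' s) hB, withDensity_apply _ (measurable_optMk' s hB)]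

theorem lintegral_optMeasure {w : h.Time → Ω → ℝ} (hw : ∀ s, Measurable (w s))
    {f : OptSpace h F → ℝ≥0∞} (hf : Measurable f) :
    ∫⁻ p, f p ∂optMeasure F Q w =
      ∑' s : h.Time, ∫⁻ ω, ENNReal.ofReal (w s ω) * f (optMk F s ω) ∂Q := by
  rw [optMeasure, lintegral_sum_measure]
  refine tsum_congr fun s => ?_
  rw [lintegral_map hf (measurable_optMk' s)]
  exact lintegral_withDensity_eq_lintegral_mul _ (hw s).ennreal_ofReal
    (hf.comp (measurable_optMk' s))

/-- Strict positivity of `μ`: an event that is null for `P ⊗ μ` has a `P`-null section at every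
time. -/
theorem IsReference.ae_of_ae_optMeasure {μ : h.Time → Ω → ℝ} (hμ : IsReference F P μ)
    {p : OptSpace h F → Prop} (hp : ∀ᵐ x ∂optMeasure F P μ, p x)
    (s : h.Time) : ∀ᵐ ω ∂P, p (optMk F s ω) := by
  rw [optMeasure, Measure.ae_sum_iff] at hp
  have h1 := ae_of_ae_map (measurable_optMk' s).aemeasurable (hp s)
  rw [ae_withDensity_iff ((hμ.adapted s).mono (sig_le F s) le_rfl).ennreal_ofReal] at h1
  filter_upwards [h1, hμ.pos] with ω h2 h3
  exact h2 (ENNReal.ofReal_pos.2 (h3 s)).ne'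

theorem IsReference.isWeight {μ : h.Time → Ω → ℝ} (hμ : IsReference F P μ) :
    IsWeight F P P μ where
  measurable s := (hμ.adapted s).mono (sig_le F s) le_rfl
  nonneg := hμ.pos.mono fun ω hω s => (hω s).le
  sum_le := hμ.sum_one.mono fun ω hω => ⟨1, le_rfl, hω⟩
  ac s B _ hB := by
    filter_upwards [measure_eq_zero_iff_ae_notMem.1 hB] with ω h1 h2 using absurd h2 h1

namespace IsWeight

variable {w : h.Time → Ω → ℝ}

theorem lintegral_optMeasure_ofReal (hw : IsWeight F P Q w) {f : OptSpace h F → ℝ}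
    (hf : Measurable f) (hf0 : ∀ x, 0 ≤ f x) {c : ℝ} (hc : ∀ x, f x ≤ c) :
    ∫⁻ p, ENNReal.ofReal (f p) ∂optMeasure F Q w =
      ∫⁻ ω, ENNReal.ofReal (pair w (fun s ω => f (optMk F s ω)) ω) ∂Q := by
  have hm : ∀ s : h.Time, AEMeasurable (fun ω =>
      ENNReal.ofReal (w s ω) * ENNReal.ofReal (f (optMk F s ω))) Q := fun s =>
    ((hw.measurable s).ennreal_ofReal.mul
      (hf.comp (measurable_optMk' s)).ennreal_ofReal).aemeasurable
  rw [lintegral_optMeasure hw.measurable hf.ennreal_ofReal, ← lintegral_tsum hm]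
  refine lintegral_congr_ae ?_
  filter_upwards [hw.nonneg, hw.sum_le] with ω h0 ⟨a, _, ha⟩
  have hn : ∀ s, 0 ≤ w s ω * f (optMk F s ω) := fun s => mul_nonneg (h0 s) (hf0 _)
  have hs : Summable fun s => w s ω * f (optMk F s ω) :=
    Summable.of_nonneg_of_le hn (fun s => mul_le_mul_of_nonneg_left (hc _) (h0 s))
      (ha.summable.mul_right c)
  rw [pair, ENNReal.ofReal_tsum_of_nonneg hn hs]
  exact tsum_congr fun s => (ENNReal.ofReal_mul (h0 s)).symm

theorem optMeasure_univ (hw : IsWeight F P Q w) :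
    optMeasure F Q w Set.univ =
      ∫⁻ ω, ENNReal.ofReal (pair w (fun _ _ => 1) ω) ∂Q := by
  rw [← hw.lintegral_optMeasure_ofReal (f := fun _ => 1) measurable_const (fun _ => zero_le_one)
    (fun _ => le_rfl)]
  simp

theorem isFiniteMeasure_optMeasure [IsProbabilityMeasure Q] (hw : IsWeight F P Q w) :
    IsFiniteMeasure (optMeasure F Q w) := by
  refine ⟨?_⟩
  rw [hw.optMeasure_univ]
  refine (lintegral_mono_ae (g := fun _ => 1) ?_).trans_lt (by simp)
  filter_upwards [hw.sum_le] with ω ⟨a, ha1, ha⟩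
  rw [ENNReal.ofReal_le_one, pair]
  simp only [mul_one]
  rwa [ha.tsum_eq]

theorem isProbabilityMeasure_optMeasure [IsProbabilityMeasure Q] (hw : IsWeight F P Q w)
    (hone : ∀ᵐ ω ∂Q, HasSum (fun s => w s ω) 1) :
    IsProbabilityMeasure (optMeasure F Q w) := by
  refine ⟨?_⟩
  rw [hw.optMeasure_univ, lintegral_congr_ae (g := fun _ => 1)]
  · simp
  · filter_upwards [hone] with ω hω
    simp only [pair, mul_one, hω.tsum_eq, ENNReal.ofReal_one]

theorem integral_optMeasure [IsProbabilityMeasure Q] (hw : IsWeight F P Q w)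
    {f : OptSpace h F → ℝ} (hf : Measurable f) {c : ℝ} (hc : ∀ x, |f x| ≤ c) :
    ∫ p, f p ∂optMeasure F Q w =
      ∫ ω, pair w (fun s ω => f (optMk F s ω)) ω ∂Q := by
  have hfin := hw.isFiniteMeasure_optMeasure
  have hpos : ∀ (g : OptSpace h F → ℝ) (d : ℝ), Measurable g → (∀ x, 0 ≤ g x) → (∀ x, g x ≤ d) →
      ∫ p, g p ∂optMeasure F Q w =
        ∫ ω, pair w (fun s ω => g (optMk F s ω)) ω ∂Q := by
    intro g d hg hg0 hgd
    have hga : IsAdapted F fun s ω => g (optMk F s ω) := fun s => hg.comp (measurable_optMk s)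
    rw [integral_eq_lintegral_of_nonneg_ae (.of_forall hg0) hg.aestronglyMeasurable,
      hw.lintegral_optMeasure_ofReal hg hg0 hgd, integral_eq_lintegral_of_nonneg_ae ?_
        (hw.measurable_pair hga).aestronglyMeasurable]
    filter_upwards [hw.nonneg] with ω hω
    exact tsum_nonneg fun s => mul_nonneg (hω s) (hg0 _)
  by_cases hne : Nonempty (OptSpace h F)
  swap
  · have : IsEmpty (OptSpace h F) := not_nonempty_iff.1 hne
    have : IsEmpty Ω := ⟨fun ω => hne ⟨optMk F ⟨0, zero_mem_times h⟩ ω⟩⟩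
    rw [integral_of_isEmpty, integral_of_isEmpty]
  obtain ⟨x₀⟩ := hne
  have hc0 : 0 ≤ c := (abs_nonneg _).trans (hc x₀)
  -- Adding the constant `c` reduces a bounded function to nonnegative ones.
  have h1 := hpos (fun x => f x + c) (c + c) (hf.add_const c)
    (fun x => by linarith [(abs_le.1 (hc x)).1]) (fun x => by linarith [(abs_le.1 (hc x)).2])
  have h2 := hpos (fun _ => c) c measurable_const (fun _ => hc0) (fun _ => le_rfl)
  have hfa : IsAdapted F fun s ω => f (optMk F s ω) := fun s => hf.comp (measurable_optMk s)
  have hca : IsAdapted F fun (_ : h.Time) (_ : Ω) => c := fun s => measurable_const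
  have hcs : ∀ s : h.Time, ∀ᵐ ω ∂P, |f (optMk F s ω)| ≤ c := fun s => .of_forall fun ω => hc _
  have hcc : ∀ s : h.Time, ∀ᵐ ω ∂P, |c| ≤ c := fun s => .of_forall fun ω => (abs_of_nonneg hc0).le
  have hi1 := hw.integrable_pair hfa hc0 hcs
  have hi2 := hw.integrable_pair hca hc0 hcc
  have h3 : ∫ ω, pair w (fun s ω => f (optMk F s ω) + c) ω ∂Q =
      ∫ ω, pair w (fun s ω => f (optMk F s ω)) ω ∂Q + ∫ ω, pair w (fun _ _ => c) ω ∂Q := by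
    rw [← integral_add hi1 hi2]
    refine integral_congr_ae ?_
    filter_upwards [hw.ae_summable hfa hcs, hw.ae_summable hca hcc] with ω h4 h5
    simp only [pair, mul_add]
    exact h4.tsum_add h5
  have hfi : Integrable f (optMeasure F Q w) :=
    Integrable.of_bound hf.aestronglyMeasurable c (.of_forall hc)
  rw [integral_add hfi (integrable_const _), h2, h3] at h1
  exact add_right_cancel h1

end IsWeight

/-- The process on `𝕋_t` given by a function on the product space. -/
def toProc (t : ℕ) (Y : OptSpace h F → ℝ) (s : h.Time) (ω : Ω) : ℝ :=
  if (t : ℕ∞) ≤ s then Y (optMk F s ω) else 0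

theorem isAdapted_toProc {Y : OptSpace h F → ℝ} (hY : Measurable Y) :
    IsAdapted F (toProc (h := h) t Y) := fun s => by
  by_cases hs : (t : ℕ∞) ≤ s
  · rw [show toProc t Y s = fun ω => Y (optMk F s ω) from funext fun ω => if_pos hs]
    exact hY.comp (measurable_optMk s)
  · rw [show toProc t Y s = fun _ => 0 from funext fun ω => if_neg hs]
    exact measurable_const

theorem toProc_of_lt {Y : OptSpace h F → ℝ} {s : h.Time} (hs : (s : ℕ∞) < t) :
    toProc t Y s = 0 := funext fun _ => if_neg (not_le.2 hs)

theorem isRInfty_toProc {Y : OptSpace h F → ℝ} (hY : Measurable Y) {b : ℝ}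
    (hb : ∀ s : h.Time, ∀ᵐ ω ∂P, |Y (optMk F s ω)| ≤ b) : IsRInfty F P t (toProc (h := h) t Y) := by
  refine IsRInfty.of_bound (isAdapted_toProc hY) (c := max b 0) (fun s => ?_) fun s hs =>
    .of_forall fun ω => by rw [toProc_of_lt hs]
  filter_upwards [hb s] with ω hω
  unfold toProc
  split_ifs
  · exact hω.trans (le_max_left _ _)
  · simp

theorem isRInfty_toProc_coe (Y : bddMeas (OptSpace h F)) :
    IsRInfty F P t (toProc (h := h) t (Y : OptSpace h F → ℝ)) := by
  obtain ⟨c, -, hc⟩ := bddMeas_bounded Y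
  exact isRInfty_toProc (bddMeas_measurable Y) fun s => .of_forall fun ω => hc _

/-- The functions whose expected risk is at most `c`. -/
def riskSet (F : Filtration ℕ mΩ) (P : Measure Ω) (t : ℕ) (ρ : (h.Time → Ω → ℝ) → Ω → ℝ)
    (c : ℝ) : Set (bddMeas (OptSpace h F)) :=
  {Y | ∫ ω, ρ (toProc t (Y : OptSpace h F → ℝ)) ω ∂P ≤ c}

theorem convex_riskSet [IsProbabilityMeasure P] (hρ : IsProcessRiskMeasure F P t ρ) (c : ℝ) :
    Convex ℝ (riskSet F P t ρ c) := by
  intro Y hY Z hZ a b ha hb hab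
  have hY' := isRInfty_toProc_coe (P := P) (t := t) Y
  have hZ' := isRInfty_toProc_coe (P := P) (t := t) Z
  have h1 := hρ.convex _ _ hY' hZ' (fun _ => a) measurable_const
    (.of_forall fun ω => ⟨ha, by linarith⟩)
  have h2 : (fun s ω => a * toProc t (Y : OptSpace h F → ℝ) s ω +
      (1 - a) * toProc t (Z : OptSpace h F → ℝ) s ω) =
      toProc t ((a • Y + b • Z : bddMeas (OptSpace h F)) : OptSpace h F → ℝ) := by
    funext s ω
    unfold toProc
    split_ifs
    · simp [← hab]
    · simp
  rw [h2] at h1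
  have h3 := integral_mono_ae (hρ.integrable (isRInfty_toProc_coe (a • Y + b • Z)))
    (((hρ.integrable hY').const_mul a).add ((hρ.integrable hZ').const_mul (1 - a))) h1
  rw [integral_add' ((hρ.integrable hY').const_mul a) ((hρ.integrable hZ').const_mul (1 - a)),
    integral_const_mul, integral_const_mul] at h3
  refine h3.trans ?_
  have h4 : a * ∫ ω, ρ (toProc t (Y : OptSpace h F → ℝ)) ω ∂P ≤ a * c :=
    mul_le_mul_of_nonneg_left hY ha
  have h5 : (1 - a) * ∫ ω, ρ (toProc t (Z : OptSpace h F → ℝ)) ω ∂P ≤ (1 - a) * c :=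
    mul_le_mul_of_nonneg_left hZ (by linarith)
  linarith

/-- A bounded convergent sequence is replaced by the suprema of its tails, which decrease to the
same limit. Continuity from above applies to them, and by monotonicity their expected risk is still
at most `c`. -/
theorem isFatouConvex_riskSet [IsProbabilityMeasure P] (hρ : IsProcessRiskMeasure F P t ρ)
    (hcont : ContinuousFromAbove F P t ρ) {μ : h.Time → Ω → ℝ} (hμ : IsReference F P μ) (c : ℝ) :
    IsFatouConvex (optMeasure F P μ) (riskSet F P t ρ c) where
  convex := convex_riskSet hρ c
  closed := by
    intro H G b hH hHb hlim
    have hb : ∀ n (s : h.Time), ∀ᵐ ω ∂P, |(H n : OptSpace h F → ℝ) (optMk F s ω)| ≤ b :=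
      fun n => hμ.ae_of_ae_optMeasure (hHb n)
    have hlim' := hμ.ae_of_ae_optMeasure hlim
    -- Clipping makes the bound hold at every point, so that the suprema of tails are finite and
    -- measurable everywhere.
    let K : ℕ → OptSpace h F → ℝ := fun n x => max (-|b|) (min |b| ((H n : OptSpace h F → ℝ) x))
    have hKm : ∀ n, Measurable (K n) := fun n =>
      measurable_const.max (measurable_const.min (bddMeas_measurable (H n)))
    have hKb : ∀ n x, |K n x| ≤ |b| := fun n x =>
      abs_le.2 ⟨le_max_left _ _, max_le (by linarith [abs_nonneg b]) (min_le_left _ _)⟩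
    have hKH : ∀ s : h.Time, ∀ᵐ ω ∂P, ∀ n,
        K n (optMk F s ω) = (H n : OptSpace h F → ℝ) (optMk F s ω) := fun s => by
      filter_upwards [ae_all_iff.2 fun n => hb n s] with ω hω n
      have h1 := abs_le.1 ((hω n).trans (le_abs_self b))
      simp only [K, min_eq_right h1.2, max_eq_right h1.1]
    let U : ℕ → OptSpace h F → ℝ := fun n x => ⨆ k, K (n + k) x
    have hbdd : ∀ n x, BddAbove (Set.range fun k => K (n + k) x) := fun n x =>
      ⟨|b|, by rintro _ ⟨k, rfl⟩; exact (abs_le.1 (hKb _ x)).2⟩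
    have hUm : ∀ n, Measurable (U n) := fun n => Measurable.iSup fun k => hKm (n + k)
    have hKU : ∀ n x, K n x ≤ U n x := fun n x => le_ciSup (hbdd n x) 0
    have hUb : ∀ n x, |U n x| ≤ |b| := fun n x =>
      abs_le.2 ⟨(abs_le.1 (hKb n x)).1.trans (hKU n x), ciSup_le fun k => (abs_le.1 (hKb _ x)).2⟩
    have hUanti : ∀ x, Antitone fun n => U n x := fun x => antitone_nat_of_succ_le fun n =>
      ciSup_le fun k => by
        have := le_ciSup (hbdd n x) (k + 1)
        rwa [show n + 1 + k = n + (k + 1) by ring]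
    have hUr : ∀ n, IsRInfty F P t (toProc (h := h) t (U n)) := fun n =>
      isRInfty_toProc (hUm n) fun s => .of_forall fun ω => hUb n _
    have hKr : ∀ n, IsRInfty F P t (toProc (h := h) t (K n)) := fun n =>
      isRInfty_toProc (hKm n) fun s => .of_forall fun ω => hKb n _
    have hG := isRInfty_toProc_coe (P := P) (t := t) G
    have hconv := hcont (fun n => toProc t (U n)) (toProc t (G : OptSpace h F → ℝ)) hUr hG (by
      intro s
      filter_upwards [hlim' s, hKH s] with ω h1 h2
      unfold toProc
      split_ifs
      · refine ⟨hUanti _, ?_⟩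
        refine Metric.tendsto_atTop.2 fun ε hε => ?_
        obtain ⟨N, hN⟩ := Metric.tendsto_atTop.1 h1 (ε / 2) (half_pos hε)
        refine ⟨N, fun n hn => ?_⟩
        have h3 : ∀ k, |K (n + k) (optMk F s ω) - (G : OptSpace h F → ℝ) (optMk F s ω)| < ε / 2 :=
          fun k => by
            have := hN (n + k) (by omega)
            rwa [Real.dist_eq, ← h2] at this
        have h4 : U n (optMk F s ω) ≤ (G : OptSpace h F → ℝ) (optMk F s ω) + ε / 2 :=
          ciSup_le fun k => by linarith [(abs_lt.1 (h3 k)).2]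
        have h5 := (abs_lt.1 (h3 0)).1
        have h6 := hKU n (optMk F s ω)
        rw [Nat.add_zero] at h5
        rw [Real.dist_eq, abs_lt]
        exact ⟨by linarith, by linarith⟩
      · exact ⟨antitone_const, tendsto_const_nhds⟩)
    have hUle : ∀ n, ∫ ω, ρ (toProc t (U n)) ω ∂P ≤ c := fun n => by
      refine le_trans (integral_mono_ae (hρ.integrable (hUr n))
        (hρ.integrable (isRInfty_toProc_coe (H n))) ?_) (hH n)
      have h1 := hρ.monotone _ _ (hKr n) (hUr n) fun s => .of_forall fun ω => by
        unfold toProc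
        split_ifs
        exacts [hKU n _, le_rfl]
      refine h1.trans (hρ.congr (hKr n) (isRInfty_toProc_coe (H n)) fun s => ?_).le
      filter_upwards [hKH s] with ω hω
      simp only [toProc, hω n]
    have hint : Tendsto (fun n => ∫ ω, ρ (toProc t (U n)) ω ∂P) atTop
        (𝓝 (∫ ω, ρ (toProc t (G : OptSpace h F → ℝ)) ω ∂P)) := by
      refine tendsto_integral_of_dominated_convergence (fun _ => |b|)
        (fun n => (hρ.integrable (hUr n)).aestronglyMeasurable) (integrable_const _)
        (fun n => ?_) hconv
      refine hρ.abs_le (hUr n) fun s => .of_forall fun ω => ?_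
      unfold toProc
      split_ifs
      · exact hUb n _
      · simp
    exact le_of_tendsto' hint hUle

theorem riskSet_upward [IsProbabilityMeasure P] (hρ : IsProcessRiskMeasure F P t ρ)
    {μ : h.Time → Ω → ℝ} (hμ : IsReference F P μ) {c : ℝ} {Y Y' : bddMeas (OptSpace h F)}
    (hY : Y ∈ riskSet F P t ρ c) (hle : ∀ᵐ x ∂optMeasure F P μ,
      (Y : OptSpace h F → ℝ) x ≤ (Y' : OptSpace h F → ℝ) x) : Y' ∈ riskSet F P t ρ c := by
  have h1 := hμ.ae_of_ae_optMeasure hle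
  refine le_trans (integral_mono_ae (hρ.integrable (isRInfty_toProc_coe Y'))
    (hρ.integrable (isRInfty_toProc_coe Y)) ?_) hY
  refine hρ.monotone _ _ (isRInfty_toProc_coe Y) (isRInfty_toProc_coe Y') fun s => ?_
  filter_upwards [h1 s] with ω hω
  unfold toProc
  split_ifs
  exacts [hω, le_rfl]

end ProcessRisk

namespace ProcessRisk

/-! Separation of a position from the positions of bounded expected risk -/

open scoped ENNReal

variable {h : Horizon} {Ω : Type*} {mΩ : MeasurableSpace Ω} {F : Filtration ℕ mΩ}
  {P : Measure Ω} {t : ℕ} {ρ : (h.Time → Ω → ℝ) → Ω → ℝ}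

theorem eq_zero_of_forall_le_add_mul {δ a b : ℝ} (H : ∀ k : ℝ, δ ≤ a + k * b) : b = 0 := by
  by_contra hb
  have h1 := H ((δ - 1 - a) / b)
  rw [div_mul_cancel₀ _ hb] at h1
  linarith

theorem measurable_payFrom {m : Ω → ℝ} (hm : Measurable[F t] m) :
    Measurable (uncurryProc F (payFrom (h := h) t m)) := by
  refine measurable_uncurryProc fun s => ?_
  by_cases hs : (t : ℕ∞) ≤ s
  · rw [show payFrom (h := h) t m s = m from funext fun ω => if_pos hs]
    exact hm.mono (sig_coe_le_of_le hs) le_rfl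
  · rw [show payFrom (h := h) t m s = fun _ => 0 from funext fun ω => if_neg hs]
    exact measurable_const

/-- The element `m 1_{𝕋_t}` of the space of bounded measurable functions. -/
def bddPay (h : Horizon) {t : ℕ} {m : Ω → ℝ} (hm : Measurable[F t] m)
    (hb : ∃ c, ∀ ω, |m ω| ≤ c) : bddMeas (OptSpace h F) :=
  ⟨uncurryProc F (payFrom (h := h) t m), measurable_payFrom hm, by
    obtain ⟨c, hc⟩ := hb
    refine ⟨max c 0, fun p => ?_⟩
    change |if (t : ℕ∞) ≤ (p.2 : h.Time) then m p.1 else 0| ≤ _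
    split_ifs
    · exact (hc _).trans (le_max_left _ _)
    · simp⟩

theorem toProc_bddPay {m : Ω → ℝ} (hm : Measurable[F t] m) (hb : ∃ c, ∀ ω, |m ω| ≤ c) :
    toProc t (bddPay h hm hb : OptSpace h F → ℝ) = payFrom t m := by
  funext s ω
  change (if (t : ℕ∞) ≤ s then (if (t : ℕ∞) ≤ s then m ω else 0) else 0) =
    if (t : ℕ∞) ≤ s then m ω else 0
  split_ifs <;> rfl

theorem isLInfty_of_bounded {m : Ω → ℝ} (hm : Measurable[F t] m) (hb : ∃ c, ∀ ω, |m ω| ≤ c) :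
    IsLInfty (F t) P m :=
  ⟨hm, hb.choose, .of_forall hb.choose_spec⟩

theorem integral_risk_add_bddPay [IsProbabilityMeasure P] (hρ : IsProcessRiskMeasure F P t ρ)
    (Y : bddMeas (OptSpace h F)) {m : Ω → ℝ} (hm : Measurable[F t] m) (hb : ∃ c, ∀ ω, |m ω| ≤ c) :
    ∫ ω, ρ (toProc t ((Y + bddPay h hm hb : bddMeas (OptSpace h F)) : OptSpace h F → ℝ)) ω ∂P =
      ∫ ω, ρ (toProc t (Y : OptSpace h F → ℝ)) ω ∂P - ∫ ω, m ω ∂P := by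
  have hY := isRInfty_toProc_coe (P := P) (t := t) Y
  have hm' : IsLInfty (F t) P m := isLInfty_of_bounded hm hb
  have h1 : toProc t ((Y + bddPay h hm hb : bddMeas (OptSpace h F)) : OptSpace h F → ℝ) =
      fun s ω => toProc t (Y : OptSpace h F → ℝ) s ω + payFrom t m s ω := by
    rw [← toProc_bddPay hm hb]
    funext s ω
    unfold toProc
    split_ifs
    · rfl
    · simp
  rw [h1, integral_congr_ae (hρ.cash_invariant _ hY m hm'),
    integral_sub (hρ.integrable hY) (hm'.integrable (F.le t))]

theorem integrable_mul_bddMeas {E : Type*} [MeasurableSpace E] {ν : Measure E} {Z : E → ℝ}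
    (hZ : Integrable Z ν) (Y : bddMeas E) : Integrable (fun x => Z x * (Y : E → ℝ) x) ν := by
  obtain ⟨c, -, hc⟩ := bddMeas_bounded Y
  exact hZ.mul_bdd (c := c) (bddMeas_measurable Y).aestronglyMeasurable (.of_forall hc)

/-- A position of expected risk larger than `c` can be separated from the acceptance set by a
density that is normalized on `F_t`. -/
theorem exists_separating_density [IsProbabilityMeasure P] (hρ : IsProcessRiskMeasure F P t ρ)
    (hcont : ContinuousFromAbove F P t ρ) {μ : h.Time → Ω → ℝ} (hμ : IsReference F P μ) {c : ℝ}
    {X : bddMeas (OptSpace h F)}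
    (hX : c < ∫ ω, ρ (toProc t (X : OptSpace h F → ℝ)) ω ∂P) :
    ∃ z : OptSpace h F → ℝ, Measurable z ∧ (∀ x, 0 ≤ z x) ∧ Integrable z (optMeasure F P μ) ∧
      (∀ (s : h.Time) (ω : Ω), (s : ℕ∞) < t → z (optMk F s ω) = 0) ∧
      (∀ A, MeasurableSet[F t] A → ∫ x, z x *
        uncurryProc F (payFrom (h := h) t (A.indicator fun _ => (1 : ℝ))) x ∂optMeasure F P μ =
          P.real A) ∧
      ∀ Y : bddMeas (OptSpace h F), IsAccepted F P t ρ (toProc t (Y : OptSpace h F → ℝ)) →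
        c ≤ ∫ x, z x * (Y : OptSpace h F → ℝ) x ∂optMeasure F P μ -
          ∫ x, z x * (X : OptSpace h F → ℝ) x ∂optMeasure F P μ := by
  have hprob := hμ.isWeight.isProbabilityMeasure_optMeasure hμ.sum_one
  set ν := optMeasure F P μ with hν
  have hconstb : ∀ k : ℝ, ∃ c, ∀ ω : Ω, |(fun _ : Ω => k) ω| ≤ c := fun k => ⟨|k|, fun _ => le_rfl⟩
  have hcm : ∀ k : ℝ, Measurable[F t] fun _ : Ω => k := fun k => measurable_const
  let K : ℝ → bddMeas (OptSpace h F) := fun k => bddPay h (hcm k) (hconstb k)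
  have hrisk0 : ∫ ω, ρ (toProc t ((0 : bddMeas (OptSpace h F)) : OptSpace h F → ℝ)) ω ∂P = 0 := by
    have h1 : toProc (h := h) t ((0 : bddMeas (OptSpace h F)) : OptSpace h F → ℝ) =
        fun _ _ => 0 := by
      funext s ω
      unfold toProc
      simp
    rw [h1, integral_congr_ae hρ.normalized]
    simp
  have hKc : (0 + K (-c)) ∈ riskSet F P t ρ c := by
    change ∫ ω, _ ∂P ≤ c
    rw [integral_risk_add_bddPay hρ, hrisk0]
    simp
  obtain ⟨Z, δ, hZm, hZ0, hZi, hδ, hZ⟩ := (isFatouConvex_riskSet hρ hcont hμ c).exists_density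
    ⟨_, hKc⟩ (fun Y hY Y' hle => riskSet_upward hρ hμ hY hle) (X := X)
    (fun hmem => absurd (show _ ≤ c from hmem) (not_le.2 hX))
  have h1m : Measurable (uncurryProc F (payFrom (h := h) t fun _ => (1 : ℝ))) :=
    measurable_payFrom measurable_const
  have h1val : ∀ x : OptSpace h F, uncurryProc F (payFrom (h := h) t fun _ => (1 : ℝ)) x = 0 ∨
      uncurryProc F (payFrom (h := h) t fun _ => (1 : ℝ)) x = 1 := fun x => by
    change (if (t : ℕ∞) ≤ (x.2 : h.Time) then (1 : ℝ) else 0) = 0 ∨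
      (if (t : ℕ∞) ≤ (x.2 : h.Time) then (1 : ℝ) else 0) = 1
    split_ifs <;> simp
  -- The risk only depends on the values from `t` on, so the part of the separating density before
  -- `t` may be dropped.
  obtain ⟨Z₁, hZ₁⟩ : ∃ Z₁ : OptSpace h F → ℝ, ∀ x,
      Z₁ x = Z x * uncurryProc F (payFrom (h := h) t fun _ => (1 : ℝ)) x := ⟨_, fun _ => rfl⟩
  have hZ₁m : Measurable Z₁ := by
    rw [funext hZ₁]
    exact hZm.mul h1m
  have hZ₁0 : ∀ x, 0 ≤ Z₁ x := fun x => by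
    rw [hZ₁]
    rcases h1val x with h' | h' <;> simp [h', hZ0]
  have hZ₁i : Integrable Z₁ ν := by
    rw [funext hZ₁]
    exact integrable_mul_bddMeas hZi (K 1)
  obtain ⟨L, hL⟩ : ∃ L : bddMeas (OptSpace h F) → ℝ, ∀ Y,
      L Y = ∫ x, Z₁ x * (Y : OptSpace h F → ℝ) x ∂ν := ⟨_, fun _ => rfl⟩
  have hLadd : ∀ Y Y' : bddMeas (OptSpace h F), L (Y + Y') = L Y + L Y' := fun Y Y' => by
    rw [hL, hL, hL, ← integral_add (integrable_mul_bddMeas hZ₁i Y) (integrable_mul_bddMeas hZ₁i Y')]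
    refine integral_congr_ae (.of_forall fun x => ?_)
    simp [mul_add]
  have hLsep : ∀ Y ∈ riskSet F P t ρ c, δ ≤ L Y - L X := by
    intro Y hY
    -- `Y'` agrees with `Y` from `t` on and with `X` before. It has the risk of `Y`, and its
    -- difference to `X` is only seen by `Z₁`.
    let Y' : bddMeas (OptSpace h F) := ⟨fun x => uncurryProc F (payFrom (h := h) t fun _ => (1 : ℝ)) x
      * ((Y : OptSpace h F → ℝ) x - (X : OptSpace h F → ℝ) x) + (X : OptSpace h F → ℝ) x, by
      refine ⟨(h1m.mul ((bddMeas_measurable Y).sub (bddMeas_measurable X))).add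
        (bddMeas_measurable X), ?_⟩
      obtain ⟨d, -, hd⟩ := bddMeas_bounded Y
      obtain ⟨e, -, he⟩ := bddMeas_bounded X
      refine ⟨max d e, fun x => ?_⟩
      rcases h1val x with h' | h'
      · simpa [h'] using Or.inr (he x)
      · simpa [h'] using Or.inl (hd x)⟩
    have hY'Y : toProc t (Y' : OptSpace h F → ℝ) = toProc t (Y : OptSpace h F → ℝ) := by
      funext s ω
      unfold toProc
      split_ifs with hs
      · have h1 : uncurryProc F (payFrom (h := h) t fun _ => (1 : ℝ)) (optMk F s ω) = 1 :=
          if_pos hs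
        change uncurryProc F (payFrom (h := h) t fun _ => (1 : ℝ)) (optMk F s ω) * _ + _ = _
        rw [h1, one_mul, sub_add_cancel]
      · rfl
    have h1 := hZ Y' (show _ ≤ c by rw [hY'Y]; exact hY)
    refine h1.trans (le_of_eq ?_)
    rw [hL, hL, ← integral_sub (integrable_mul_bddMeas hZ₁i Y) (integrable_mul_bddMeas hZ₁i X)]
    refine integral_congr_ae (.of_forall fun x => ?_)
    change Z x * (uncurryProc F (payFrom (h := h) t fun _ => (1 : ℝ)) x * _ + _ - _) = _
    simp only [hZ₁]
    ring
  have hκ : ∫ x, Z₁ x ∂ν = L (K 1) := by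
    rw [hL]
    refine integral_congr_ae (.of_forall fun x => ?_)
    change Z₁ x = Z₁ x * uncurryProc F (payFrom (h := h) t fun _ => (1 : ℝ)) x
    rcases h1val x with h' | h' <;> simp [hZ₁, h']
  -- With zero total mass the functional `L` would vanish, against the strict separation by `δ`.
  have hκ0 : 0 < ∫ x, Z₁ x ∂ν := by
    refine lt_of_le_of_ne (integral_nonneg hZ₁0) fun h0 => ?_
    have h1 := (integral_eq_zero_iff_of_nonneg hZ₁0 hZ₁i).1 h0.symm
    have h2 : ∀ Y, L Y = 0 := fun Y => by
      rw [hL, ← integral_zero (OptSpace h F) ℝ (μ := ν)]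
      refine integral_congr_ae ?_
      filter_upwards [h1] with x hx
      simp [hx]
    have h3 := hLsep _ hKc
    rw [h2, h2, sub_zero] at h3
    exact absurd h3 (not_le.2 hδ)
  set κ := ∫ x, Z₁ x ∂ν with hκdef
  have hLK : ∀ k : ℝ, L (K k) = k * κ := fun k => by
    rw [hκ, hL, hL, ← integral_const_mul]
    refine integral_congr_ae (.of_forall fun x => ?_)
    change Z₁ x * (if (t : ℕ∞) ≤ (x.2 : h.Time) then k else 0) =
      k * (Z₁ x * (if (t : ℕ∞) ≤ (x.2 : h.Time) then 1 else 0))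
    split_ifs <;> ring
  have hLA : ∀ A (hA : MeasurableSet[F t] A), ∫ x, Z₁ x *
      uncurryProc F (payFrom (h := h) t (A.indicator fun _ => (1 : ℝ))) x ∂ν = P.real A * κ := by
    intro A hA
    have hAm : Measurable[F t] (A.indicator fun _ => (1 : ℝ)) := measurable_const.indicator hA
    have hAb : ∃ c, ∀ ω, |A.indicator (fun _ => (1 : ℝ)) ω| ≤ c := ⟨1, fun ω => by
      by_cases hω : ω ∈ A <;> simp [hω]⟩
    have hm : ∀ k : ℝ, Measurable[F t] fun ω => k * (A.indicator (fun _ => (1 : ℝ)) ω - P.real A) :=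
      fun k => measurable_const.mul (hAm.sub measurable_const)
    have hb : ∀ k : ℝ, ∃ c, ∀ ω, |k * (A.indicator (fun _ => (1 : ℝ)) ω - P.real A)| ≤ c :=
      fun k => ⟨|k| * (1 + |P.real A|), fun ω => by
        rw [abs_mul]
        refine mul_le_mul_of_nonneg_left ((abs_sub _ _).trans ?_) (abs_nonneg _)
        gcongr
        by_cases hω : ω ∈ A <;> simp [hω]⟩
    -- The payment `k (1_A - P(A))` has mean zero, so it does not change the expected risk, for any
    -- real `k`. The separating functional is bounded below along this line, hence constant there;
    -- this is the normalization on `F_t`.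
    have hmem : ∀ k, (0 + K (-c)) + bddPay h (hm k) (hb k) ∈ riskSet F P t ρ c := by
      intro k
      change ∫ ω, _ ∂P ≤ c
      rw [integral_risk_add_bddPay hρ, integral_risk_add_bddPay hρ, hrisk0, integral_const_mul,
        integral_sub ((integrable_const _).indicator (F.le t A hA)) (integrable_const _),
        integral_indicator_const _ (F.le t A hA)]
      simp
    have hval : ∀ k, L (bddPay h (hm k) (hb k)) =
        k * (L (bddPay h hAm hAb) - P.real A * L (K 1)) := by
      intro k
      have hi1 := integrable_mul_bddMeas hZ₁i (bddPay h hAm hAb)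
      have hi2 := integrable_mul_bddMeas hZ₁i (K 1)
      rw [hL, hL, hL, ← integral_const_mul (P.real A), ← integral_sub hi1 (hi2.const_mul _),
        ← integral_const_mul]
      refine integral_congr_ae (.of_forall fun x => ?_)
      change Z₁ x * (if (t : ℕ∞) ≤ (x.2 : h.Time) then
          k * (A.indicator (fun _ => (1 : ℝ)) x.1 - P.real A) else 0) =
        k * (Z₁ x * (if (t : ℕ∞) ≤ (x.2 : h.Time) then A.indicator (fun _ => (1 : ℝ)) x.1 else 0) -
          P.real A * (Z₁ x * (if (t : ℕ∞) ≤ (x.2 : h.Time) then 1 else 0)))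
      split_ifs <;> ring
    have h2 : ∀ k : ℝ, δ ≤ (L (0 + K (-c)) - L X) +
        k * (L (bddPay h hAm hAb) - P.real A * L (K 1)) := fun k => by
      have h3 := hLsep _ (hmem k)
      rw [hLadd, hval] at h3
      linarith
    have h4 := eq_zero_of_forall_le_add_mul h2
    rw [← hκ, hL] at h4
    exact sub_eq_zero.1 h4
  refine ⟨fun x => Z₁ x / κ, hZ₁m.div_const κ, fun x => div_nonneg (hZ₁0 x) hκ0.le,
    hZ₁i.div_const κ, fun s ω hs => ?_, fun A hA => ?_, fun Y hY => ?_⟩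
  · have : uncurryProc F (payFrom (h := h) t fun _ => (1 : ℝ)) (optMk F s ω) = 0 :=
      if_neg (not_le.2 hs)
    change Z₁ (optMk F s ω) / κ = 0
    rw [hZ₁, this, mul_zero, zero_div]
  · simp only [div_mul_eq_mul_div]
    rw [integral_div, hLA A hA, mul_div_cancel_right₀ _ hκ0.ne']
  -- Lowering an accepted position by the constant `c` from `t` on gives expected risk at most `c`;
  -- the mass of the normalized density turns this constant back into `c`.
  · have hmem : Y + K (-c) ∈ riskSet F P t ρ c := by
      change ∫ ω, _ ∂P ≤ c
      rw [integral_risk_add_bddPay hρ]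
      have h1 : ∫ ω, ρ (toProc t (Y : OptSpace h F → ℝ)) ω ∂P ≤ 0 := integral_nonpos_of_ae hY.nonpos
      simp only [integral_const, probReal_univ, smul_eq_mul, one_mul]
      linarith
    have h1 := hLsep _ hmem
    rw [hLadd, hLK] at h1
    simp only [div_mul_eq_mul_div]
    rw [integral_div, integral_div, ← hL, ← hL, ← sub_div, le_div_iff₀ hκ0]
    linarith

end ProcessRisk

namespace ProcessRisk

/-! Models attached to normalized optional densities -/

open scoped ENNReal NNReal

variable {h : Horizon} {Ω : Type*} {mΩ : MeasurableSpace Ω} {F : Filtration ℕ mΩ}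
  {P Q : Measure Ω} {t : ℕ} {ρ : (h.Time → Ω → ℝ) → Ω → ℝ}

theorem lintegral_mul_eq_of_setLIntegral_eq {m : MeasurableSpace Ω} (hm : m ≤ mΩ)
    {f g : Ω → ℝ≥0∞} (hf : Measurable[mΩ] f) (hg : Measurable[mΩ] g)
    (hfg : ∀ A, MeasurableSet[m] A → ∫⁻ ω in A, f ω ∂Q = ∫⁻ ω in A, g ω ∂P)
    {k : Ω → ℝ≥0∞} (hk : Measurable[m] k) :
    ∫⁻ ω, k ω * f ω ∂Q = ∫⁻ ω, k ω * g ω ∂P := by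
  have h1 : (Q.withDensity f).trim hm = (P.withDensity g).trim hm := by
    refine @Measure.ext _ m _ _ fun B hB => ?_
    rw [trim_measurableSet_eq _ hB, trim_measurableSet_eq _ hB,
      withDensity_apply _ (hm B hB), withDensity_apply _ (hm B hB), hfg B hB]
  have h2 := congrArg (fun ν => @lintegral _ m ν k) h1
  simp only [lintegral_trim hm hk] at h2
  have hk' : Measurable[mΩ] k := hk.mono hm le_rfl
  rw [lintegral_withDensity_eq_lintegral_mul _ hf hk',
    lintegral_withDensity_eq_lintegral_mul _ hg hk'] at h2
  simpa only [Pi.mul_apply, mul_comm] using h2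

theorem tsum_time {g : ℕ∞ → ℝ≥0∞} (hg : ∀ s ∉ h.times, g s = 0) :
    ∑' s : h.Time, g s = ∑' n : ℕ, g n + g ⊤ := by
  have h1 : ∑' s : h.Time, g s = ∑' s : ℕ∞, g s :=
    tsum_subtype_eq_of_support_subset (s := h.times) fun s hs => by
      by_contra h'
      exact hs (hg s h')
  rw [h1]
  exact (hasSum_enat (g := g) ENNReal.summable.hasSum).tsum_eq

theorem tsum_nat_split (g : ℕ∞ → ℝ≥0∞) (t : ℕ) :
    ∑' n : ℕ, g n = ∑ j ∈ Finset.range t, g j + ∑' n : ℕ, if (t : ℕ∞) ≤ (n : ℕ∞) then g n else 0 := by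
  have h1 : ∑ j ∈ Finset.range t, (if (t : ℕ∞) ≤ ((j : ℕ) : ℕ∞) then g j else 0) = 0 :=
    Finset.sum_eq_zero fun j hj => if_neg (by
      exact_mod_cast not_le.2 (Finset.mem_range.1 hj))
  have h2 := Summable.sum_add_tsum_nat_add' (f := fun n : ℕ => g n) (k := t) ENNReal.summable
  have h3 := Summable.sum_add_tsum_nat_add' (f := fun n : ℕ =>
    if (t : ℕ∞) ≤ (n : ℕ∞) then g n else 0) (k := t) ENNReal.summable
  rw [h1, zero_add] at h3
  rw [← h2, ← h3]
  congr 1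
  refine tsum_congr fun n => (if_pos ?_).symm
  exact_mod_cast Nat.le_add_left t n

/-- The sum over `𝕋` splits into the times before `t` and the times from `t` on. -/
theorem tsum_time_split {g : ℕ∞ → ℝ≥0∞} (hg : ∀ s ∉ h.times, g s = 0) (t : ℕ) :
    ∑' s : h.Time, g s = ∑ j ∈ Finset.range t, g j +
      ∑' s : h.Time, if (t : ℕ∞) ≤ s then g s else 0 := by
  rw [tsum_time hg, tsum_time (g := fun s => if (t : ℕ∞) ≤ s then g s else 0)
    (fun s hs => by simp [hg s hs]), tsum_nat_split g t, add_assoc]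
  simp

/-- Makes agreement on the time-`t` field checkable: an event is determined by its sections before
`t` and one common `F_t`-measurable section from `t` on. -/
theorem exists_section_of_measurableSet_optionalFieldAt {B : Set (Ω × h.Time)}
    (hB : MeasurableSet[optionalFieldAt h F t] B) :
    ∃ A, MeasurableSet[F t] A ∧ ∀ s : h.Time, (t : ℕ∞) ≤ s → optMk F s ⁻¹' B = A := by
  classical
  refine MeasurableSpace.generateFrom_induction _
    (fun B _ => ∃ A, MeasurableSet[F t] A ∧ ∀ s : h.Time, (t : ℕ∞) ≤ s → optMk F s ⁻¹' B = A)
    ?_ ?_ ?_ ?_ B hB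
  · rintro B (⟨j, A, hj, -, rfl⟩ | ⟨A, hA, rfl⟩) -
    · refine ⟨∅, @MeasurableSet.empty _ (F t), fun s hs => ?_⟩
      rw [preimage_optMk_prod, if_neg]
      rintro rfl
      exact absurd hs (not_le.2 hj)
    · exact ⟨A, hA, fun s hs => Set.ext fun ω => ⟨fun hω => hω.1, fun hω => ⟨hω, hs⟩⟩⟩
  · exact ⟨∅, @MeasurableSet.empty _ (F t), fun s _ => rfl⟩
  · rintro B - ⟨A, hA, h1⟩
    exact ⟨Aᶜ, hA.compl, fun s hs => by rw [Set.preimage_compl, h1 s hs]⟩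
  · rintro B - h1
    choose A hA h1 using h1
    refine ⟨⋃ n, A n, MeasurableSet.iUnion hA, fun s hs => ?_⟩
    rw [Set.preimage_iUnion]
    exact Set.iUnion_congr fun n => h1 n s hs

theorem optionalFieldAt_le (h : Horizon) (F : Filtration ℕ mΩ) (t : ℕ) :
    optionalFieldAt h F t ≤ optionalField h F := by
  refine MeasurableSpace.generateFrom_le ?_
  rintro B (⟨j, A, -, hA, rfl⟩ | ⟨A, hA, rfl⟩)
  · exact MeasurableSpace.measurableSet_generateFrom ⟨j, A, hA, rfl⟩
  · have h1 : A ×ˢ {s : h.Time | (t : ℕ∞) ≤ s} =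
        ⋃ s : {s : h.Time // (t : ℕ∞) ≤ s}, A ×ˢ {s.1} := by
      ext ⟨ω, s⟩
      refine Iff.trans ?_ Set.mem_iUnion.symm
      constructor
      · exact fun h' => ⟨⟨s, h'.2⟩, h'.1, rfl⟩
      · rintro ⟨⟨r, hr⟩, h1, h2⟩
        have h3 : s = r := h2
        exact ⟨h1, h3 ▸ hr⟩
    rw [h1]
    exact @MeasurableSet.iUnion _ _ (optionalField h F) _ _ fun s =>
      MeasurableSpace.measurableSet_generateFrom
        ⟨s.1, A, sig_coe_le_of_le s.2 _ hA, rfl⟩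

/-- The mass that the reference process puts on `𝕋_t`, as an `F_t`-measurable random variable. -/
noncomputable def restMass (μ : h.Time → Ω → ℝ) (t : ℕ) (ω : Ω) : ℝ≥0 :=
  (1 - ∑ j ∈ Finset.range t, extend μ (j : ℕ∞) ω).toNNReal

/-- The optional density that coincides with the reference process before `t` and is given by `z`
from `t` on. -/
noncomputable def pasteDensity (μ z : h.Time → Ω → ℝ) (t : ℕ) (s : ℕ∞) (ω : Ω) : ℝ≥0 :=
  if (t : ℕ∞) ≤ s then restMass μ t ω * ((extend μ s ω).toNNReal * (extend z s ω).toNNReal)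
  else (extend μ s ω).toNNReal

theorem measurable_extend_of_isAdapted {X : h.Time → Ω → ℝ} (hX : IsAdapted F X) (s : ℕ∞) :
    Measurable[sig F s] (extend X s) := by
  by_cases hs : s ∈ h.times
  · rw [show extend X s = X ⟨s, hs⟩ from funext fun ω => extend_of_mem X hs ω]
    exact hX ⟨s, hs⟩
  · rw [show extend X s = fun _ => 0 from funext fun ω => extend_of_notMem X hs ω]
    exact measurable_const

/-- Nonnegative densities with respect to `P ⊗ μ` that vanish before `t` and are normalized
on `F_t`. -/
structure IsNormalizedDensity (F : Filtration ℕ mΩ) (P : Measure Ω) (μ : h.Time → Ω → ℝ) (t : ℕ)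
    (z : h.Time → Ω → ℝ) : Prop where
  adapted : IsAdapted F z
  nonneg : ∀ s ω, 0 ≤ z s ω
  null_before : ∀ (s : h.Time) ω, (s : ℕ∞) < t → z s ω = 0
  normalized : ∀ A, MeasurableSet[F t] A →
    ∑' s : h.Time, ∫⁻ ω in A, ENNReal.ofReal (μ s ω) * ENNReal.ofReal (z s ω) ∂P = P A

namespace IsReference

variable {μ : h.Time → Ω → ℝ}

theorem measurable_restMass (hμ : IsReference F P μ) : Measurable[F t] (restMass μ t) := by
  refine Measurable.real_toNNReal (measurable_const.sub ?_)
  exact Finset.measurable_fun_sum _ fun j hj => (measurable_extend_of_isAdapted hμ.adapted j).mono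
    (F.mono (Finset.mem_range.1 hj).le) le_rfl

theorem ae_split (hμ : IsReference F P μ) : ∀ᵐ ω ∂P,
    ∑ j ∈ Finset.range t, ((extend μ j ω).toNNReal : ℝ≥0∞) + restMass μ t ω = 1 ∧
    (restMass μ t ω : ℝ≥0∞) = ∑' s : h.Time, if (t : ℕ∞) ≤ s then ENNReal.ofReal (μ s ω) else 0 := by
  filter_upwards [hμ.pos, hμ.sum_one] with ω h0 h1
  have hext : ∀ s, 0 ≤ extend μ s ω := fun s => by
    by_cases hs : s ∈ h.times
    · rw [extend_of_mem μ hs]; exact (h0 _).le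
    · rw [extend_of_notMem μ hs]
  have hval : ∀ s : h.Time, extend μ s ω = μ s ω := fun s => extend_of_mem μ s.2 ω
  have h2 : ∑' s : h.Time, ((extend μ s ω).toNNReal : ℝ≥0∞) = 1 := by
    have h3 := ENNReal.ofReal_tsum_of_nonneg (fun s => (h0 s).le) h1.summable
    rw [h1.tsum_eq, ENNReal.ofReal_one] at h3
    rw [h3]
    exact tsum_congr fun s => by rw [hval]; rfl
  rw [tsum_time_split (g := fun s => ((extend μ s ω).toNNReal : ℝ≥0∞))
    (fun s hs => by rw [extend_of_notMem μ hs]; simp) t] at h2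
  have h4 : ∑ j ∈ Finset.range t, ((extend μ j ω).toNNReal : ℝ≥0∞) =
      ENNReal.ofReal (∑ j ∈ Finset.range t, extend μ j ω) := by
    rw [ENNReal.ofReal_sum_of_nonneg (f := fun j : ℕ => extend μ j ω) fun j _ => hext j]
    rfl
  have h5 : ∑ j ∈ Finset.range t, extend μ j ω ≤ 1 := by
    rw [← ENNReal.ofReal_le_one, ← h4, ← h2]
    exact le_self_add
  have h6 : ∑ j ∈ Finset.range t, ((extend μ j ω).toNNReal : ℝ≥0∞) + restMass μ t ω = 1 := by
    rw [h4]
    change _ + ENNReal.ofReal (1 - ∑ j ∈ Finset.range t, extend μ j ω) = 1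
    rw [← ENNReal.ofReal_add (Finset.sum_nonneg fun j _ => hext _) (sub_nonneg.2 h5)]
    simp
  refine ⟨h6, ?_⟩
  have h7 := (ENNReal.add_right_inj (by rw [h4]; exact ENNReal.ofReal_ne_top)).1 (h6.trans h2.symm)
  rw [h7]
  exact tsum_congr fun s => by rw [hval]; rfl

theorem ae_restMass_pos (hμ : IsReference F P μ) (ht : (t : ℕ∞) ∈ h.times) :
    ∀ᵐ ω ∂P, 0 < restMass μ t ω := by
  filter_upwards [hμ.pos, hμ.ae_split (t := t)] with ω h0 h1
  have h2 : (0 : ℝ≥0∞) < restMass μ t ω := by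
    rw [h1.2]
    refine lt_of_lt_of_le (ENNReal.ofReal_pos.2 (h0 ⟨t, ht⟩)) ?_
    refine le_trans (le_of_eq ?_) (ENNReal.le_tsum ⟨t, ht⟩)
    exact (if_pos le_rfl).symm
  exact_mod_cast h2

end IsReference

namespace IsNormalizedDensity

variable {μ z : h.Time → Ω → ℝ}

theorem pasteDensity_of_notMem {s : ℕ∞} (hs : s ∉ h.times) (ω : Ω) :
    pasteDensity μ z t s ω = 0 := by
  simp [pasteDensity, extend_of_notMem μ hs]

theorem pasteDensity_of_le {s : h.Time} (hs : (t : ℕ∞) ≤ s) (ω : Ω) :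
    (pasteDensity μ z t s ω : ℝ≥0∞) =
      restMass μ t ω * (ENNReal.ofReal (μ s ω) * ENNReal.ofReal (z s ω)) := by
  simp only [pasteDensity, if_pos hs, extend_of_mem μ s.2, extend_of_mem z s.2]
  push_cast
  rfl

theorem pasteDensity_of_lt {s : ℕ∞} (hs : s < t) (ω : Ω) :
    pasteDensity μ z t s ω = (extend μ s ω).toNNReal := if_neg (not_le.2 hs)

theorem measurable_pasteDensity (hμ : IsReference F P μ) (hz : IsNormalizedDensity F P μ t z)
    (s : ℕ∞) : Measurable[sig F s] (pasteDensity μ z t s) := by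
  by_cases hs : (t : ℕ∞) ≤ s
  · rw [show pasteDensity μ z t s = fun ω => restMass μ t ω *
      ((extend μ s ω).toNNReal * (extend z s ω).toNNReal) from funext fun ω => if_pos hs]
    exact (hμ.measurable_restMass.mono (sig_coe_le_of_le hs) le_rfl).mul
      ((measurable_extend_of_isAdapted hμ.adapted s).real_toNNReal.mul
        (measurable_extend_of_isAdapted hz.adapted s).real_toNNReal)
  · rw [show pasteDensity μ z t s = fun ω => (extend μ s ω).toNNReal from
      funext fun ω => if_neg hs]
    exact (measurable_extend_of_isAdapted hμ.adapted s).real_toNNReal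

/-- The normalization says that `∑ μ_s z_s` has conditional expectation one given `F_t`, so
`F_t`-measurable factors integrate as if it were one. -/
theorem lintegral_mul_sum (hμ : IsReference F P μ) (hz : IsNormalizedDensity F P μ t z)
    {k : Ω → ℝ≥0∞} (hk : Measurable[F t] k) :
    ∫⁻ ω, k ω * ∑' s : h.Time, ENNReal.ofReal (μ s ω) * ENNReal.ofReal (z s ω) ∂P =
      ∫⁻ ω, k ω ∂P := by
  have hm : ∀ s : h.Time, Measurable fun ω => ENNReal.ofReal (μ s ω) * ENNReal.ofReal (z s ω) :=
    fun s => ((hμ.adapted s).mono (sig_le F s) le_rfl).ennreal_ofReal.mul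
      ((hz.adapted s).mono (sig_le F s) le_rfl).ennreal_ofReal
  have h1 := lintegral_mul_eq_of_setLIntegral_eq (P := P) (Q := P) (F.le t)
    (f := fun ω => ∑' s : h.Time, ENNReal.ofReal (μ s ω) * ENNReal.ofReal (z s ω))
    (g := fun _ => 1) (Measurable.tsum hm) measurable_const (fun A hA => by
      rw [lintegral_tsum fun s => (hm s).aemeasurable, hz.normalized A hA, setLIntegral_const,
        one_mul]) hk
  simpa only [mul_one] using h1

/-- The pasted density puts the same mass on `A × 𝕋_t` as the reference process. -/
theorem tsum_setLIntegral_pasteDensity (hμ : IsReference F P μ)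
    (hz : IsNormalizedDensity F P μ t z) {A : Set Ω} (hA : MeasurableSet[F t] A) :
    ∑' s : h.Time, (if (t : ℕ∞) ≤ s then ∫⁻ ω in A, (pasteDensity μ z t s ω : ℝ≥0∞) ∂P else 0) =
      ∫⁻ ω in A, (restMass μ t ω : ℝ≥0∞) ∂P := by
  have hAm := F.le t A hA
  have hV : Measurable fun ω => (restMass μ t ω : ℝ≥0∞) :=
    (hμ.measurable_restMass.mono (F.le t) le_rfl).coe_nnreal_ennreal
  have hm : ∀ s : h.Time, Measurable fun ω => (restMass μ t ω : ℝ≥0∞) *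
      (ENNReal.ofReal (μ s ω) * ENNReal.ofReal (z s ω)) :=
    fun s => hV.mul (((hμ.adapted s).mono (sig_le F s) le_rfl).ennreal_ofReal.mul
      ((hz.adapted s).mono (sig_le F s) le_rfl).ennreal_ofReal)
  have h1 := hz.lintegral_mul_sum hμ
    (k := A.indicator fun ω => (restMass μ t ω : ℝ≥0∞))
    (hμ.measurable_restMass.coe_nnreal_ennreal.indicator hA)
  rw [lintegral_indicator hAm] at h1
  rw [← h1]
  have h2 : ∀ ω, A.indicator (fun ω => (restMass μ t ω : ℝ≥0∞)) ω *
      ∑' s : h.Time, ENNReal.ofReal (μ s ω) * ENNReal.ofReal (z s ω) =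
      A.indicator (fun ω => ∑' s : h.Time, (restMass μ t ω : ℝ≥0∞) *
        (ENNReal.ofReal (μ s ω) * ENNReal.ofReal (z s ω))) ω := fun ω => by
    by_cases hω : ω ∈ A
    · simp only [Set.indicator_of_mem hω, ENNReal.tsum_mul_left]
    · simp only [Set.indicator_of_notMem hω, zero_mul]
  rw [lintegral_congr h2, lintegral_indicator hAm, lintegral_tsum fun s => (hm s).aemeasurable]
  refine tsum_congr fun s => ?_
  split_ifs with hs
  · exact lintegral_congr fun ω => pasteDensity_of_le hs ω
  · simp [hz.null_before s _ (not_le.1 hs)]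

/-- Before `t` the mass is that of `μ`; from `t` on it is `restMass` times a sum of conditional
expectation one. Together this is the normalization required by `IsOptionalDensity.agreeOn`. -/
theorem setLIntegral_tailSum (hμ : IsReference F P μ) (hz : IsNormalizedDensity F P μ t z)
    {A : Set Ω} (hA : MeasurableSet[F t] A) :
    ∫⁻ ω in A, tailSum (pasteDensity μ z t) 0 ω ∂P = P A := by
  have hm : ∀ s : ℕ∞, Measurable fun ω => (pasteDensity μ z t s ω : ℝ≥0∞) := fun s =>
    ((measurable_pasteDensity hμ hz s).mono (sig_le F s) le_rfl).coe_nnreal_ennreal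
  have h1 : ∀ ω, tailSum (pasteDensity μ z t) 0 ω =
      ∑ j ∈ Finset.range t, ((extend μ j ω).toNNReal : ℝ≥0∞) +
        ∑' s : h.Time, if (t : ℕ∞) ≤ s then (pasteDensity μ z t s ω : ℝ≥0∞) else 0 := by
    intro ω
    have h2 : ∀ s ∉ h.times, (pasteDensity μ z t s ω : ℝ≥0∞) = 0 := fun s hs => by
      rw [pasteDensity_of_notMem hs, ENNReal.coe_zero]
    have h3 : tailSum (pasteDensity μ z t) 0 ω =
        ∑' s : h.Time, (pasteDensity μ z t s ω : ℝ≥0∞) := (tsum_time h2).symm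
    rw [h3, tsum_time_split h2 t]
    congr 1
    refine Finset.sum_congr rfl fun j hj => ?_
    rw [pasteDensity_of_lt (by exact_mod_cast Finset.mem_range.1 hj)]
  have hm2 : ∀ s : h.Time, Measurable fun ω =>
      if (t : ℕ∞) ≤ s then (pasteDensity μ z t s ω : ℝ≥0∞) else 0 := fun s => by
    split_ifs
    exacts [hm s, measurable_const]
  have hm3 : Measurable fun ω => ∑ j ∈ Finset.range t, ((extend μ j ω).toNNReal : ℝ≥0∞) :=
    Finset.measurable_fun_sum _ fun j _ => ((measurable_extend_of_isAdapted hμ.adapted j).mono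
      (sig_le F j) le_rfl).real_toNNReal.coe_nnreal_ennreal
  simp only [h1]
  rw [lintegral_add_left hm3, lintegral_tsum fun s => (hm2 s).aemeasurable]
  have h4 : ∀ s : h.Time, ∫⁻ ω in A, (if (t : ℕ∞) ≤ s then (pasteDensity μ z t s ω : ℝ≥0∞) else 0)
      ∂P = if (t : ℕ∞) ≤ s then ∫⁻ ω in A, (pasteDensity μ z t s ω : ℝ≥0∞) ∂P else 0 := fun s => by
    split_ifs <;> simp
  simp only [h4]
  rw [hz.tsum_setLIntegral_pasteDensity hμ hA, ← lintegral_add_left hm3, ← one_mul (P A),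
    ← setLIntegral_const]
  refine lintegral_congr_ae (ae_restrict_of_ae ?_)
  filter_upwards [hμ.ae_split (t := t)] with ω hω using hω.1

theorem isOptionalDensity [IsProbabilityMeasure P] (hμ : IsReference F P μ)
    (hz : IsNormalizedDensity F P μ t z) : IsOptionalDensity h F P (pasteDensity μ z t) where
  measurable s := measurable_pasteDensity hμ hz s
  null s hs ω := pasteDensity_of_notMem hs ω
  total := by
    have h1 := hz.setLIntegral_tailSum hμ (A := Set.univ) MeasurableSet.univ
    rwa [setLIntegral_univ, measure_univ] at h1

/-- The glued density equals `μ` before `t` and puts mass `restMass` on `A × 𝕋_t`, as `μ` does, for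
`A` in `F_t`. Absolute continuity follows because null events of `P ⊗ μ` have `P`-null sections. -/
theorem mem_modelSet (hμ : IsReference F P μ) (hz : IsNormalizedDensity F P μ t z)
    [IsProbabilityMeasure P] {γ : h.Time → Ω → ℝ}
    (hγ : ∀ (s : h.Time) (A : Set Ω), MeasurableSet[sig F s] A →
      ∫⁻ ω in A, ENNReal.ofReal (γ s ω) ∂Q = ∫⁻ ω in A, (pasteDensity μ z t s ω : ℝ≥0∞) ∂P) :
    otimes F Q γ ∈ modelSet F P μ t := by
  have hprob := hμ.isWeight.isProbabilityMeasure_optMeasure hμ.sum_one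
  have happ : ∀ B : Set (OptSpace h F), MeasurableSet B → optMeasure F Q γ B =
      ∑' s : h.Time, ∫⁻ ω in optMk F s ⁻¹' B, (pasteDensity μ z t s ω : ℝ≥0∞) ∂P := fun B hB => by
    rw [optMeasure_apply hB]
    exact tsum_congr fun s => hγ s _ (measurable_optMk s hB)
  have hagree : ∀ B, MeasurableSet[optionalFieldAt h F t] B →
      optMeasure F Q γ B = optMeasure F P μ B := by
    intro B hB
    have hB' : MeasurableSet[optionalField h F] B := optionalFieldAt_le h F t B hB
    obtain ⟨A, hA, hBA⟩ := exists_section_of_measurableSet_optionalFieldAt hB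
    rw [happ B hB', optMeasure_apply hB']
    have hsplit : ∀ f : h.Time → ℝ≥0∞, ∑' s, f s =
        ∑' s : h.Time, (if (s : ℕ∞) < t then f s else 0) +
          ∑' s : h.Time, (if (t : ℕ∞) ≤ s then f s else 0) := fun f => by
      rw [← ENNReal.tsum_add]
      refine tsum_congr fun s => ?_
      by_cases hs : (t : ℕ∞) ≤ s
      · rw [if_neg (not_lt.2 hs), if_pos hs, zero_add]
      · rw [if_pos (not_le.1 hs), if_neg hs, add_zero]
    rw [hsplit, hsplit (fun s => ∫⁻ ω in optMk F s ⁻¹' B, ENNReal.ofReal (μ s ω) ∂P)]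
    congr 1
    · refine tsum_congr fun s => ?_
      split_ifs with hs
      · refine lintegral_congr fun ω => ?_
        rw [pasteDensity_of_lt hs, extend_of_mem μ s.2]
        rfl
      · rfl
    · have h1 := hz.tsum_setLIntegral_pasteDensity hμ hA
      have h2 : ∫⁻ ω in A, (restMass μ t ω : ℝ≥0∞) ∂P =
          ∑' s : h.Time, if (t : ℕ∞) ≤ s then ∫⁻ ω in A, ENNReal.ofReal (μ s ω) ∂P else 0 := by
        have hm : ∀ s : h.Time, Measurable fun ω =>
            if (t : ℕ∞) ≤ s then ENNReal.ofReal (μ s ω) else 0 := fun s => by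
          split_ifs
          exacts [((hμ.adapted s).mono (sig_le F s) le_rfl).ennreal_ofReal, measurable_const]
        rw [lintegral_congr_ae (ae_restrict_of_ae ((hμ.ae_split (t := t)).mono fun ω hω => hω.2)),
          lintegral_tsum fun s => (hm s).aemeasurable]
        refine tsum_congr fun s => ?_
        split_ifs <;> simp
      rw [h2] at h1
      refine Eq.trans (tsum_congr fun s => ?_) (h1.trans (tsum_congr fun s => ?_))
      · split_ifs with hs
        · rw [hBA s hs]
        · rfl
      · split_ifs with hs
        · rw [hBA s hs]
        · rfl
  refine ⟨?_, ?_, hagree⟩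
  · rw [otimes_eq]
    exact (hagree Set.univ (@MeasurableSet.univ _ (optionalFieldAt h F t))).trans measure_univ
  · rw [otimes_eq, otimes_eq]
    refine @Measure.AbsolutelyContinuous.mk (OptSpace h F) _ _ _ fun B hB h0 => ?_
    rw [happ B hB, ENNReal.tsum_eq_zero]
    intro s
    have h1 := hμ.ae_of_ae_optMeasure (measure_eq_zero_iff_ae_notMem.1 h0) s
    have h2 : P (optMk F s ⁻¹' B) = 0 := measure_eq_zero_iff_ae_notMem.2 h1
    rw [Measure.restrict_eq_zero.2 h2, lintegral_zero_measure]

/-- The normalized weights of the pasted model have density `z`. -/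
theorem optMeasure_condWeight (hμ : IsReference F P μ) (hz : IsNormalizedDensity F P μ t z)
    {γ : h.Time → Ω → ℝ} (hγm : ∀ s, Measurable (γ s))
    (hγ : ∀ (s : h.Time) (A : Set Ω), MeasurableSet[sig F s] A →
      ∫⁻ ω in A, ENNReal.ofReal (γ s ω) ∂Q = ∫⁻ ω in A, (pasteDensity μ z t s ω : ℝ≥0∞) ∂P)
    (hpos : ∀ᵐ ω ∂P, 0 < restMass μ t ω)
    (hdisc : ∀ᵐ ω ∂Q, discount γ t ω = restMass μ t ω) (hposQ : ∀ᵐ ω ∂Q, 0 < restMass μ t ω) :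
    optMeasure F Q (condWeight γ t) =
      (optMeasure F P μ).withDensity fun x => ENNReal.ofReal (uncurryProc F z x) := by
  refine Measure.ext fun B hB => ?_
  have hzm : Measurable fun x => ENNReal.ofReal (uncurryProc F z x) :=
    (measurable_uncurryProc hz.adapted).ennreal_ofReal
  rw [optMeasure_apply hB, withDensity_apply _ hB, ← lintegral_indicator hB,
    lintegral_optMeasure hμ.isWeight.measurable (hzm.indicator hB)]
  refine tsum_congr fun s => ?_
  have hBs : MeasurableSet[sig F s] (optMk F s ⁻¹' B) := measurable_optMk s hB
  have hBm := sig_le F s _ hBs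
  by_cases hs : (t : ℕ∞) ≤ s
  · have hk : Measurable[sig F s] ((optMk F s ⁻¹' B).indicator
        fun ω => (restMass μ t ω : ℝ≥0∞)⁻¹) :=
      (((hμ.measurable_restMass.mono (sig_coe_le_of_le hs) le_rfl).coe_nnreal_ennreal).inv).indicator
        hBs
    have hpm : Measurable fun ω => (pasteDensity μ z t s ω : ℝ≥0∞) :=
      ((measurable_pasteDensity hμ hz s).mono (sig_le F s) le_rfl).coe_nnreal_ennreal
    have h1 := lintegral_mul_eq_of_setLIntegral_eq (sig_le F s) (hγm s).ennreal_ofReal hpm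
      (hγ s) hk
    have h2 : ∫⁻ ω in optMk F s ⁻¹' B, ENNReal.ofReal (condWeight γ t s ω) ∂Q =
        ∫⁻ ω, (optMk F s ⁻¹' B).indicator (fun ω => (restMass μ t ω : ℝ≥0∞)⁻¹) ω *
          ENNReal.ofReal (γ s ω) ∂Q := by
      rw [← lintegral_indicator hBm]
      refine lintegral_congr_ae ?_
      filter_upwards [hdisc, hposQ] with ω h3 h4
      by_cases hω : ω ∈ optMk F s ⁻¹' B
      · simp only [Set.indicator_of_mem hω, condWeight, if_pos hs, h3]
        rw [ENNReal.ofReal_div_of_pos (by exact_mod_cast h4), ENNReal.ofReal_coe_nnreal,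
          ENNReal.div_eq_inv_mul]
      · simp only [Set.indicator_of_notMem hω, zero_mul]
    rw [h2, h1]
    refine lintegral_congr_ae ?_
    filter_upwards [hpos] with ω h5
    by_cases hω : ω ∈ optMk F s ⁻¹' B
    · have hω' : optMk F s ω ∈ B := hω
      rw [Set.indicator_of_mem hω, Set.indicator_of_mem hω', pasteDensity_of_le hs, ← mul_assoc,
        ENNReal.inv_mul_cancel (by exact_mod_cast h5.ne') ENNReal.coe_ne_top, one_mul]
      rfl
    · have hω' : optMk F s ω ∉ B := hω
      rw [Set.indicator_of_notMem hω, Set.indicator_of_notMem hω', zero_mul, mul_zero]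
  · have h1 : ∀ ω, condWeight γ t s ω = 0 := fun ω => if_neg hs
    have h2 : ∀ ω, B.indicator (fun x => ENNReal.ofReal (uncurryProc F z x)) (optMk F s ω) = 0 :=
      fun ω => by
        have h3 : ENNReal.ofReal (uncurryProc F z (optMk F s ω)) = 0 := by
          rw [uncurryProc_optMk, hz.null_before s ω (not_le.1 hs), ENNReal.ofReal_zero]
        by_cases hω : optMk F s ω ∈ B
        · rw [Set.indicator_of_mem hω, h3]
        · rw [Set.indicator_of_notMem hω]
    simp only [h1, h2, ENNReal.ofReal_zero, lintegral_zero, mul_zero]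

end IsNormalizedDensity

end ProcessRisk

namespace ProcessRisk

/-! Separating models -/

open scoped ENNReal NNReal

variable {h : Horizon} {Ω : Type*} {mΩ : MeasurableSpace Ω} {F : Filtration ℕ mΩ}
  {P Q : Measure Ω} {t : ℕ} {ρ : (h.Time → Ω → ℝ) → Ω → ℝ}

/-- The function on the product space given by a bounded adapted process. -/
def bddProc {X : h.Time → Ω → ℝ} (hX : IsAdapted F X) (hb : ∃ c : ℝ, ∀ s ω, |X s ω| ≤ c) :
    bddMeas (OptSpace h F) :=
  ⟨uncurryProc F X, measurable_uncurryProc hX, hb.imp fun _ hc _ => hc _ _⟩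

theorem toProc_bddProc {X : h.Time → Ω → ℝ} (hX : IsAdapted F X)
    (hb : ∃ c : ℝ, ∀ s ω, |X s ω| ≤ c) (h0 : ∀ s : h.Time, (s : ℕ∞) < t → X s = 0) :
    toProc t (bddProc hX hb : OptSpace h F → ℝ) = X := by
  funext s ω
  change (if (t : ℕ∞) ≤ s then X s ω else 0) = X s ω
  split_ifs with hs
  · rfl
  · rw [h0 s (not_le.1 hs)]
    rfl

theorem isNormalizedDensity_of_integral [IsProbabilityMeasure P] {μ : h.Time → Ω → ℝ}
    (hμ : IsReference F P μ) {z : OptSpace h F → ℝ} (hz : Measurable z) (hz0 : ∀ x, 0 ≤ z x)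
    (hzi : Integrable z (optMeasure F P μ))
    (hzt : ∀ (s : h.Time) (ω : Ω), (s : ℕ∞) < t → z (optMk F s ω) = 0)
    (hzn : ∀ A, MeasurableSet[F t] A → ∫ x, z x *
      uncurryProc F (payFrom (h := h) t (A.indicator fun _ => (1 : ℝ))) x ∂optMeasure F P μ =
        P.real A) :
    IsNormalizedDensity F P μ t fun s ω => z (optMk F s ω) where
  adapted s := hz.comp (measurable_optMk s)
  nonneg s ω := hz0 _
  null_before := hzt
  normalized A hA := by
    have hI : Measurable[F t] (A.indicator fun _ => (1 : ℝ)) := measurable_const.indicator hA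
    have hgm : Measurable fun x => z x *
        uncurryProc F (payFrom (h := h) t (A.indicator fun _ => (1 : ℝ))) x :=
      hz.mul (measurable_payFrom hI)
    have hind : ∀ x : OptSpace h F,
        0 ≤ uncurryProc F (payFrom (h := h) t (A.indicator fun _ => (1 : ℝ))) x := fun x => by
      change 0 ≤ if (t : ℕ∞) ≤ (x.2 : h.Time) then A.indicator (fun _ => (1 : ℝ)) x.1 else 0
      split_ifs
      · exact Set.indicator_nonneg (fun _ _ => zero_le_one) _
      · exact le_rfl
    have hint : Integrable (fun x => z x *
        uncurryProc F (payFrom (h := h) t (A.indicator fun _ => (1 : ℝ))) x)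
        (optMeasure F P μ) := by
      refine hzi.mul_bdd (c := 1) (measurable_payFrom hI).aestronglyMeasurable
        (.of_forall fun x => ?_)
      rw [Real.norm_of_nonneg (hind x)]
      change (if (t : ℕ∞) ≤ (x.2 : h.Time) then A.indicator (fun _ => (1 : ℝ)) x.1 else 0) ≤ 1
      split_ifs
      · exact Set.indicator_le_self' (fun _ _ => zero_le_one) _
      · exact zero_le_one
    have h1 := ofReal_integral_eq_lintegral_ofReal hint
      (.of_forall fun x => mul_nonneg (hz0 x) (hind x))
    rw [hzn A hA, ofReal_measureReal, lintegral_optMeasure hμ.isWeight.measurable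
      hgm.ennreal_ofReal] at h1
    rw [h1]
    refine tsum_congr fun s => ?_
    rw [← lintegral_indicator (F.le t A hA)]
    refine lintegral_congr fun ω => ?_
    have h2 : uncurryProc F (payFrom (h := h) t (A.indicator fun _ => (1 : ℝ))) (optMk F s ω) =
      if (t : ℕ∞) ≤ s then A.indicator (fun _ => (1 : ℝ)) ω else 0 := rfl
    rw [h2]
    by_cases hs : (t : ℕ∞) ≤ s
    · by_cases hω : ω ∈ A <;> simp [hs, hω]
    · by_cases hω : ω ∈ A <;> simp [hs, hω, hzt s ω (not_le.1 hs)]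

/-- A position of expected risk larger than `c` is separated from the acceptance set by a
model. -/
theorem exists_separating_model [IsProbabilityMeasure P] (hFT : ⨆ s : h.Time, sig F s = mΩ)
    (hstd : h.IsInfinite → IsStandardFiltration F) (ht : (t : ℕ∞) ∈ h.times)
    (hρ : IsProcessRiskMeasure F P t ρ) (hcont : ContinuousFromAbove F P t ρ)
    {μ : h.Time → Ω → ℝ} (hμ : IsReference F P μ) {X : h.Time → Ω → ℝ} (hX : IsRInfty F P t X)
    {c : ℝ} (hc : c < ∫ ω, ρ X ω ∂P) :
    ∃ (Q : Measure Ω) (D : h.Time → Ω → ℝ), IsLocAC h F P Q ∧ AgreeOn (F t) Q P ∧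
      IsDiscounting F P Q D ∧ otimes F Q (ofDiscounting D) ∈ modelSet F P μ t ∧
      (∀ᵐ ω ∂Q, 0 < extend D t ω) ∧
      IsWeight F P Q (condWeight (ofDiscounting D) t) ∧
      ∀ Y, IsAccepted F P t ρ Y → -∫ ω, pair (condWeight (ofDiscounting D) t) Y ω ∂Q ≤
        -∫ ω, pair (condWeight (ofDiscounting D) t) X ω ∂Q - c := by
  obtain ⟨X', hX', hXX', hb, h0⟩ := hX.exists_version
  rw [integral_congr_ae (hρ.congr hX hX' hXX'),
    ← toProc_bddProc hX'.adapted hb h0] at hc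
  obtain ⟨z, hzm, hz0, hzi, hzt, hzn, hsep⟩ := exists_separating_density hρ hcont hμ hc
  have hz := isNormalizedDensity_of_integral hμ hzm hz0 hzi hzt hzn
  obtain ⟨Q, D, hQ, hD, hQD, hQt⟩ := (hz.isOptionalDensity hμ).exists_model hFT hstd
  obtain ⟨hA, hDt⟩ := hQt t ht fun A hA => hz.setLIntegral_tailSum hμ hA
  have hQp := hQ.1
  have hrpos := hμ.ae_restMass_pos ht
  have hrm := hμ.measurable_restMass (t := t)
  have hrposQ : ∀ᵐ ω ∂Q, 0 < restMass μ t ω :=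
    hA.ae_of (measurableSet_lt measurable_const hrm) hrpos
  have hsum : ∀ᵐ ω ∂Q, ∑ j ∈ Finset.range t, ((extend μ (j : ℕ∞) ω).toNNReal : ℝ≥0∞) +
      restMass μ t ω = 1 := by
    refine hA.ae_of ?_ (hμ.ae_split.mono fun ω hω => hω.1)
    have hm : Measurable[F t] fun ω => ∑ j ∈ Finset.range t,
        ((extend μ (j : ℕ∞) ω).toNNReal : ℝ≥0∞) + restMass μ t ω := by
      refine Measurable.add ?_ hrm.coe_nnreal_ennreal
      exact Finset.measurable_fun_sum _ fun j hj =>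
        (((measurable_extend_of_isAdapted hμ.adapted j).mono
          (F.mono (Finset.mem_range.1 hj).le) le_rfl).real_toNNReal).coe_nnreal_ennreal
    exact hm (measurableSet_singleton 1)
  -- The glued density is `μ` before `t`, so the mass unspent at `t` is the rest mass of the
  -- reference process.
  have hDr : ∀ᵐ ω ∂Q, extend D t ω = restMass μ t ω := by
    filter_upwards [hDt, hsum] with ω h1 h2
    have h3 : ∑ j ∈ Finset.range t, ((extend μ (j : ℕ∞) ω).toNNReal : ℝ) + restMass μ t ω = 1 := by
      rw [← ENNReal.ofNNReal_finsetSum] at h2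
      exact_mod_cast h2
    have h4 : ∑ j ∈ Finset.range t,
        (pasteDensity μ (fun s ω => z (optMk F s ω)) t (j : ℕ∞) ω : ℝ) =
        ∑ j ∈ Finset.range t, ((extend μ (j : ℕ∞) ω).toNNReal : ℝ) :=
      Finset.sum_congr rfl fun j hj => congrArg _
        (IsNormalizedDensity.pasteDensity_of_lt (by exact_mod_cast Finset.mem_range.1 hj) ω)
    rw [h1, h4, ← h3]
    ring
  have hγ := hD.isOptionalRandomMeasure
  have hw := hγ.isWeight hQ t
  have hdisc : ∀ᵐ ω ∂Q, discount (ofDiscounting D) t ω = restMass μ t ω := by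
    filter_upwards [hD.discount_eq t, hDr] with ω h1 h2 using h1.trans h2
  have hdens : optMeasure F Q (condWeight (ofDiscounting D) t) =
      (optMeasure F P μ).withDensity fun x => ENNReal.ofReal (z x) :=
    hz.optMeasure_condWeight hμ hγ.measurable hQD hrpos hdisc hrposQ
  have hpair : ∀ Y : bddMeas (OptSpace h F),
      ∫ x, z x * (Y : OptSpace h F → ℝ) x ∂optMeasure F P μ =
        ∫ ω, pair (condWeight (ofDiscounting D) t)
          (fun s ω => (Y : OptSpace h F → ℝ) (optMk F s ω)) ω ∂Q := fun Y => by
    obtain ⟨b, -, hb⟩ := bddMeas_bounded Y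
    rw [← hw.integral_optMeasure (bddMeas_measurable Y) hb, hdens,
      integral_withDensity_eq_integral_toReal_smul hzm.ennreal_ofReal
        (.of_forall fun x => ENNReal.ofReal_lt_top)]
    refine integral_congr_ae (.of_forall fun x => ?_)
    change _ = (ENNReal.ofReal (z x)).toReal * _
    rw [ENNReal.toReal_ofReal (hz0 x)]
  refine ⟨Q, D, hQ, hA, hD, hz.mem_modelSet hμ hQD, ?_, hw, fun Y hY => ?_⟩
  · filter_upwards [hDr, hrposQ] with ω h1 h2
    rw [h1]
    exact_mod_cast h2
  · obtain ⟨Y', hY', hYY', hYb, hY0⟩ := hY.isRInfty.exists_version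
    have h1 := hsep (bddProc hY'.adapted hYb) (by
      rw [toProc_bddProc hY'.adapted hYb hY0]
      exact hY.congr hρ hY'.adapted hYY')
    rw [hpair, hpair] at h1
    rw [integral_congr_ae (hw.pair_congr hY.isRInfty.adapted hY'.adapted hYY'),
      integral_congr_ae (hw.pair_congr hX.adapted hX'.adapted hXX')]
    change c ≤ ∫ ω, pair _ Y' ω ∂Q - ∫ ω, pair _ X' ω ∂Q at h1
    linarith

end ProcessRisk

namespace ProcessRisk

/-! Cash additivity and discounting -/

open scoped ENNReal NNReal

variable {h : Horizon} {Ω : Type*} {mΩ : MeasurableSpace Ω} {F : Filtration ℕ mΩ}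
  {P Q : Measure Ω} {t : ℕ} {ρ : (h.Time → Ω → ℝ) → Ω → ℝ}

theorem nonpos_of_forall_nat_mul_le {a : ℝ} {b : EReal} (hb : b < ⊤)
    (H : ∀ n : ℕ, ((n * a : ℝ) : EReal) ≤ b) : a ≤ 0 := by
  induction b with
  | bot => exact absurd (H 0) (not_le.2 (EReal.bot_lt_coe _))
  | top => exact absurd hb (lt_irrefl _)
  | coe b =>
    by_contra ha
    push Not at ha
    obtain ⟨n, hn⟩ := exists_nat_gt (b / a)
    rw [div_lt_iff₀ ha] at hn
    exact absurd (EReal.coe_le_coe_iff.1 (H n)) (not_le.2 hn)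

/-- Postponing a deterministic payment from `t` to `s` is free of risk under cash additivity. -/
theorem CashAdditiveAt.isAccepted_postpone {s : h.Time} (hts : (t : ℕ∞) ≤ s)
    (hρ : IsProcessRiskMeasure F P t ρ) (hca : CashAdditiveAt F P t ρ s) (a : ℝ) :
    IsAccepted F P t ρ fun r ω => payFrom t (fun _ => -a) r ω + payFrom s (fun _ => a) r ω where
  isRInfty := (IsRInfty.payFrom (isLInfty_const _ P _) le_rfl).add
    (IsRInfty.payFrom (isLInfty_const _ P _) hts)
  nonpos := by
    filter_upwards [hca _ (IsRInfty.payFrom (isLInfty_const (F t) P (-a)) le_rfl) _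
      (isLInfty_const (F t) P a), hρ.payFrom_eq (isLInfty_const (F t) P (-a))] with ω h1 h2
    rw [h1, h2]
    simp

/-- The normalized weights have mass `D_t / D_t` from `t` on and `D_s / D_t` from `s` on. Both are
zero where `D_t = 0`, so no positivity is needed. -/
theorem IsDiscounting.pair_postpone {D : h.Time → Ω → ℝ} (hD : IsDiscounting F P Q D) {s : h.Time}
    (hts : (t : ℕ∞) ≤ s) (a : ℝ) : ∀ᵐ ω ∂Q, -pair (condWeight (ofDiscounting D) t)
      (fun r ω => payFrom t (fun _ => -a) r ω + payFrom s (fun _ => a) r ω) ω =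
        a * ((extend D t ω - extend D s ω) / extend D t ω) := by
  filter_upwards [hD.hasSum_tail, hD.discount_eq t] with ω h1 h2
  have h3 := ((h1 t).mul_left (-(a / extend D t ω))).add ((h1 s).mul_left (a / extend D t ω))
  rw [pair, HasSum.tsum_eq (h3.congr_fun fun r => ?_)]
  · ring
  · unfold condWeight payFrom
    rw [h2]
    by_cases hr : (t : ℕ∞) ≤ r
    · by_cases hr' : (s : ℕ∞) ≤ r
      · simp only [if_pos hr, if_pos hr']; ring
      · simp only [if_pos hr, if_neg hr']; ring
    · simp only [if_neg hr, if_neg fun hr' => hr (hts.trans hr')]; ring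

/-- Every multiple of a postponed unit payment is accepted, so `n E_Q[R | F_t]` stays below the
finite penalty for all `n`, where `R = (D_t - D_s) / D_t ≥ 0`. Hence `R = 0`, and monotonicity
settles the times between `t` and `s`. -/
theorem CashAdditiveAt.noDiscounting [IsProbabilityMeasure P] {μ : h.Time → Ω → ℝ} {s : h.Time}
    (ht : (t : ℕ∞) ∈ h.times) (hts : (t : ℕ∞) ≤ s)
    (hρ : IsProcessRiskMeasure F P t ρ) (hca : CashAdditiveAt F P t ρ s) :
    NoDiscounting F P μ t ρ s := by
  intro Q D hQ hD _ hpen k htk hks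
  have hQp := hQ.1
  obtain ⟨R, hR⟩ : ∃ R : Ω → ℝ, ∀ ω, R ω = (extend D t ω - extend D s ω) / extend D t ω :=
    ⟨_, fun _ => rfl⟩
  have hext : ∀ r : ℕ∞, Measurable (extend D r) := fun r =>
    (hD.measurable_extend r).mono ((predSig_le_sig F r).trans (sig_le F r)) le_rfl
  have hRm : Measurable R := by
    rw [funext hR]
    exact ((hext _).sub (hext _)).div (hext _)
  have hR01 : ∀ᵐ ω ∂Q, 0 ≤ R ω ∧ R ω ≤ 1 := by
    filter_upwards [hD.nonneg, hD.antitone] with ω h0 ha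
    rw [hR, extend_of_mem D ht, extend_of_mem D s.2]
    have h1 : D s ω ≤ D ⟨t, ht⟩ ω := ha hts
    exact ⟨div_nonneg (sub_nonneg.2 h1) (h0 _),
      div_le_one_of_le₀ (by linarith [h0 s]) (h0 _)⟩
  have hRi : Integrable R Q := Integrable.of_bound hRm.aestronglyMeasurable 1
    (hR01.mono fun ω hω => by rw [Real.norm_of_nonneg hω.1]; exact hω.2)
  have hle : ∀ n : ℕ, ∀ᵐ ω ∂Q, ((n * (Q[R|F t]) ω : ℝ) : EReal) ≤
      penalty F P t ρ Q (ofDiscounting D) ω := by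
    intro n
    have h1 := (isEssSup_penalty (F := F) (P := P) (t := t) (ρ := ρ) (Q := Q)
      (ofDiscounting D)).2.1 _ ⟨_, hca.isAccepted_postpone hts hρ n, rfl⟩
    have h2 : condLoss F t Q (condWeight (ofDiscounting D) t)
        (fun r ω => payFrom t (fun _ => -(n : ℝ)) r ω + payFrom s (fun _ => (n : ℝ)) r ω) =ᵐ[Q]
        (n : ℝ) • Q[R|F t] := by
      refine (condExp_congr_ae (g := (n : ℝ) • R) ?_).trans (condExp_smul _ _ _)
      filter_upwards [hD.pair_postpone hts (n : ℝ)] with ω hω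
      rw [hω, ← hR]
      rfl
    filter_upwards [h1, h2] with ω h3 h4
    rw [h4] at h3
    exact h3
  have hnp : ∀ᵐ ω ∂Q, (Q[R|F t]) ω ≤ 0 := by
    filter_upwards [ae_all_iff.2 hle, hpen] with ω h1 h2 using nonpos_of_forall_nat_mul_le h2 h1
  have hint : ∫ ω, R ω ∂Q ≤ 0 := by
    rw [← integral_condExp (F.le t)]
    exact integral_nonpos_of_ae hnp
  have hzero := (integral_eq_zero_iff_of_nonneg_ae (hR01.mono fun ω hω => hω.1) hRi).1
    (le_antisymm hint (integral_nonneg_of_ae (hR01.mono fun ω hω => hω.1)))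
  filter_upwards [hzero, hD.nonneg, hD.antitone] with ω h1 h0 ha
  have h2 : D k ω ≤ D ⟨t, ht⟩ ω := ha htk
  have h3 : D s ω ≤ D k ω := ha hks
  rw [hR, extend_of_mem D ht, extend_of_mem D s.2, Pi.zero_apply, div_eq_zero_iff] at h1
  rw [extend_of_mem D ht]
  rcases h1 with h1 | h1
  · linarith
  -- Here `D_t = 0`, so `D_k` lies between `0` and `D_t`.
  · linarith [h0 k]

end ProcessRisk

namespace ProcessRisk

/-! Robust representations of cash additive risk measures -/

open scoped ENNReal NNReal

variable {h : Horizon} {Ω : Type*} {mΩ : MeasurableSpace Ω} {F : Filtration ℕ mΩ}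
  {P Q : Measure Ω} {t : ℕ} {ρ : (h.Time → Ω → ℝ) → Ω → ℝ}

namespace IsOptionalRandomMeasureFrom

variable {s : h.Time} {γ X : h.Time → Ω → ℝ}

theorem ae_eq_zero_of_lt (hγ : IsOptionalRandomMeasureFrom F P Q s γ) :
    ∀ᵐ ω ∂Q, ∀ r < s, γ r ω = 0 :=
  ae_all_iff.2 fun r => by
    by_cases hr : r < s
    · exact (hγ.2 r hr).mono fun ω hω _ => hω
    · exact .of_forall fun ω hr' => absurd hr' hr

/-- Weights starting at `s ≥ t` have `D_t = 1`, so the normalization does nothing. -/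
theorem condWeight_eq (hγ : IsOptionalRandomMeasureFrom F P Q s γ) (hts : (t : ℕ∞) ≤ s) :
    ∀ᵐ ω ∂Q, ∀ r, condWeight γ t r ω = γ r ω := by
  filter_upwards [hγ.ae_eq_zero_of_lt, hγ.1.sum_one] with ω h0 h1 r
  have h2 : ∀ r : h.Time, ¬ (t : ℕ∞) ≤ r → γ r ω = 0 := fun r hr =>
    h0 r (show (r : ℕ∞) < s from (not_le.1 hr).trans_le hts)
  have h3 : discount γ t ω = 1 := HasSum.tsum_eq (h1.congr_fun fun r => by
    split_ifs with hr
    · rfl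
    · exact (h2 r hr).symm)
  unfold condWeight
  split_ifs with hr
  · rw [h3, div_one]
  · exact (h2 r hr).symm

theorem hasSum_condWeight (hγ : IsOptionalRandomMeasureFrom F P Q s γ) (hts : (t : ℕ∞) ≤ s) :
    ∀ᵐ ω ∂Q, HasSum (fun r => condWeight γ t r ω) 1 := by
  filter_upwards [hγ.condWeight_eq hts, hγ.1.sum_one] with ω h1 h2
  exact h2.congr_fun h1

theorem hasSum_condWeight_ge (hγ : IsOptionalRandomMeasureFrom F P Q s γ) (hts : (t : ℕ∞) ≤ s)
    {k : ℕ∞} (hk : k ≤ s) :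
    ∀ᵐ ω ∂Q, HasSum (fun r : h.Time => if k ≤ r then condWeight γ t r ω else 0) 1 := by
  filter_upwards [hγ.condWeight_eq hts, hγ.1.sum_one, hγ.ae_eq_zero_of_lt] with ω h1 h2 h3
  refine h2.congr_fun fun r => ?_
  split_ifs with hr
  · exact h1 r
  · exact (h3 r (show (r : ℕ∞) < s from (not_le.1 hr).trans_le hk)).symm

theorem tsum_eq_pair (hγ : IsOptionalRandomMeasureFrom F P Q s γ) (hts : (t : ℕ∞) ≤ s)
    (X : h.Time → Ω → ℝ) :
    ∀ᵐ ω ∂Q, (∑' k : h.Time, if s ≤ k then γ k ω * X k ω else 0) = pair (condWeight γ t) X ω := by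
  filter_upwards [hγ.condWeight_eq hts, hγ.ae_eq_zero_of_lt] with ω h1 h2
  refine tsum_congr fun k => ?_
  rw [h1]
  split_ifs with hk
  · rfl
  · rw [h2 k (not_le.1 hk), zero_mul]

theorem value_ae_eq (hγ : IsOptionalRandomMeasureFrom F P Q s γ) (hA : AgreeOn (F t) Q P)
    (hts : (t : ℕ∞) ≤ s) (X : h.Time → Ω → ℝ) :
    (fun ω => (((Q[fun ω' => -∑' k : h.Time,
        if s ≤ k then γ k ω' * X k ω' else 0 | F t]) ω : ℝ) : EReal) - penalty F P t ρ Q γ ω)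
      =ᵐ[P] fun ω => (condLoss F t Q (condWeight γ t) X ω : EReal) - penalty F P t ρ Q γ ω := by
  have h1 : Q[fun ω' => -∑' k : h.Time, if s ≤ k then γ k ω' * X k ω' else 0 | F t] =ᵐ[Q]
      condLoss F t Q (condWeight γ t) X := condExp_congr_ae (by
    filter_upwards [hγ.tsum_eq_pair hts X] with ω hω
    rw [hω])
  filter_upwards [hA.symm.ae_eq_of_ae_eq stronglyMeasurable_condExp.measurable
    (measurable_condLoss _ _) h1] with ω hω
  rw [hω]

end IsOptionalRandomMeasureFrom

/-- `D_t - D_s = 0` is the sum of the nonnegative weights at the times in `[t, s)`, so each of them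
vanishes. -/
theorem IsDiscounting.ofDiscounting_eq_zero {D : h.Time → Ω → ℝ} (hD : IsDiscounting F P Q D)
    {s : ℕ∞} (hts : (t : ℕ∞) ≤ s) (hst : extend D s =ᵐ[Q] extend D t) :
    ∀ᵐ ω ∂Q, ∀ r : h.Time, (t : ℕ∞) ≤ r → ¬ s ≤ r → ofDiscounting D r ω = 0 := by
  filter_upwards [hD.hasSum_tail, hst, hD.isOptionalRandomMeasure.nonneg] with ω h1 h2 h0 r hr hsr
  have h3 := (h1 t).sub (h1 s)
  rw [h2, sub_self, hasSum_zero_iff_of_nonneg] at h3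
  · have h4 := congrFun h3 r
    simpa only [if_pos hr, if_neg hsr, sub_zero, Pi.zero_apply] using h4
  · intro r
    by_cases hr : s ≤ r
    · simp [hr, hts.trans hr]
    · by_cases hr' : (t : ℕ∞) ≤ r
      · simpa [hr, hr'] using h0 r
      · simp [hr, hr']

/-- Without discounting up to time `s`, separating models can be chosen with weights on `𝕋_s`. -/
theorem NoDiscounting.exists_separating_model [IsProbabilityMeasure P]
    (hFT : ⨆ s : h.Time, sig F s = mΩ)
    (hstd : h.IsInfinite → IsStandardFiltration F) (ht : (t : ℕ∞) ∈ h.times)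
    (hρ : IsProcessRiskMeasure F P t ρ) (hcont : ContinuousFromAbove F P t ρ)
    {μ : h.Time → Ω → ℝ} (hμ : IsReference F P μ) {s : h.Time} (hts : (t : ℕ∞) ≤ s)
    (hs : NoDiscounting F P μ t ρ s) {X : h.Time → Ω → ℝ} (hX : IsRInfty F P t X)
    {c : ℝ} (hc : c < ∫ ω, ρ X ω ∂P) :
    ∃ (Q : Measure Ω) (γ : h.Time → Ω → ℝ), IsLocAC h F P Q ∧ AgreeOn (F t) Q P ∧
      IsOptionalRandomMeasureFrom F P Q s γ ∧
      ∀ Y, IsAccepted F P t ρ Y → -∫ ω, pair (condWeight γ t) Y ω ∂Q ≤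
        -∫ ω, pair (condWeight γ t) X ω ∂Q - c := by
  obtain ⟨Q, D, hQ, hA, hD, hmod, hpos, hw, hsep⟩ :=
    ProcessRisk.exists_separating_model hFT hstd ht hρ hcont hμ hX hc
  have hQp := hQ.1
  -- The separation bounds all expected losses of accepted positions, so the model has finite
  -- penalty and the absence of discounting applies to it.
  have hst : extend D s =ᵐ[Q] extend D t := by
    filter_upwards [hs Q D hQ hD hmod (penalty_lt_top hρ hw hsep) s hts le_rfl] with ω hω
    rw [← hω, extend_of_mem D s.2]
  -- The mass of the model before `t` is discarded and the rest is divided by `D_t`. Since `D_s =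
  -- D_t`, the weights on `𝕋_s` alone sum to one, and the normalized weights are unchanged.
  have hγ := hD.isOptionalRandomMeasure
  obtain ⟨γ', hγ'⟩ : ∃ γ' : h.Time → Ω → ℝ, ∀ r ω, γ' r ω =
      if s ≤ r then ofDiscounting D r ω / extend D t ω else 0 := ⟨_, fun _ _ => rfl⟩
  have hΓ : IsOptionalRandomMeasureFrom F P Q s γ' := by
    refine ⟨⟨fun r => ?_, ?_, ?_, fun r hr => ?_⟩, fun r hr => .of_forall fun ω => ?_⟩
    · rw [funext (hγ' r)]
      by_cases hr : s ≤ r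
      · simp only [if_pos hr]
        exact (hγ.adapted r).div ((hD.measurable_extend t).mono ((predSig_le_sig F t).trans
          (sig_mono F (hts.trans hr))) le_rfl)
      · simp only [if_neg hr]
        exact measurable_const
    · filter_upwards [hγ.nonneg, hpos] with ω h0 h1 r
      rw [hγ']
      split_ifs
      exacts [div_nonneg (h0 r) h1.le, le_rfl]
    · filter_upwards [hD.hasSum_tail, hst, hpos] with ω h1 h2 h3
      have h4 := (h1 s).div_const (extend D t ω)
      rw [h2, div_self h3.ne'] at h4
      refine h4.congr_fun fun r => ?_
      rw [hγ', ite_div, zero_div]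
      rfl
    · filter_upwards [hγ.null_singular r hr] with ω h1 h2
      rw [hγ', h1 h2, zero_div, ite_self]
    · rw [hγ', if_neg (not_le.2 hr)]
      rfl
  have hpair : ∀ Y : h.Time → Ω → ℝ, ∫ ω, pair (condWeight (ofDiscounting D) t) Y ω ∂Q =
      ∫ ω, pair (condWeight γ' t) Y ω ∂Q := fun Y => by
    refine integral_congr_ae ?_
    filter_upwards [hΓ.condWeight_eq hts, hD.ofDiscounting_eq_zero hts hst, hD.discount_eq t]
      with ω h1 h2 h3
    refine tsum_congr fun r => ?_
    rw [h1, hγ']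
    unfold condWeight
    rw [h3]
    by_cases hr : (t : ℕ∞) ≤ r
    · by_cases hr' : s ≤ r
      · rw [if_pos hr, if_pos hr']
      · rw [if_pos hr, if_neg hr', h2 r hr hr', zero_div]
    · rw [if_neg hr, if_neg fun hr' : s ≤ r => hr (hts.trans hr')]
  refine ⟨Q, γ', hQ, hA, hΓ, fun Y hY => ?_⟩
  rw [← hpair, ← hpair]
  exact hsep Y hY

/-- The upper bound holds for any model that agrees with `P` on `F_t`; the lower bound uses
separating models, whose weights can be taken on `𝕋_s`. -/
theorem NoDiscounting.hasRepresentationFrom [IsProbabilityMeasure P]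
    (hFT : ⨆ s : h.Time, sig F s = mΩ)
    (hstd : h.IsInfinite → IsStandardFiltration F) (ht : (t : ℕ∞) ∈ h.times)
    (hρ : IsProcessRiskMeasure F P t ρ) (hcont : ContinuousFromAbove F P t ρ)
    {μ : h.Time → Ω → ℝ} (hμ : IsReference F P μ) {s : h.Time} (hts : (t : ℕ∞) ≤ s)
    (hs : NoDiscounting F P μ t ρ s) : HasRepresentationFrom F P t ρ s := by
  refine fun X hX => ⟨(hρ.mem X hX).1.coe_real_ereal, ?_, fun Z hZ hle => ?_⟩
  · rintro f ⟨Q, γ, hQ, hA, hΓ, rfl⟩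
    have hQp := hQ.1
    exact (hΓ.value_ae_eq hA hts X).le.trans (condLoss_sub_penalty_le hρ hA (hΓ.1.isWeight hQ t)
      (hΓ.hasSum_condWeight hts) hX)
  · refine le_of_forall_exists_model hρ hX hZ fun c hc => ?_
    obtain ⟨Q, γ, hQ, hA, hΓ, hY⟩ := hs.exists_separating_model hFT hstd ht hρ hcont hμ hts hX hc
    exact ⟨Q, γ, hQ.1, hA, hΓ.1.isWeight hQ t, hΓ.hasSum_condWeight hts, hY,
      (hΓ.value_ae_eq hA hts X).symm.le.trans (hle _ ⟨Q, γ, hQ, hA, hΓ, rfl⟩)⟩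

theorem IsEssSup.le_sub {m : MeasurableSpace Ω} {μ : @Measure Ω mΩ} {S S' : Set (Ω → EReal)}
    {f g c : Ω → ℝ} (hS : IsEssSup m μ S fun ω => (f ω : EReal))
    (hS' : IsEssSup m μ S' fun ω => (g ω : EReal)) (hf : Measurable[m] f) (hc : Measurable[m] c)
    (H : ∀ u ∈ S', ∃ v ∈ S, u ≤ᵐ[μ] fun ω => v ω - (c ω : EReal)) :
    g ≤ᵐ[μ] fun ω => f ω - c ω := by
  have hm : Measurable[m] fun ω => f ω - c ω := hf.sub hc
  have h1 := hS'.2.2 (fun ω => ((f ω - c ω : ℝ) : EReal)) hm.coe_real_ereal fun u hu => by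
    obtain ⟨v, hv, huv⟩ := H u hu
    filter_upwards [huv, hS.2.1 v hv] with ω h2 h3
    refine h2.trans ?_
    rw [EReal.coe_sub]
    exact EReal.sub_le_sub h3 le_rfl
  filter_upwards [h1] with ω hω
  exact EReal.coe_le_coe_iff.1 hω

/-- The opposite inequality comes from applying `H` to `X + m 1_{𝕋_s}` and the payment `-m`. -/
theorem cashAdditiveAt_of_le {s : h.Time} (hts : (t : ℕ∞) ≤ s)
    (H : ∀ X, IsRInfty F P t X → ∀ m, IsLInfty (F t) P m →
      ρ (fun r ω => X r ω + payFrom s m r ω) ≤ᵐ[P] fun ω => ρ X ω - m ω) :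
    CashAdditiveAt F P t ρ s := by
  intro X hX m hm
  have h1 := H _ (hX.add (IsRInfty.payFrom hm hts)) _ hm.neg
  have h2 : (fun (r : h.Time) ω => X r ω + payFrom s m r ω + payFrom s (fun ω => -m ω) r ω) =
      X := by
    funext r ω
    unfold payFrom
    split_ifs <;> ring
  rw [h2] at h1
  filter_upwards [H X hX m hm, h1] with ω h3 h4
  linarith

theorem condLoss_add_payFrom_sub [IsFiniteMeasure Q] (hA : AgreeOn (F t) Q P)
    {γ X : h.Time → Ω → ℝ} (hw : IsWeight F P Q (condWeight γ t)) {k : ℕ∞}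
    (hk : ∀ᵐ ω ∂Q, HasSum (fun s : h.Time => if k ≤ s then condWeight γ t s ω else 0) 1)
    (hX : IsRInfty F P t X) {m : Ω → ℝ} (hm : IsLInfty (F t) P m) (p : Ω → EReal) :
    (fun ω => (condLoss F t Q (condWeight γ t) (fun s ω => X s ω + payFrom k m s ω) ω : EReal) -
      p ω) =ᵐ[P] fun ω => (condLoss F t Q (condWeight γ t) X ω : EReal) - p ω - (m ω : EReal) := by
  filter_upwards [condLoss_add_payFrom hA hw hk hX hm] with ω hω
  rw [hω, EReal.coe_sub, sub_eq_add_neg, sub_eq_add_neg, sub_eq_add_neg, sub_eq_add_neg,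
    add_right_comm]

/-- The penalty of a model does not involve `X`, and its weights sum to one on `𝕋_s`. So each term
of the essential supremum drops by exactly `m`. -/
theorem HasRepresentationFrom.cashAdditiveAt [IsProbabilityMeasure P] {s : h.Time}
    (hts : (t : ℕ∞) ≤ s) (hρ : IsProcessRiskMeasure F P t ρ)
    (hs : HasRepresentationFrom F P t ρ s) : CashAdditiveAt F P t ρ s := by
  refine cashAdditiveAt_of_le hts fun X hX m hm => ?_
  refine (hs X hX).le_sub (hs _ (hX.add (IsRInfty.payFrom hm hts))) (hρ.mem X hX).1 hm.1 ?_
  rintro u ⟨Q, γ, hQ, hA, hΓ, rfl⟩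
  have hQp := hQ.1
  refine ⟨_, ⟨Q, γ, hQ, hA, hΓ, rfl⟩, ?_⟩
  refine EventuallyEq.le ?_
  refine (hΓ.value_ae_eq hA hts _).trans ((condLoss_add_payFrom_sub hA (hΓ.1.isWeight hQ t)
    (hΓ.hasSum_condWeight_ge hts le_rfl) hX hm _).trans ?_)
  filter_upwards [hΓ.value_ae_eq (ρ := ρ) hA hts X] with ω hω
  rw [hω]

end ProcessRisk

namespace ProcessRisk

/-! Representations in terms of the terminal value -/

open scoped ENNReal NNReal

variable {h : Horizon} {Ω : Type*} {mΩ : MeasurableSpace Ω} {F : Filtration ℕ mΩ}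
  {P Q : Measure Ω} {t : ℕ} {ρ : (h.Time → Ω → ℝ) → Ω → ℝ} {T : h.Time}

theorem le_sig_of_forall_le (hFT : ⨆ s : h.Time, sig F s = mΩ) (hT : ∀ s : h.Time, s ≤ T) :
    mΩ ≤ sig F T :=
  hFT.symm.le.trans (iSup_le fun s => sig_mono F (hT s))

theorem isLocAC_of_ac [IsProbabilityMeasure Q] (hQ : Q ≪ P) : IsLocAC h F P Q :=
  ⟨inferInstance, fun n _ => hQ.trim (F.le n)⟩

/-- Only the condition at infinity needs an argument: the density process does not explode
`P`-almost surely, hence not `Q`-almost surely when `Q ≪ P`. -/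
theorem isOptionalRandomMeasureFrom_diracAt [IsProbabilityMeasure P] [IsProbabilityMeasure Q]
    (hQ : Q ≪ P) (T : h.Time) : IsOptionalRandomMeasureFrom F P Q T (diracAt T) := by
  refine ⟨⟨fun r => measurable_const, .of_forall fun ω s => ?_, .of_forall fun ω => ?_,
    fun s hs => ?_⟩, fun r hr => .of_forall fun ω => if_neg hr.ne⟩
  · unfold diracAt
    split_ifs
    exacts [zero_le_one, le_rfl]
  · exact hasSum_ite_eq T 1
  · have h1 := hQ (measure_densityLimit_eq_top (F := F) (P := P) (Q := Q)
      fun n => hQ.trim (F.le n))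
    filter_upwards [measure_eq_zero_iff_ae_notMem.1 h1] with ω h2 h3 using absurd h3 h2

namespace IsOptionalRandomMeasureFrom

variable {γ : h.Time → Ω → ℝ}

theorem ae_eq_diracAt (hγ : IsOptionalRandomMeasureFrom F P Q T γ) (hT : ∀ s : h.Time, s ≤ T) :
    ∀ᵐ ω ∂Q, ∀ r, γ r ω = diracAt T r ω := by
  filter_upwards [hγ.ae_eq_zero_of_lt, hγ.1.sum_one] with ω h0 h1 r
  have h2 : ∀ r, r ≠ T → γ r ω = 0 := fun r hr => h0 r (lt_of_le_of_ne (hT r) hr)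
  unfold diracAt
  split_ifs with hr
  · rw [hr, ← (hasSum_single T h2).unique h1]
  · exact h2 r hr

theorem ae_pair_eq (hγ : IsOptionalRandomMeasureFrom F P Q T γ) (hT : ∀ s : h.Time, s ≤ T)
    (ht : (t : ℕ∞) ≤ T) (X : h.Time → Ω → ℝ) :
    pair (condWeight γ t) X =ᵐ[Q] X T := by
  filter_upwards [hγ.condWeight_eq ht, hγ.ae_eq_diracAt hT] with ω h1 h2
  rw [pair, tsum_eq_single T fun r hr => by rw [h1, h2, diracAt, if_neg hr, zero_mul]]
  rw [h1, h2, diracAt, if_pos rfl, one_mul]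

theorem absolutelyContinuous [IsProbabilityMeasure P]
    (hγ : IsOptionalRandomMeasureFrom F P Q T γ) (hQ : IsLocAC h F P Q)
    (hFT : ⨆ s : h.Time, sig F s = mΩ) (hT : ∀ s : h.Time, s ≤ T) : Q ≪ P := by
  refine Measure.AbsolutelyContinuous.mk fun B hB h0 => measure_eq_zero_iff_ae_notMem.2 ?_
  filter_upwards [hγ.1.ae_eq_zero hQ T (le_sig_of_forall_le hFT hT B hB) h0,
    hγ.ae_eq_diracAt hT] with ω h1 h2 hω
  have h3 := h2 T
  rw [h1 hω, diracAt, if_pos rfl] at h3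
  exact zero_ne_one h3

end IsOptionalRandomMeasureFrom

theorem tsum_diracAt (hT : ∀ s : h.Time, s ≤ T) (X : h.Time → Ω → ℝ) (ω : Ω) :
    (∑' k : h.Time, if T ≤ k then diracAt T k ω * X k ω else 0) = X T ω := by
  rw [tsum_eq_single T fun r hr => if_neg fun hr' => hr ((hT r).antisymm hr'), if_pos le_rfl,
    diracAt, if_pos rfl, one_mul]

theorem terminalValue_ae_eq [IsProbabilityMeasure P] [IsProbabilityMeasure Q] (hQ : Q ≪ P)
    (hA : AgreeOn (F t) Q P) (hT : ∀ s : h.Time, s ≤ T) (ht : (t : ℕ∞) ≤ T)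
    (X : h.Time → Ω → ℝ) :
    (fun ω => (((Q[fun ω' => -X T ω' | F t]) ω : ℝ) : EReal)
        - penalty F P t ρ Q (diracAt T) ω) =ᵐ[P]
      fun ω => (condLoss F t Q (condWeight (diracAt T) t) X ω : EReal) -
        penalty F P t ρ Q (diracAt T) ω := by
  have h1 := (isOptionalRandomMeasureFrom_diracAt (F := F) hQ T).value_ae_eq (ρ := ρ) hA ht X
  simp only [tsum_diracAt hT] at h1
  exact h1

theorem NoDiscounting.hasTerminalRepresentation [IsProbabilityMeasure P]
    (hFT : ⨆ s : h.Time, sig F s = mΩ)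
    (hstd : h.IsInfinite → IsStandardFiltration F) (ht : (t : ℕ∞) ∈ h.times)
    (hρ : IsProcessRiskMeasure F P t ρ) (hcont : ContinuousFromAbove F P t ρ)
    {μ : h.Time → Ω → ℝ} (hμ : IsReference F P μ) (hT : ∀ s : h.Time, s ≤ T)
    (hs : NoDiscounting F P μ t ρ T) : HasTerminalRepresentation F P t ρ T := by
  have htT : (t : ℕ∞) ≤ T := hT ⟨t, ht⟩
  refine fun X hX => ⟨(hρ.mem X hX).1.coe_real_ereal, ?_, fun Z hZ hle => ?_⟩
  · rintro f ⟨Q, hQp, hQ, hA, rfl⟩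
    have hΓ := isOptionalRandomMeasureFrom_diracAt (F := F) hQ T
    exact (terminalValue_ae_eq hQ hA hT htT X).le.trans (condLoss_sub_penalty_le hρ hA
      (hΓ.1.isWeight (isLocAC_of_ac hQ) t) (hΓ.hasSum_condWeight htT) hX)
  · refine le_of_forall_exists_model hρ hX hZ fun c hc => ?_
    obtain ⟨Q, γ, hQ, hA, hγ, hY⟩ := hs.exists_separating_model hFT hstd ht hρ hcont hμ htT hX hc
    have hQp := hQ.1
    have hQP := hγ.absolutelyContinuous hQ hFT hT
    have hΓ := isOptionalRandomMeasureFrom_diracAt (F := F) hQP T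
    have hpair : ∀ Y : h.Time → Ω → ℝ, ∫ ω, pair (condWeight (diracAt T) t) Y ω ∂Q =
        ∫ ω, pair (condWeight γ t) Y ω ∂Q := fun Y =>
      integral_congr_ae ((hΓ.ae_pair_eq hT htT Y).trans (hγ.ae_pair_eq hT htT Y).symm)
    refine ⟨Q, diracAt T, hQp, hA, hΓ.1.isWeight hQ t, hΓ.hasSum_condWeight htT, fun Y hYa => ?_,
      (terminalValue_ae_eq hQP hA hT htT X).symm.le.trans (hle _ ⟨Q, hQp, hQP, hA, rfl⟩)⟩
    rw [hpair, hpair]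
    exact hY Y hYa

/-- Needed when `t` is itself the last time: cash additivity is then vacuous, and the terminal
representation has to hold without it. -/
theorem noDiscounting_self {μ : h.Time → Ω → ℝ} {s : h.Time} (hs : (s : ℕ∞) = t) :
    NoDiscounting F P μ t ρ s := by
  intro Q D _ _ _ _ k htk hks
  have hk : (k : ℕ∞) = t := le_antisymm ((show (k : ℕ∞) ≤ s from hks).trans hs.le) htk
  refine .of_forall fun ω => ?_
  rw [← hk, extend_of_mem D k.2]

theorem HasTerminalRepresentation.cashAdditiveAt [IsProbabilityMeasure P]
    (hρ : IsProcessRiskMeasure F P t ρ) (hT : ∀ s : h.Time, s ≤ T)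
    (hrep : HasTerminalRepresentation F P t ρ T) {s : h.Time} (hts : (t : ℕ∞) ≤ s) :
    CashAdditiveAt F P t ρ s := by
  have htT : (t : ℕ∞) ≤ T := hts.trans (hT s)
  refine cashAdditiveAt_of_le hts fun X hX m hm => ?_
  refine (hrep X hX).le_sub (hrep _ (hX.add (IsRInfty.payFrom hm hts))) (hρ.mem X hX).1 hm.1 ?_
  rintro u ⟨Q, hQp, hQ, hA, rfl⟩
  have hΓ := isOptionalRandomMeasureFrom_diracAt (F := F) hQ T
  refine ⟨_, ⟨Q, hQp, hQ, hA, rfl⟩, EventuallyEq.le ?_⟩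
  refine (terminalValue_ae_eq hQ hA hT htT _).trans ((condLoss_add_payFrom_sub hA
    (hΓ.1.isWeight (isLocAC_of_ac hQ) t) (hΓ.hasSum_condWeight_ge htT (hT s)) hX hm _).trans ?_)
  filter_upwards [terminalValue_ae_eq (ρ := ρ) hQ hA hT htT X] with ω hω
  rw [hω]

/-- The process that pays `Y` at time `T`. -/
def payAt (T : h.Time) (Y : Ω → ℝ) (r : h.Time) (ω : Ω) : ℝ := if r = T then Y ω else 0

theorem payAt_of_ne (Y : Ω → ℝ) {r : h.Time} (hr : r ≠ T) : payAt T Y r = 0 :=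
  funext fun _ => if_neg hr

theorem payAt_self (T : h.Time) (Y : Ω → ℝ) : payAt T Y T = Y := funext fun _ => if_pos rfl

theorem isRInfty_payAt (hFT : ⨆ s : h.Time, sig F s = mΩ) (hT : ∀ s : h.Time, s ≤ T)
    (htT : (t : ℕ∞) ≤ T) {Y : Ω → ℝ} (hY : IsLInfty mΩ P Y) : IsRInfty F P t (payAt T Y) := by
  obtain ⟨c, hc⟩ := hY.2
  refine IsRInfty.of_bound (c := max c 0) (fun r => ?_) (fun r => ?_) fun r hr => ?_
  · by_cases hr : r = T
    · subst hr
      rw [payAt_self]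
      exact hY.1.mono (le_sig_of_forall_le hFT hT) le_rfl
    · rw [payAt_of_ne Y hr]
      exact measurable_const
  · by_cases hr : r = T
    · subst hr
      rw [payAt_self]
      exact hc.mono fun ω hω => hω.trans (le_max_left _ _)
    · rw [payAt_of_ne Y hr]
      exact .of_forall fun ω => by simp
  · rw [payAt_of_ne Y]
    rintro rfl
    exact absurd hr (not_lt.2 htT)

theorem HasTerminalRepresentation.isRiskMeasure [IsProbabilityMeasure P]
    (hFT : ⨆ s : h.Time, sig F s = mΩ) (hρ : IsProcessRiskMeasure F P t ρ)
    (hT : ∀ s : h.Time, s ≤ T) (htT : (t : ℕ∞) ≤ T) (hrep : HasTerminalRepresentation F P t ρ T) :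
    IsRiskMeasure F P t fun Y => ρ (payAt T Y) where
  mem Y hY := hρ.mem _ (isRInfty_payAt hFT hT htT hY)
  cash_invariant Y hY m hm := by
    -- As `T` is the last time, an amount paid at `T` only is the same as `m 1_{𝕋_T}`. Cash
    -- invariance is thus cash additivity at `T`.
    have h1 : payAt T (fun ω => Y ω + m ω) = fun r ω => payAt T Y r ω + payFrom T m r ω := by
      funext r ω
      have h2 : (T : ℕ∞) ≤ r ↔ r = T := ⟨fun h' => (hT r).antisymm h', fun h' => by rw [h']⟩
      simp only [payAt, payFrom, h2]
      split_ifs <;> simp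
    rw [h1]
    exact hrep.cashAdditiveAt hρ hT htT _ (isRInfty_payAt hFT hT htT hY) m hm
  monotone X Y hX hY hXY := by
    refine hρ.monotone _ _ (isRInfty_payAt hFT hT htT hX) (isRInfty_payAt hFT hT htT hY) fun r => ?_
    by_cases hr : r = T
    · subst hr
      rwa [payAt_self, payAt_self]
    · rw [payAt_of_ne X hr, payAt_of_ne Y hr]
  convex X Y hX hY l hl hl01 := by
    have h1 : payAt T (fun ω => l ω * X ω + (1 - l ω) * Y ω) =
        fun r ω => l ω * payAt T X r ω + (1 - l ω) * payAt T Y r ω := by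
      funext r ω
      simp only [payAt]
      split_ifs <;> simp
    rw [h1]
    exact hρ.convex _ _ (isRInfty_payAt hFT hT htT hX) (isRInfty_payAt hFT hT htT hY) l hl hl01
  normalized := by
    have h1 : payAt T (fun _ : Ω => (0 : ℝ)) = fun _ _ => 0 := by
      funext r ω
      exact ite_self _
    rw [h1]
    exact hρ.normalized

theorem IsRInfty.terminal {X : h.Time → Ω → ℝ} (hX : IsRInfty F P t X)
    (T : h.Time) : IsLInfty mΩ P (X T) := by
  obtain ⟨c, -, hc⟩ := hX.exists_bound
  exact ⟨(hX.adapted T).mono (sig_le F T) le_rfl, c, hc T⟩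

/-- Both sides are essential suprema of the same family, since the representation depends on a
process only through its value at `T`. -/
theorem HasTerminalRepresentation.ae_eq_payAt
    (hFT : ⨆ s : h.Time, sig F s = mΩ) (hT : ∀ s : h.Time, s ≤ T) (htT : (t : ℕ∞) ≤ T)
    (hrep : HasTerminalRepresentation F P t ρ T) {X : h.Time → Ω → ℝ} (hX : IsRInfty F P t X) :
    ρ X =ᵐ[P] ρ (payAt T (X T)) := by
  have h1 := hrep _ (isRInfty_payAt hFT hT htT (hX.terminal T))
  rw [payAt_self] at h1
  filter_upwards [(hrep X hX).ae_eq h1] with ω hω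
  exact EReal.coe_eq_coe_iff.1 hω

theorem cashAdditive_of_terminal (hT : ∀ s : h.Time, s ≤ T)
    {φ : (Ω → ℝ) → Ω → ℝ} (hφ : IsRiskMeasure F P t φ)
    (hρφ : ∀ X, IsRInfty F P t X → ρ X =ᵐ[P] φ (X T)) : CashAdditive F P t ρ := by
  intro s hts X hX m hm
  have h1 : (fun ω => X T ω + payFrom s m T ω) = fun ω => X T ω + m ω :=
    funext fun ω => congrArg _ (if_pos (hT s))
  have h2 := hρφ _ (hX.add (IsRInfty.payFrom hm hts.le))
  rw [h1] at h2
  filter_upwards [h2, hφ.cash_invariant _ (hX.terminal T) m hm, hρφ X hX] with ω h3 h4 h5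
  rw [h3, h4, h5]

end ProcessRisk

theorem proposition5p9 {Ω : Type*} [mΩ : MeasurableSpace Ω] (h : Horizon)
    (F : Filtration ℕ mΩ) (P : Measure Ω) [IsProbabilityMeasure P]
    (hF0 : F 0 = ⊥) (hFT : ⨆ s : h.Time, sig F s = mΩ)
    (hstd : h.IsInfinite → IsStandardFiltration F)
    (μ : h.Time → Ω → ℝ) (hμ : IsReference F P μ)
    (t : ℕ) (ht : (t : ℕ∞) ∈ h.times)
    (ρ : (h.Time → Ω → ℝ) → Ω → ℝ) (hρ : IsProcessRiskMeasure F P t ρ)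
    (hcont : ContinuousFromAbove F P t ρ) :
    (∀ s : h.Time, (t : ℕ∞) < s →
      (CashAdditiveAt F P t ρ s ↔ NoDiscounting F P μ t ρ s) ∧
      (CashAdditiveAt F P t ρ s ↔ HasRepresentationFrom F P t ρ s) ∧
      (CashAdditiveAt F P t ρ s →
        ∀ k : h.Time, (t : ℕ∞) < k → k ≤ s → CashAdditiveAt F P t ρ k)) ∧
    (∀ T : h.Time, (∀ s : h.Time, s ≤ T) →
      (CashAdditive F P t ρ ↔ HasTerminalRepresentation F P t ρ T) ∧
      (CashAdditive F P t ρ ↔ ∃ φ : (Ω → ℝ) → Ω → ℝ, IsRiskMeasure F P t φ ∧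
        ∀ X, IsRInfty F P t X → ρ X =ᵐ[P] φ (X T))) := by
  have hrepr : ∀ s : h.Time, (t : ℕ∞) < s → NoDiscounting F P μ t ρ s →
      HasRepresentationFrom F P t ρ s := fun s hts hs =>
    hs.hasRepresentationFrom hFT hstd ht hρ hcont hμ hts.le
  have hnd : ∀ s : h.Time, (t : ℕ∞) < s → CashAdditiveAt F P t ρ s →
      NoDiscounting F P μ t ρ s := fun s hts hs => hs.noDiscounting ht hts.le hρ
  have hcash : ∀ s : h.Time, (t : ℕ∞) < s → HasRepresentationFrom F P t ρ s →
      CashAdditiveAt F P t ρ s := fun s hts hs => hs.cashAdditiveAt hts.le hρ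
  refine ⟨fun s hts => ⟨⟨hnd s hts, fun hs => hcash s hts (hrepr s hts hs)⟩,
    ⟨fun hs => hrepr s hts (hnd s hts hs), hcash s hts⟩, fun hs k htk hks => ?_⟩, fun T hT => ?_⟩
  -- The absence of discounting up to `s` contains its absence up to any earlier `k`, so cash
  -- additivity is inherited by `k`.
  · refine hcash k htk (hrepr k htk fun Q D hQ hD hmod hpen r htr hrk => ?_)
    exact hnd s hts hs Q D hQ hD hmod hpen r htr (hrk.trans hks)
  · have htT : (t : ℕ∞) ≤ T := hT ⟨t, ht⟩
    have hterm : CashAdditive F P t ρ → HasTerminalRepresentation F P t ρ T := fun hca => by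
      refine NoDiscounting.hasTerminalRepresentation hFT hstd ht hρ hcont hμ hT ?_
      -- Cash additivity gives information at `T` only if `T > t`.
      rcases htT.eq_or_lt with h1 | h1
      · exact noDiscounting_self h1.symm
      · exact hnd T h1 (hca T h1)
    refine ⟨⟨hterm, fun hrep s hts => hrep.cashAdditiveAt hρ hT hts.le⟩, fun hca => ?_, ?_⟩
    · exact ⟨_, (hterm hca).isRiskMeasure hFT hρ hT htT, fun X hX =>
        (hterm hca).ae_eq_payAt hFT hT htT hX⟩
    · rintro ⟨φ, hφ, hρφ⟩
      exact cashAdditive_of_terminal hT hφ hρφ
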